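/- Let $\Bbbk$ be a field, $S$ a $\Bbbk$-algebra, $G$ a finite group acting on $S$ by $\Bbbk$-algebra automorphisms $s\mapsto{}^gs$, and $\sigma:G\times G\to Z(S)^\times$ a normalized two-cocycle: ${}^g\sigma(h,l)\,\sigma(g,hl)=\sigma(g,h)\,\sigma(gh,l)$ and $\sigma(g,1)=1=\sigma(1,g)$. Let $R=S\#_\sigma G=\bigoplus_{g\in G}S\overline g$ be the crossed product, $(s\overline g)(t\overline h)=s({}^gt)\sigma(g,h)\overline{gh}$, and $R^e=R\otimes_\Bbbk R^{op}$. *Notation.* $\mathrm{HH}^*(R)=\mathrm{Ext}^*_{R^e}(R,R)$ is the cohomology of the complex $\mathrm{Hom}_{R^e}(R^{\otimes(n+2)},R)$, where $R^{\otimes(n+2)}$ has differential $r_0\otimes\cdots\otimes r_{n+1}\mapsto\sum_{i=0}^{n}(-1)^ir_0\otimes\cdots\otimes r_ir_{i+1}\otimes\cdots\otimes r_{n+1}$; its cup product is induced by $(f\smile f')(r_0\otimes\cdots\otimes r_{m+n+1})=f(r_0\otimes\cdots\otimes r_m\otimes1)\,f'(1\otimes r_{m+1}\otimes\cdots\otimes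 r_{m+n+1})$. For a subgroup $H\le G$ let $\Delta(H)=\bigoplus_{h\in H}S\overline h\otimes S(\overline h)^{-1}\subseteq R^e$, and $\Delta=\Delta(G)$. Let $\Delta_n\subseteq R^{\otimes(n+2)}$ be the span of all $s_0\overline{g_0}\otimes\cdots\otimes s_{n+1}\overline{g_{n+1}}$ with $g_0\cdots g_{n+1}=1$, with the restricted differential. For a $\Delta(H)$-stable subspace $N\subseteq R$, $\mathrm{Ext}^*_{\Delta(H)}(S,N)$ is the cohomology of $\mathrm{Hom}_{\Delta(H)}(\Delta_\bullet,N)$. On these groups one has, for $K\le H$ and $x\in G$: the restriction $\mathrm{res}^H_K$ (regard a $\Delta(H)$-map as a $\Delta(K)$-map); the conjugation $x^*:\mathrm{Ext}^*_{\Delta(H)}(S,N)\to\mathrm{Ext}^*_{\Delta({}^xH)}(S,\overline xN\overline x^{-1})$, $(x^*f)(p)=\overline x f(\overline x^{-1}p\,\overline x)\overline x^{-1}$, where ${}^xH=xHx^{-1}$; the corestriction $\mathrm{cores}^H_K(f)(p)=\sum_{g\in H/K}\overline g f(\overline g^{-1}p\,\overline g)\overline g^{-1}$; the maps $\theta_g^*$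 and $\pi_g^*$ (the latter over $\Delta(W)$ with $W\le C(g)$) induced by the inclusion $\theta_g:S\overline g\to R$ and the projection $\pi_g:R\to S\overline g$; and, for $N=R$, the cup product $(f\smile f')(r_0\otimes\cdots\otimes r_{m+n+1})=f(r_0\otimes\cdots\otimes r_m\otimes\overline h^{-1})\,f'(\overline h\otimes r_{m+1}\otimes\cdots\otimes r_{m+n+1})$ for $r_i\in S\overline{g_i}$, $g_0\cdots g_{m+n+1}=1$, $h=g_0\cdots g_m$. Write ${}^xg=xgx^{-1}$ and let $C(g)$ be the centralizer of $g$ in $G$. Put $A(g)=\mathrm{Ext}^*_{\Delta(C(g))}(S,S\overline g)$ and $\gamma_g=\mathrm{cores}^G_{C(g)}\circ\theta_g^*:A(g)\to\mathrm{Ext}^*_\Delta(S,R)$. Let $g_1,\dots,g_t$ represent the conjugacy classes of $G$, each once; $\gamma_i=\gamma_{g_i}$, $\pi_i=\pi_{g_i}$. **Theorem.** 1. $R^{\otimes(\bullet+2)}\to R$ is a projective resolution of $R$ over $R^e$, and, for every subgroup $H\le G$, $\Delta_\bullet\to S$ is a projective resolution of $S$ over $\Delta(H)$. $\mathrm{HH}^*(R)$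 is an associative algebra with unit, and restriction of maps from $R^{\otimes(n+2)}$ to $\Delta_n$ gives an isomorphism $\mathrm{HH}^*(R)\cong\mathrm{Ext}^*_\Delta(S,R)$ compatible with cup products. 2. The map $(\alpha_i)_i\mapsto\sum_i\gamma_i(\alpha_i)$ is a linear isomorphism $\bigoplus_{i=1}^tA(g_i)\cong\mathrm{Ext}^*_\Delta(S,R)\cong\mathrm{HH}^*(R)$ with inverse $\zeta\mapsto(\pi_i^*\,\mathrm{res}^G_{C(g_i)}\zeta)_i$. 3. (Product formula.) Let $\alpha\in A(g_i)$, $\beta\in A(g_j)$, and let $D$ be any set of representatives of the double cosets $C(g_i)\backslash G/C(g_j)$. For each $x\in D$ there are $k=k(x)$ and $y=y(x)\in G$ with $g_k={}^yg_i\,{}^{yx}g_j$, and for every such choice, with $W_x={}^yC(g_i)\cap{}^{yx}C(g_j)\le C(g_k)$, the cup product of $\gamma_i(\alpha)$ and $\gamma_j(\beta)$ in $\mathrm{HH}^*(R)$ is $$\sum_{x\in D}\gamma_k\Bigl(\mathrm{cores}^{C(g_k)}_{W_x}\,\pi_k^*\bigl(\theta^*_{{}^yg_i}\mathrm{res}^{{}^yC(g_i)}_{W_x}y^*\alpha\smile\theta^*_{{}^{yx}g_j}\mathrm{res}^{{}^{yx}C(g_j)}_{W_x}(yx)^*\beta\bigr)\Bigr).$$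 4. Let $c_x=x^*:A(g)\to A({}^xg)$ and $m_{g,h}:A(g)\times A(h)\to A(gh)$, $$m_{g,h}(\alpha,\beta)=\mathrm{cores}^{C(gh)}_{C(g)\cap C(h)}\,\pi_{gh}^*\bigl(\theta_g^*\mathrm{res}^{C(g)}_{C(g)\cap C(h)}\alpha\smile\theta_h^*\mathrm{res}^{C(h)}_{C(g)\cap C(h)}\beta\bigr).$$ Then $c_1=\mathrm{id}$, $c_xc_y=c_{xy}$, $c_x(m_{g,h}(\alpha,\beta))=m_{{}^xg,{}^xh}(c_x\alpha,c_x\beta)$, and there is $u\in A(1)$ with $c_x(u)=u$ for all $x$ and $m_{1,g}(u,\alpha)=\alpha=m_{g,1}(\alpha,u)$ for all $g$ and $\alpha\in A(g)$. Let $A^G$ be the space of families $\alpha=(\alpha_g)_{g}\in\bigoplus_{g\in G}A(g)$ with $c_x(\alpha_g)=\alpha_{{}^xg}$ for all $x,g$. For $\alpha,\beta\in A^G$ put $$(\alpha\cdot\beta)_g=\sum_{(h,l)}m_{h,l}(\alpha_h,\beta_l),$$ the sum over representatives of the orbits of $C(g)$, acting by simultaneous conjugation, on $\{(h,l)\in G\times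 G: hl=g\}$. This does not depend on the representatives, and makes $A^G$ an associative algebra whose unit is the family with component $u$ at $1$ and $0$ elsewhere. The map $\alpha\mapsto(\alpha_{g_i})_i$ is a bijection $A^G\to\bigoplus_iA(g_i)$, and $\alpha\mapsto\sum_i\gamma_i(\alpha_{g_i})$ is an isomorphism of unital algebras $A^G\cong\mathrm{HH}^*(R)$. -/

import Mathlib

open scoped TensorProduct DirectSum
open MulOpposite

noncomputable section

namespace CrossedHH

/-! ## Cohomology of a cochain complex of `k`-modules -/

section Cohomology

variable {k : Type*} [CommRing k]
variable {X : ℕ → Type*} [∀ n, AddCommGroup (X n)] [∀ n, Module k (X n)]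
variable {Y : ℕ → Type*} [∀ n, AddCommGroup (Y n)] [∀ n, Module k (Y n)]

/-- The coboundaries of a cochain complex `X 0 → X 1 → X 2 → ⋯`. -/
def coboundaries (d : ∀ n, X n →ₗ[k] X (n + 1)) : ∀ n, Submodule k (X n)
  | 0 => ⊥
  | n + 1 => LinearMap.range (d n)

/-- The cohomology `Ker (d n) / Im (d (n - 1))` of a cochain complex `X 0 → X 1 → X 2 → ⋯`. -/
def Coh (d : ∀ n, X n →ₗ[k] X (n + 1)) (n : ℕ) : Type _ :=
  LinearMap.ker (d n) ⧸ (coboundaries d n).submoduleOf (LinearMap.ker (d n))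

instance (d : ∀ n, X n →ₗ[k] X (n + 1)) (n : ℕ) : AddCommGroup (Coh d n) :=
  inferInstanceAs
    (AddCommGroup (LinearMap.ker (d n) ⧸ (coboundaries d n).submoduleOf (LinearMap.ker (d n))))

instance (d : ∀ n, X n →ₗ[k] X (n + 1)) (n : ℕ) : Module k (Coh d n) :=
  inferInstanceAs
    (Module k (LinearMap.ker (d n) ⧸ (coboundaries d n).submoduleOf (LinearMap.ker (d n))))

/-- The map that sends a cocycle to its cohomology class. -/
def Coh.proj (d : ∀ n, X n →ₗ[k] X (n + 1)) (n : ℕ) : LinearMap.ker (d n) →ₗ[k] Coh d n :=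
  Submodule.mkQ _

/-- The cohomology class of a cocycle. -/
def Coh.mk (d : ∀ n, X n →ₗ[k] X (n + 1)) {n : ℕ} (x : X n) (hx : d n x = 0) : Coh d n :=
  Coh.proj d n ⟨x, hx⟩

theorem Coh.proj_surjective (d : ∀ n, X n →ₗ[k] X (n + 1)) (n : ℕ) :
    Function.Surjective (Coh.proj d n) :=
  Submodule.mkQ_surjective _

theorem Coh.proj_eq_zero (d : ∀ n, X n →ₗ[k] X (n + 1)) {n : ℕ} (x : LinearMap.ker (d n)) :
    Coh.proj d n x = 0 ↔ x.1 ∈ coboundaries d n :=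
  Submodule.Quotient.mk_eq_zero _

/-- The linear map on cohomology defined by a linear map on cocycles that vanishes on
coboundaries. -/
def Coh.lift {d : ∀ n, X n →ₗ[k] X (n + 1)} {n : ℕ} {M : Type*} [AddCommGroup M] [Module k M]
    (f : LinearMap.ker (d n) →ₗ[k] M) (hf : ∀ x, x.1 ∈ coboundaries d n → f x = 0) :
    Coh d n →ₗ[k] M :=
  Submodule.liftQ _ f hf

@[simp]
theorem Coh.lift_proj {d : ∀ n, X n →ₗ[k] X (n + 1)} {n : ℕ} {M : Type*} [AddCommGroup M]
    [Module k M] (f : LinearMap.ker (d n) →ₗ[k] M) (hf : ∀ x, x.1 ∈ coboundaries d n → f x = 0)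
    (x : LinearMap.ker (d n)) : Coh.lift f hf (Coh.proj d n x) = f x :=
  rfl

theorem map_coboundaries {dX : ∀ n, X n →ₗ[k] X (n + 1)} {dY : ∀ n, Y n →ₗ[k] Y (n + 1)}
    (φ : ∀ n, X n →ₗ[k] Y n) (h : ∀ n x, φ (n + 1) (dX n x) = dY n (φ n x)) (n : ℕ) (x : X n)
    (hx : x ∈ coboundaries dX n) : φ n x ∈ coboundaries dY n := by
  cases n with
  | zero =>
    have : x = 0 := hx
    subst this
    simp
  | succ n =>
    obtain ⟨y, rfl⟩ := hx
    exact ⟨φ n y, (h n y).symm⟩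

/-- The map induced on cohomology by a map of cochain complexes. -/
def Coh.map {dX : ∀ n, X n →ₗ[k] X (n + 1)} {dY : ∀ n, Y n →ₗ[k] Y (n + 1)}
    (φ : ∀ n, X n →ₗ[k] Y n) (h : ∀ n x, φ (n + 1) (dX n x) = dY n (φ n x)) (n : ℕ) :
    Coh dX n →ₗ[k] Coh dY n :=
  Coh.lift ((Coh.proj dY n).comp
    ((φ n).restrict (p := LinearMap.ker (dX n)) (q := LinearMap.ker (dY n)) (fun x hx => by
      rw [LinearMap.mem_ker] at hx ⊢
      rw [← h, hx, map_zero])))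
    (fun x hx => (Coh.proj_eq_zero dY _).2 (map_coboundaries φ h n x.1 hx))

theorem Coh.map_mk {dX : ∀ n, X n →ₗ[k] X (n + 1)} {dY : ∀ n, Y n →ₗ[k] Y (n + 1)}
    (φ : ∀ n, X n →ₗ[k] Y n) (h : ∀ n x, φ (n + 1) (dX n x) = dY n (φ n x)) {n : ℕ}
    (x : X n) (hx : dX n x = 0) :
    Coh.map φ h n (Coh.mk dX x hx) = Coh.mk dY (φ n x) (by rw [← h, hx, map_zero]) :=
  rfl

/-- The bilinear map induced on cohomology by a bilinear pairing of cochains that sends pairs of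
cocycles to cocycles, and to coboundaries if one of the two is a coboundary. -/
def Coh.map₂ {d : ∀ n, X n →ₗ[k] X (n + 1)} {m n N : ℕ} (μ : X m →ₗ[k] X n →ₗ[k] X N)
    (hZ : ∀ x y, d m x = 0 → d n y = 0 → d N (μ x y) = 0)
    (hl : ∀ x y, x ∈ coboundaries d m → d n y = 0 → μ x y ∈ coboundaries d N)
    (hr : ∀ x y, d m x = 0 → y ∈ coboundaries d n → μ x y ∈ coboundaries d N) :
    Coh d m →ₗ[k] Coh d n →ₗ[k] Coh d N :=
  let ν : LinearMap.ker (d m) →ₗ[k] LinearMap.ker (d n) →ₗ[k] Coh d N :=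
    LinearMap.mk₂ k (fun x y => Coh.proj d N ⟨μ x.1 y.1, hZ _ _ x.2 y.2⟩)
      (fun x x' y => by
        rw [← map_add]
        exact congrArg _ (Subtype.ext (LinearMap.map_add₂ _ _ _ _)))
      (fun c x y => by
        rw [← map_smul]
        exact congrArg _ (Subtype.ext (LinearMap.map_smul₂ _ _ _ _)))
      (fun x y y' => by
        rw [← map_add]
        exact congrArg _ (Subtype.ext (map_add _ _ _)))
      (fun c x y => by
        rw [← map_smul]
        exact congrArg _ (Subtype.ext (map_smul _ _ _)))
  LinearMap.flip (Coh.lift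
    (LinearMap.flip (Coh.lift ν (fun x hx => LinearMap.ext fun y =>
      (Coh.proj_eq_zero d _).2 (hl x.1 y.1 hx y.2))))
    (fun y hy => LinearMap.ext fun x => by
      obtain ⟨x, rfl⟩ := Coh.proj_surjective d m x
      exact (Coh.proj_eq_zero d _).2 (hr x.1 y.1 x.2 hy)))

theorem Coh.map₂_mk {d : ∀ n, X n →ₗ[k] X (n + 1)} {m n N : ℕ} (μ : X m →ₗ[k] X n →ₗ[k] X N)
    (hZ : ∀ x y, d m x = 0 → d n y = 0 → d N (μ x y) = 0)
    (hl : ∀ x y, x ∈ coboundaries d m → d n y = 0 → μ x y ∈ coboundaries d N)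
    (hr : ∀ x y, d m x = 0 → y ∈ coboundaries d n → μ x y ∈ coboundaries d N)
    (x : X m) (hx : d m x = 0) (y : X n) (hy : d n y = 0) :
    Coh.map₂ μ hZ hl hr (Coh.mk d x hx) (Coh.mk d y hy) = Coh.mk d (μ x y) (hZ x y hx hy) :=
  rfl

end Cohomology

/-! ## The Hochschild complex of a `k`-algebra -/

section Hochschild

variable {k : Type*} [CommRing k] {R : Type*} [Ring R] [Algebra k R]

/-- A function of a tuple that is linear in every slot, as a multilinear map. -/
def mkMultilinear {N : ℕ} {M : Type*} [AddCommGroup M] [Module k M] (F : (Fin N → R) → M)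
    (h : ∀ (r : Fin N → R) (i : Fin N),
      ∃ L : R →ₗ[k] M, ∀ x, F (Function.update r i x) = L x) :
    MultilinearMap k (fun _ : Fin N => R) M where
  toFun := F
  map_update_add' := by
    intro inst r i x y
    obtain rfl : inst = instDecidableEqFin N := Subsingleton.elim _ _
    obtain ⟨L, hL⟩ := h r i
    rw [hL, hL, hL, map_add]
  map_update_smul' := by
    intro inst r i c x
    obtain rfl : inst = instDecidableEqFin N := Subsingleton.elim _ _
    obtain ⟨L, hL⟩ := h r i
    rw [hL, hL, map_smul]

/-- The tuple obtained from `r` by multiplying the entries with indices `i` and `i + 1`. -/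
def contract {A : Type*} [Mul A] {n : ℕ} (i : ℕ) (r : Fin (n + 1) → A) : Fin n → A := fun j =>
  if (j : ℕ) < i then r j.castSucc else if (j : ℕ) = i then r j.castSucc * r j.succ else r j.succ

theorem contract_update {n : ℕ} (i : ℕ) (hi : i < n) (r : Fin (n + 1) → R) (j : Fin (n + 1)) :
    ∃ (l : Fin n) (L : R →ₗ[k] R), ∀ x,
      contract i (Function.update r j x) = Function.update (contract i r) l (L x) := by
  rcases lt_trichotomy (j : ℕ) i with h | h | h
  · refine ⟨⟨j, by omega⟩, LinearMap.id, fun x => ?_⟩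
    ext l
    by_cases hl : l = ⟨j, by omega⟩
    · subst hl
      have h1 : (Fin.castSucc (⟨j, by omega⟩ : Fin n)) = j := by ext; simp
      simp [contract, h, h1]
    · have h1 : l.castSucc ≠ j := fun h' => hl (by ext; simp [← h'])
      rw [Function.update_of_ne hl]
      unfold contract
      split_ifs with h2 h3
      · rw [Function.update_of_ne h1]
      · have h4 : l.succ ≠ j := fun h' => by
          have := congrArg Fin.val h'; simp at this; omega
        rw [Function.update_of_ne h1, Function.update_of_ne h4]
      · have h4 : l.succ ≠ j := fun h' => by
          have := congrArg Fin.val h'; simp at this; omega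
        rw [Function.update_of_ne h4]
  · subst h
    refine ⟨⟨j, by omega⟩, LinearMap.mulRight k (r ⟨j + 1, by omega⟩), fun x => ?_⟩
    ext l
    by_cases hl : l = ⟨j, by omega⟩
    · subst hl
      have h3 : (⟨j + 1, by omega⟩ : Fin (n + 1)) ≠ j := fun h' => by
        have := congrArg Fin.val h'; simp at this
      simp [contract, Function.update_of_ne h3]
    · have h1 : l.castSucc ≠ j := fun h' => hl (by ext; simp [← h'])
      have h5 : (l : ℕ) ≠ j := fun h' => hl (by ext; simp [h'])
      rw [Function.update_of_ne hl]
      unfold contract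
      split_ifs with h2
      · rw [Function.update_of_ne h1]
      · have h4 : l.succ ≠ j := fun h' => by
          have := congrArg Fin.val h'; simp at this; omega
        rw [Function.update_of_ne h4]
  · by_cases hij : (j : ℕ) = i + 1
    · refine ⟨⟨i, hi⟩, LinearMap.mulLeft k (r ⟨i, by omega⟩), fun x => ?_⟩
      ext l
      by_cases hl : l = ⟨i, hi⟩
      · subst hl
        have h1 : (Fin.castSucc (⟨i, by omega⟩ : Fin n)) = ⟨i, by omega⟩ := by ext; simp
        have h2 : (Fin.succ (⟨i, by omega⟩ : Fin n)) = j := by ext; simp [hij]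
        have h3 : (⟨i, by omega⟩ : Fin (n + 1)) ≠ j := fun h' => by
          have := congrArg Fin.val h'; simp at this; omega
        simp [contract, h1, h2, Function.update_of_ne h3]
      · have h5 : (l : ℕ) ≠ i := fun h' => hl (by ext; simp [h'])
        rw [Function.update_of_ne hl]
        unfold contract
        split_ifs with h2
        · have h4 : l.castSucc ≠ j := fun h' => by
            have := congrArg Fin.val h'; simp at this; omega
          rw [Function.update_of_ne h4]
        · have h4 : l.succ ≠ j := fun h' => by
            have := congrArg Fin.val h'; simp at this; omega
          rw [Function.update_of_ne h4]
    · refine ⟨⟨j - 1, by omega⟩, LinearMap.id, fun x => ?_⟩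
      ext l
      by_cases hl : l = ⟨j - 1, by omega⟩
      · subst hl
        have h2 : (Fin.succ (⟨j - 1, by omega⟩ : Fin n)) = j := by ext; simp; omega
        have h3 : ¬ ((j : ℕ) - 1 < i) := by omega
        have h4 : ¬ ((j : ℕ) - 1 = i) := by omega
        simp [contract, h2, h3, h4]
      · have h5 : (l : ℕ) ≠ j - 1 := fun h' => hl (by ext; simp [h'])
        have h4 : l.succ ≠ j := fun h' => by
            have := congrArg Fin.val h'; simp at this; omega
        rw [Function.update_of_ne hl]
        unfold contract
        split_ifs with h2 h3
        · have h4 : l.castSucc ≠ j := fun h' => by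
            have := congrArg Fin.val h'; simp at this; omega
          rw [Function.update_of_ne h4]
        · have h6 : l.castSucc ≠ j := fun h' => by
            have := congrArg Fin.val h'; simp at this; omega
          rw [Function.update_of_ne h4, Function.update_of_ne h6]
        · rw [Function.update_of_ne h4]

variable (k R)

/-- The enveloping algebra `R ⊗ Rᵒᵖ`. -/
abbrev Env : Type _ := R ⊗[k] Rᵐᵒᵖ

/-- The tensor power `R^{⊗ (n + 2)}`, the `n`-th term of the Hochschild (bar) resolution. -/
def Bar (n : ℕ) : Type _ := PiTensorProduct k (fun _ : Fin (n + 2) => R)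

instance (n : ℕ) : AddCommGroup (Bar k R n) :=
  inferInstanceAs (AddCommGroup (PiTensorProduct k (fun _ : Fin (n + 2) => R)))

instance (n : ℕ) : Module k (Bar k R n) :=
  inferInstanceAs (Module k (PiTensorProduct k (fun _ : Fin (n + 2) => R)))

variable {R}

/-- The pure tensor `r_0 ⊗ ⋯ ⊗ r_{n+1}`. -/
def Bar.tprod {n : ℕ} : MultilinearMap k (fun _ : Fin (n + 2) => R) (Bar k R n) :=
  PiTensorProduct.tprod k

variable {k}

/-- The linear map on `R^{⊗ (n + 2)}` defined by a multilinear map. -/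
def Bar.lift {n : ℕ} {M : Type*} [AddCommGroup M] [Module k M]
    (φ : MultilinearMap k (fun _ : Fin (n + 2) => R) M) : Bar k R n →ₗ[k] M :=
  PiTensorProduct.lift φ

@[simp]
theorem Bar.lift_tprod {n : ℕ} {M : Type*} [AddCommGroup M] [Module k M]
    (φ : MultilinearMap k (fun _ : Fin (n + 2) => R) M) (r : Fin (n + 2) → R) :
    Bar.lift φ (Bar.tprod k r) = φ r :=
  PiTensorProduct.lift.tprod r

theorem Bar.hom_ext {n : ℕ} {M : Type*} [AddCommGroup M] [Module k M]
    {f g : Bar k R n →ₗ[k] M} (h : ∀ r, f (Bar.tprod k r) = g (Bar.tprod k r)) : f = g :=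
  PiTensorProduct.ext (MultilinearMap.ext h)

/-- The endomorphism `L_0 ⊗ ⋯ ⊗ L_{n+1}` of `R^{⊗ (n + 2)}`. -/
def Bar.map {n : ℕ} (L : Fin (n + 2) → R →ₗ[k] R) : Bar k R n →ₗ[k] Bar k R n :=
  PiTensorProduct.map L

theorem Bar.map_tprod {n : ℕ} (L : Fin (n + 2) → R →ₗ[k] R) (r : Fin (n + 2) → R) :
    Bar.map L (Bar.tprod k r) = Bar.tprod k (fun i => L i (r i)) :=
  PiTensorProduct.map_tprod _ _

/-- The endomorphism of `R^{⊗ (n + 2)}` that applies `L` in slot `i`. -/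
def Bar.slot {n : ℕ} (i : Fin (n + 2)) : (R →ₗ[k] R) →ₗ[k] Module.End k (Bar k R n) :=
  (PiTensorProduct.mapMultilinear k (fun _ : Fin (n + 2) => R) (fun _ => R)).toLinearMap
    (fun _ => LinearMap.id) i

theorem Bar.slot_tprod {n : ℕ} (i : Fin (n + 2)) (L : R →ₗ[k] R) (r : Fin (n + 2) → R) :
    Bar.slot i L (Bar.tprod k r) = Bar.tprod k (Function.update r i (L (r i))) := by
  change PiTensorProduct.map _ (PiTensorProduct.tprod k r) = PiTensorProduct.tprod k _
  rw [PiTensorProduct.map_tprod]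
  congr 1
  ext j
  by_cases h : j = i
  · subst h; simp
  · simp [h]

/-- The left action of `R` on `R^{⊗ (n + 2)}`, on the first factor. -/
def Bar.left (n : ℕ) : R →ₐ[k] Module.End k (Bar k R n) :=
  AlgHom.ofLinearMap ((Bar.slot 0).comp (LinearMap.mul k R))
    (Bar.hom_ext fun r => by simp [Bar.slot_tprod])
    (fun a b => Bar.hom_ext fun r => by simp [Bar.slot_tprod, mul_assoc])

/-- The right action of `R` on `R^{⊗ (n + 2)}`, on the last factor. -/
def Bar.right (n : ℕ) : Rᵐᵒᵖ →ₐ[k] Module.End k (Bar k R n) :=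
  AlgHom.ofLinearMap ((Bar.slot (Fin.last (n + 1))).comp
      ((LinearMap.mul k R).flip.comp (MulOpposite.opLinearEquiv k).symm.toLinearMap))
    (Bar.hom_ext fun r => by simp [Bar.slot_tprod])
    (fun a b => Bar.hom_ext fun r => by simp [Bar.slot_tprod, mul_assoc])

/-- The action of `R ⊗ Rᵒᵖ` on `R^{⊗ (n + 2)}`. -/
def Bar.act (n : ℕ) : Env k R →ₐ[k] Module.End k (Bar k R n) :=
  Algebra.TensorProduct.lift (Bar.left n) (Bar.right n) (fun a b => by
    refine Bar.hom_ext fun r => ?_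
    have h : (0 : Fin (n + 2)) ≠ Fin.last (n + 1) := by simp [Fin.ext_iff]
    simp [Bar.left, Bar.right, Bar.slot_tprod, h, h.symm, Function.update_comm h])

instance (n : ℕ) : Module (Env k R) (Bar k R n) := Module.compHom _ (Bar.act n).toRingHom

theorem Bar.smul_def {n : ℕ} (a : Env k R) (x : Bar k R n) : a • x = Bar.act n a x := rfl

/-- The tuple `r` with the first entry multiplied by `a` from the left and the last entry
multiplied by `b` from the right. -/
def sandwich {A : Type*} [Monoid A] {n : ℕ} (a b : A) (r : Fin (n + 2) → A) : Fin (n + 2) → A :=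
  fun i =>
    (if (i : ℕ) = 0 then a else 1) * r i * (if (i : ℕ) = n + 1 then b else 1)

theorem Bar.tmul_smul_tprod {n : ℕ} (a b : R) (r : Fin (n + 2) → R) :
    ((a ⊗ₜ[k] op b : Env k R) • Bar.tprod k r : Bar k R n) = Bar.tprod k (sandwich a b r) := by
  rw [Bar.smul_def]
  have h : (0 : Fin (n + 2)) ≠ Fin.last (n + 1) := by simp [Fin.ext_iff]
  simp only [act, Algebra.TensorProduct.lift_tmul, Module.End.mul_apply, left, right,
    AlgHom.ofLinearMap_apply, LinearMap.comp_apply, slot_tprod]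
  congr 1
  ext i
  unfold sandwich
  by_cases h0 : i = 0
  · subst h0
    simp [h]
  · have h0' : (i : ℕ) ≠ 0 := fun h' => h0 (by ext; simpa using h')
    by_cases h1 : i = Fin.last (n + 1)
    · subst h1
      simp [h.symm]
    · have h1' : (i : ℕ) ≠ n + 1 := fun h' => h1 (by ext; simpa using h')
      simp [h0, h1, h0', h1']

variable (k R)

/-- The differential `r_0 ⊗ ⋯ ⊗ r_{n+2} ↦ ∑ i, (-1)^i r_0 ⊗ ⋯ ⊗ r_i r_{i+1} ⊗ ⋯ ⊗ r_{n+2}` of the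
Hochschild resolution. -/
def barD (n : ℕ) : Bar k R (n + 1) →ₗ[k] Bar k R n :=
  ∑ i : Fin (n + 2), (-1 : k) ^ (i : ℕ) •
    Bar.lift (mkMultilinear (fun r => Bar.tprod k (contract i r)) (fun r j => by
      obtain ⟨l, L, h⟩ := contract_update (k := k) i i.2 r j
      exact ⟨((Bar.tprod k).toLinearMap (contract i r) l).comp L, fun x => by rw [h x]; rfl⟩))

/-- The augmentation `r_0 ⊗ r_1 ↦ r_0 r_1` of the Hochschild resolution. -/
def barAug : Bar k R 0 →ₗ[k] R :=
  Bar.lift (mkMultilinear (fun r => r 0 * r 1) (fun r j => by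
    by_cases h : j = 0
    · subst h
      exact ⟨LinearMap.mulRight k (r 1), fun x => by simp⟩
    · have h1 : j = 1 := Fin.eq_one_of_ne_zero j h
      subst h1
      exact ⟨LinearMap.mulLeft k (r 0), fun x => by simp⟩))

variable {k R}

theorem barD_tprod (n : ℕ) (r : Fin (n + 3) → R) :
    barD k R n (Bar.tprod k r) =
      ∑ i ∈ Finset.range (n + 2), (-1 : k) ^ i • Bar.tprod k (contract i r) := by
  rw [← Fin.sum_univ_eq_sum_range
    (fun i => (-1 : k) ^ i • (Bar.tprod k (contract i r) : Bar k R n))]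
  simp only [barD, LinearMap.sum_apply, LinearMap.smul_apply, Bar.lift_tprod]
  rfl

theorem barAug_tprod (r : Fin 2 → R) : barAug k R (Bar.tprod k r) = r 0 * r 1 := by
  simp only [barAug, Bar.lift_tprod]
  rfl

theorem contract_sandwich {n : ℕ} (i : ℕ) (hi : i < n + 2) (a b : R) (r : Fin (n + 3) → R) :
    contract i (sandwich a b r) = sandwich a b (contract i r) := by
  ext j
  have hj := j.2
  simp only [contract, sandwich, Fin.val_castSucc, Fin.val_succ]
  by_cases h1 : (j : ℕ) < i
  · have h2 : (j : ℕ) ≠ n + 2 := by omega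
    have h3 : (j : ℕ) ≠ n + 1 := by omega
    simp [h1, h2, h3]
  · by_cases h2 : (j : ℕ) = i
    · subst h2
      have h3 : (j : ℕ) ≠ n + 2 := by omega
      simp [mul_assoc, h3]
    · have h3 : (j : ℕ) ≠ 0 := by omega
      simp [h1, h2, h3]

theorem barD_smul (n : ℕ) (a : Env k R) (x : Bar k R (n + 1)) :
    barD k R n (a • x) = a • barD k R n x := by
  suffices h : (barD k R n).comp (Bar.act (n + 1) a) = (Bar.act n a).comp (barD k R n) from
    LinearMap.congr_fun h x
  induction a using TensorProduct.induction_on with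
  | zero => simp
  | add a b ha hb => rw [map_add, map_add, LinearMap.comp_add, LinearMap.add_comp, ha, hb]
  | tmul a b =>
    refine Bar.hom_ext fun r => ?_
    have h := fun m => Bar.tmul_smul_tprod (k := k) (n := m) a b.unop
    simp only [op_unop, Bar.smul_def] at h
    rw [LinearMap.comp_apply, LinearMap.comp_apply, h, barD_tprod, barD_tprod, map_sum]
    refine Finset.sum_congr rfl fun i hi => ?_
    rw [map_smul, h, contract_sandwich i (Finset.mem_range.1 hi)]

theorem barAug_smul (a : Env k R) (x : Bar k R 0) :
    barAug k R (a • x) = AlgHom.mulLeftRight k R a (barAug k R x) := by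
  suffices h : (barAug k R).comp (Bar.act 0 a) =
      (AlgHom.mulLeftRight k R a).comp (barAug k R) from LinearMap.congr_fun h x
  induction a using TensorProduct.induction_on with
  | zero => simp
  | add a b ha hb => rw [map_add, map_add, LinearMap.comp_add, LinearMap.add_comp, ha, hb]
  | tmul a b =>
    refine Bar.hom_ext fun r => ?_
    have h := Bar.tmul_smul_tprod (k := k) (n := 0) a b.unop
    simp only [op_unop, Bar.smul_def] at h
    rw [LinearMap.comp_apply, LinearMap.comp_apply, h, barAug_tprod, barAug_tprod]
    simp [sandwich, mul_assoc]

theorem barAug_barD (x : Bar k R 1) : barAug k R (barD k R 0 x) = 0 := by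
  suffices h : (barAug k R).comp (barD k R 0) = 0 from LinearMap.congr_fun h x
  refine Bar.hom_ext fun r => ?_
  rw [LinearMap.comp_apply, barD_tprod]
  simp [Finset.sum_range_succ, barAug_tprod, contract, mul_assoc]

variable (k R)

/-- The Hochschild cochains `Hom_{R ⊗ Rᵒᵖ}(R^{⊗ (n + 2)}, R)`; the enveloping algebra acts on `R` by
`(a ⊗ b) • r = a * r * b`. -/
def hochCochain (n : ℕ) : Submodule k (Bar k R n →ₗ[k] R) where
  carrier := {f | ∀ (a : Env k R) (x : Bar k R n), f (a • x) = AlgHom.mulLeftRight k R a (f x)}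
  add_mem' hf hg a x := by simp [hf a x, hg a x]
  zero_mem' a x := by simp
  smul_mem' c f hf a x := by simp [hf a x]

/-- The module of Hochschild cochains of degree `n`. -/
def HochCochain (n : ℕ) : Type _ := hochCochain k R n

instance (n : ℕ) : AddCommGroup (HochCochain k R n) :=
  inferInstanceAs (AddCommGroup (hochCochain k R n))

instance (n : ℕ) : Module k (HochCochain k R n) :=
  inferInstanceAs (Module k (hochCochain k R n))

/-- The differential of the Hochschild cochain complex, composition with `barD`. -/
def hochD (n : ℕ) : HochCochain k R n →ₗ[k] HochCochain k R (n + 1) :=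
  (LinearMap.lcomp k R (barD k R n)).restrict (p := hochCochain k R n)
    (q := hochCochain k R (n + 1)) (fun f hf a x => by
      simp only [LinearMap.lcomp_apply, barD_smul, hf a])

/-- Hochschild cohomology `HH^n(R) = Ext^n_{R ⊗ Rᵒᵖ}(R, R)`, computed by the Hochschild complex. -/
abbrev HH (n : ℕ) : Type _ := Coh (hochD k R) n

variable {k R}

/-! ### Cup products of cochains -/

/-- The tuple `(r_0, …, r_m, y)`. -/
def headTuple {m N : ℕ} (h : m ≤ N) (r : Fin (N + 2) → R) (y : R) : Fin (m + 2) → R := fun i =>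
  if hi : (i : ℕ) ≤ m then r ⟨i, by omega⟩ else y

/-- The tuple `(y, r_{m+1}, …, r_{m+n+1})`. -/
def tailTuple {m n N : ℕ} (h : m + n = N) (y : R) (r : Fin (N + 2) → R) : Fin (n + 2) → R :=
  fun i => if (i : ℕ) = 0 then y else r ⟨m + i, by omega⟩

/-- For finite families `a, b` of elements of `R`, the product of cochains
`(f, f') ↦ (r_0 ⊗ ⋯ ⊗ r_{m+n+1} ↦
  ∑ e, f (r_0 ⊗ ⋯ ⊗ r_m ⊗ a e) * f' (b e ⊗ r_{m+1} ⊗ ⋯ ⊗ r_{m+n+1}))`. -/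
def barCup {ι : Type*} [Fintype ι] (a b : ι → R) {m n N : ℕ} (h : m + n = N) :
    (Bar k R m →ₗ[k] R) →ₗ[k] (Bar k R n →ₗ[k] R) →ₗ[k] (Bar k R N →ₗ[k] R) :=
  LinearMap.mk₂ k (fun f f' => Bar.lift (mkMultilinear
    (fun r => ∑ e, f (Bar.tprod k (headTuple (by omega) r (a e))) *
      f' (Bar.tprod k (tailTuple h (b e) r)))
    (fun r j => by
      by_cases hj : (j : ℕ) ≤ m
      · refine ⟨∑ e, (LinearMap.mulRight k (f' (Bar.tprod k (tailTuple h (b e) r)))).comp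
          (f.comp ((Bar.tprod k).toLinearMap (headTuple (by omega) r (a e))
            ⟨j, by omega⟩)), fun x => ?_⟩
        rw [LinearMap.sum_apply]
        refine Finset.sum_congr rfl fun e _ => ?_
        have h1 : headTuple (m := m) (by omega) (Function.update r j x) (a e) =
            Function.update (headTuple (by omega) r (a e)) ⟨j, by omega⟩ x := by
          ext i
          by_cases hi : i = ⟨j, by omega⟩
          · subst hi
            simp [headTuple, hj]
          · have hi' : (i : ℕ) ≠ j := fun h' => hi (by ext; exact h')
            rw [Function.update_of_ne hi]
            unfold headTuple
            split_ifs with h2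
            · rw [Function.update_of_ne (fun h' => hi' (congrArg Fin.val h'))]
            · rfl
        have h2 : tailTuple h (b e) (Function.update r j x) = tailTuple h (b e) r := by
          ext i
          unfold tailTuple
          split_ifs with h2
          · rfl
          · rw [Function.update_of_ne (fun h' => by have := congrArg Fin.val h'; simp at this; omega)]
        rw [h1, h2]
        rfl
      · refine ⟨∑ e, (LinearMap.mulLeft k
          (f (Bar.tprod k (headTuple (by omega) r (a e))))).comp
          (f'.comp ((Bar.tprod k).toLinearMap (tailTuple h (b e) r)
            ⟨j - m, by omega⟩)), fun x => ?_⟩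
        rw [LinearMap.sum_apply]
        refine Finset.sum_congr rfl fun e _ => ?_
        have h1 : headTuple (m := m) (by omega) (Function.update r j x) (a e) =
            headTuple (by omega) r (a e) := by
          ext i
          unfold headTuple
          split_ifs with h2
          · rw [Function.update_of_ne (fun h' => by have := congrArg Fin.val h'; simp at this; omega)]
          · rfl
        have h2 : tailTuple h (b e) (Function.update r j x) =
            Function.update (tailTuple h (b e) r) ⟨j - m, by omega⟩ x := by
          ext i
          by_cases hi : i = ⟨j - m, by omega⟩
          · subst hi
            have h3 : ¬ ((j : ℕ) - m = 0) := by omega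
            have h4 : (⟨m + (j - m), by omega⟩ : Fin (N + 2)) = j := by ext; simp; omega
            simp [tailTuple, h3, h4]
          · have hi' : (i : ℕ) ≠ j - m := fun h' => hi (by ext; exact h')
            rw [Function.update_of_ne hi]
            unfold tailTuple
            split_ifs with h2
            · rfl
            · rw [Function.update_of_ne (fun h' => by
                have := congrArg Fin.val h'; simp at this; omega)]
        rw [h1, h2]
        rfl)))
    (fun f f' g => Bar.hom_ext fun r => by
      simp [mkMultilinear, add_mul, Finset.sum_add_distrib])
    (fun c f g => Bar.hom_ext fun r => by
      simp [mkMultilinear, Finset.smul_sum])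
    (fun f f' g => Bar.hom_ext fun r => by
      simp [mkMultilinear, mul_add, Finset.sum_add_distrib])
    (fun c f g => Bar.hom_ext fun r => by
      simp [mkMultilinear, Finset.smul_sum])

theorem barCup_tprod {ι : Type*} [Fintype ι] (a b : ι → R) {m n N : ℕ} (h : m + n = N)
    (f : Bar k R m →ₗ[k] R) (f' : Bar k R n →ₗ[k] R) (r : Fin (N + 2) → R) :
    barCup a b h f f' (Bar.tprod k r) = ∑ e, f (Bar.tprod k (headTuple (by omega) r (a e))) *
      f' (Bar.tprod k (tailTuple h (b e) r)) := by
  simp only [barCup, LinearMap.mk₂_apply, Bar.lift_tprod]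
  rfl

theorem barCup_leibniz {ι : Type*} [Fintype ι] (a b : ι → R) {m n N : ℕ} (h : m + n = N)
    (h1 : (m + 1) + n = N + 1) (h2 : m + (n + 1) = N + 1)
    (f : Bar k R m →ₗ[k] R) (f' : Bar k R n →ₗ[k] R)
    (hbal : ∀ (x : R) (p : Fin (m + 2) → R) (q : Fin (n + 2) → R),
      ∑ e, f (Bar.tprod k (Function.update p (Fin.last _) (x * a e))) *
        f' (Bar.tprod k (Function.update q 0 (b e))) =
      ∑ e, f (Bar.tprod k (Function.update p (Fin.last _) (a e))) *
        f' (Bar.tprod k (Function.update q 0 (b e * x)))) :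
    barCup a b h1 (f.comp (barD k R m)) f' +
      (-1 : k) ^ m • barCup a b h2 f (f'.comp (barD k R n)) =
    (barCup a b h f f').comp (barD k R N) := by
  refine Bar.hom_ext fun r => ?_
  set A : ℕ → R := fun i => ∑ e, f (Bar.tprod k (contract i (headTuple (by omega) r (a e)))) *
    f' (Bar.tprod k (tailTuple h1 (b e) r)) with hA
  set B : ℕ → R := fun i => ∑ e, f (Bar.tprod k (headTuple (by omega) r (a e))) *
    f' (Bar.tprod k (contract i (tailTuple h2 (b e) r))) with hB
  set C : ℕ → R := fun i => ∑ e, f (Bar.tprod k (headTuple (by omega) (contract i r) (a e))) *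
    f' (Bar.tprod k (tailTuple h (b e) (contract i r))) with hC
  have e1 : barCup a b h1 (f.comp (barD k R m)) f' (Bar.tprod k r) =
      ∑ i ∈ Finset.range (m + 2), (-1 : k) ^ i • A i := by
    simp only [barCup_tprod, LinearMap.comp_apply, barD_tprod, map_sum, map_smul, Finset.sum_mul,
      smul_mul_assoc, hA, Finset.smul_sum]
    rw [Finset.sum_comm]
  have e2 : barCup a b h2 f (f'.comp (barD k R n)) (Bar.tprod k r) =
      ∑ i ∈ Finset.range (n + 2), (-1 : k) ^ i • B i := by
    simp only [barCup_tprod, LinearMap.comp_apply, barD_tprod, map_sum, map_smul, Finset.mul_sum,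
      mul_smul_comm, hB, Finset.smul_sum]
    rw [Finset.sum_comm]
  have e3 : barCup a b h f f' (barD k R N (Bar.tprod k r)) =
      ∑ i ∈ Finset.range ((m + 1) + (n + 1)), (-1 : k) ^ i • C i := by
    have : (m + 1) + (n + 1) = N + 2 := by omega
    rw [barD_tprod, map_sum, this]
    simp only [map_smul, barCup_tprod, hC]
  have c1 : ∀ i, i < m + 1 → C i = A i := by
    intro i hi
    refine Finset.sum_congr rfl fun e _ => ?_
    congr 3
    · ext j
      simp only [headTuple, contract, Fin.val_castSucc, Fin.val_succ]
      split_ifs <;> first | omega | rfl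
    · ext j
      simp only [tailTuple, contract]
      split_ifs <;> first | omega | rfl | (congr 1; ext; simp; omega)
  have c2 : ∀ j, C (m + 1 + j) = B (j + 1) := by
    intro i
    refine Finset.sum_congr rfl fun e _ => ?_
    congr 3
    · ext j
      simp only [headTuple, contract]
      split_ifs <;> first | omega | rfl
    · ext j
      simp only [tailTuple, contract, Fin.val_castSucc, Fin.val_succ]
      split_ifs <;> first | contradiction | omega | rfl
  have c3 : A (m + 1) = B 0 := by
    have := hbal (r ⟨m + 1, by omega⟩) (headTuple (by omega) r 0) (tailTuple h1 0 r)
    convert this using 6 with e _ e _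
    · ext j
      by_cases hj : j = Fin.last _
      · subst hj
        simp [headTuple, contract]
      · have hj' : (j : ℕ) < m + 1 := by
          have : (j : ℕ) ≠ m + 1 := fun h' => hj (by ext; simpa using h')
          omega
        have hj'' : (j : ℕ) ≤ m := by omega
        have hj3 : (j : ℕ) ≤ m + 1 := by omega
        rw [Function.update_of_ne hj]
        simp [headTuple, contract, hj', hj'', hj3]
    · ext j
      by_cases hj : j = 0
      · subst hj
        simp [tailTuple]
      · have hj' : (j : ℕ) ≠ 0 := fun h' => hj (by ext; simpa using h')
        rw [Function.update_of_ne hj]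
        simp [tailTuple, hj']
    · ext j
      by_cases hj : j = Fin.last _
      · subst hj
        simp [headTuple]
      · have hj' : (j : ℕ) ≤ m := by
          have : (j : ℕ) ≠ m + 1 := fun h' => hj (by ext; simpa using h')
          omega
        rw [Function.update_of_ne hj]
        simp [headTuple, hj']
    · ext j
      by_cases hj : j = 0
      · subst hj
        simp [tailTuple, contract]
      · have hj' : (j : ℕ) ≠ 0 := fun h' => hj (by ext; simpa using h')
        rw [Function.update_of_ne hj]
        simp only [tailTuple, contract, hj', Fin.val_castSucc, Fin.val_succ]
        simp
        congr 1; ext; simp; omega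
  have d1 : ∑ i ∈ Finset.range (m + 2), (-1 : k) ^ i • A i =
      ∑ i ∈ Finset.range (m + 1), (-1 : k) ^ i • C i + (-1 : k) ^ (m + 1) • B 0 := by
    rw [Finset.sum_range_succ, c3, Finset.sum_congr rfl fun i hi => ?_]
    rw [c1 i (Finset.mem_range.1 hi)]
  have d2 : (-1 : k) ^ m • ∑ i ∈ Finset.range (n + 2), (-1 : k) ^ i • B i =
      ∑ i ∈ Finset.range (n + 1), (-1 : k) ^ (m + 1 + i) • C (m + 1 + i) + (-1 : k) ^ m • B 0 := by
    rw [Finset.sum_range_succ', smul_add, Finset.smul_sum]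
    congr 1
    · refine Finset.sum_congr rfl fun i _ => ?_
      rw [c2, smul_smul]
      congr 1
      ring
    · simp
  rw [LinearMap.add_apply, LinearMap.smul_apply, LinearMap.comp_apply, e1, e2, e3, d1, d2,
    Finset.sum_range_add _ (m + 1) (n + 1), pow_succ, mul_neg, mul_one, neg_smul]
  abel

/-! ### The Hochschild cup product -/

theorem hochCochain_tmul {n : ℕ} {f : Bar k R n →ₗ[k] R} (hf : f ∈ hochCochain k R n) (a b : R)
    (r : Fin (n + 2) → R) : f (Bar.tprod k (sandwich a b r)) = a * f (Bar.tprod k r) * b := by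
  rw [← Bar.tmul_smul_tprod, hf, AlgHom.mulLeftRight_apply, unop_op]

theorem mem_hochCochain_iff {n : ℕ} {f : Bar k R n →ₗ[k] R} : f ∈ hochCochain k R n ↔
    ∀ (a b : R) (r : Fin (n + 2) → R),
      f (Bar.tprod k (sandwich a b r)) = a * f (Bar.tprod k r) * b := by
  refine ⟨fun hf a b r => hochCochain_tmul hf a b r, fun hf a x => ?_⟩
  suffices h : f.comp (Bar.act n a) = (AlgHom.mulLeftRight k R a).comp f from
    LinearMap.congr_fun h x
  induction a using TensorProduct.induction_on with
  | zero => simp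
  | add a b ha hb => rw [map_add, map_add, LinearMap.comp_add, LinearMap.add_comp, ha, hb]
  | tmul a b =>
    refine Bar.hom_ext fun r => ?_
    have h := Bar.tmul_smul_tprod (k := k) (n := n) a b.unop
    simp only [op_unop, Bar.smul_def] at h
    rw [LinearMap.comp_apply, LinearMap.comp_apply, h, hf, AlgHom.mulLeftRight_apply]

theorem update_last_eq_sandwich {n : ℕ} (p : Fin (n + 2) → R) (x y : R) :
    Function.update p (Fin.last _) (x * y) =
      sandwich 1 y (Function.update p (Fin.last _) x) := by
  ext j
  by_cases hj : j = Fin.last _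
  · subst hj
    simp [sandwich]
  · have hj' : (j : ℕ) ≠ n + 1 := fun h' => hj (by ext; simpa using h')
    simp [sandwich, hj, hj']

theorem update_zero_eq_sandwich {n : ℕ} (q : Fin (n + 2) → R) (x y : R) :
    Function.update q 0 (x * y) = sandwich x 1 (Function.update q 0 y) := by
  ext j
  by_cases hj : j = 0
  · subst hj
    simp [sandwich]
  · have hj' : (j : ℕ) ≠ 0 := fun h' => hj (by ext; simpa using h')
    simp [sandwich, hj]

theorem headTuple_sandwich {m N : ℕ} (h : m ≤ N) (x y z : R) (r : Fin (N + 2) → R) :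
    headTuple h (sandwich x y r) z = sandwich x 1 (headTuple h r z) := by
  ext j
  by_cases hj : (j : ℕ) ≤ m
  · have hj' : (j : ℕ) ≠ N + 1 := by omega
    simp [headTuple, sandwich, hj, hj']
  · have hj' : (j : ℕ) ≠ 0 := by omega
    have hj0 : j ≠ 0 := fun h' => hj' (by simp [h'])
    simp [headTuple, sandwich, hj, hj0]

theorem tailTuple_sandwich {m n N : ℕ} (h : m + n = N) (x y z : R) (r : Fin (N + 2) → R) :
    tailTuple h z (sandwich x y r) = sandwich 1 y (tailTuple h z r) := by
  ext j
  by_cases hj : (j : ℕ) = 0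
  · have hj0 : j = 0 := by ext; simpa using hj
    subst hj0
    simp [tailTuple, sandwich]
  · have h1 : ¬ (m + (j : ℕ) = 0) := by omega
    have h2 : (m + (j : ℕ) = N + 1) ↔ (j : ℕ) = n + 1 := by omega
    have hj0 : j ≠ 0 := fun h' => hj (by simp [h'])
    simp only [tailTuple, sandwich, hj, h1, h2]
    simp

variable (k R)

/-- The Hochschild cup product of cochains,
`(f ⌣ f')(r_0 ⊗ ⋯ ⊗ r_{m+n+1}) = f (r_0 ⊗ ⋯ ⊗ r_m ⊗ 1) * f' (1 ⊗ r_{m+1} ⊗ ⋯ ⊗ r_{m+n+1})`. -/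
def hochCup {m n N : ℕ} (h : m + n = N) :
    HochCochain k R m →ₗ[k] HochCochain k R n →ₗ[k] HochCochain k R N :=
  LinearMap.mk₂ k (fun f f' => ⟨barCup (fun _ : Unit => 1) (fun _ => 1) h f.1 f'.1, by
      rw [mem_hochCochain_iff]
      intro a b r
      simp only [barCup_tprod, Finset.univ_unique, Finset.sum_singleton, headTuple_sandwich,
        tailTuple_sandwich, hochCochain_tmul f.2, hochCochain_tmul f'.2, one_mul, mul_one,
        mul_assoc]⟩)
    (fun _ _ _ => Subtype.ext (LinearMap.map_add₂ _ _ _ _))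
    (fun _ _ _ => Subtype.ext (LinearMap.map_smul₂ _ _ _ _))
    (fun _ _ _ => Subtype.ext (map_add _ _ _))
    (fun _ _ _ => Subtype.ext (map_smul _ _ _))

theorem hochCup_leibniz {m n N : ℕ} (h : m + n = N) (h1 : (m + 1) + n = N + 1)
    (h2 : m + (n + 1) = N + 1) (f : HochCochain k R m) (f' : HochCochain k R n) :
    hochCup k R h1 (hochD k R m f) f' + (-1 : k) ^ m • hochCup k R h2 f (hochD k R n f') =
      hochD k R N (hochCup k R h f f') := by
  refine Subtype.ext (barCup_leibniz _ _ h h1 h2 f.1 f'.1 fun x p q => ?_)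
  simp only [Finset.univ_unique, Finset.sum_singleton, mul_one, one_mul]
  have e1 := update_last_eq_sandwich p 1 x
  have e2 := update_zero_eq_sandwich q x 1
  rw [one_mul] at e1
  rw [mul_one] at e2
  rw [e1, e2, hochCochain_tmul f.2, hochCochain_tmul f'.2]
  simp [mul_assoc]

variable {k R}

/-- A pairing of cochains satisfying the Leibniz rule induces a pairing on cohomology. -/
def Coh.cup {X : ℕ → Type*} [∀ n, AddCommGroup (X n)] [∀ n, Module k (X n)]
    {d : ∀ n, X n →ₗ[k] X (n + 1)} (μ : ∀ {m n N : ℕ}, m + n = N → (X m →ₗ[k] X n →ₗ[k] X N))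
    (hμ : ∀ {m n N : ℕ} (h : m + n = N) (h1 : (m + 1) + n = N + 1) (h2 : m + (n + 1) = N + 1)
      (x : X m) (y : X n),
      μ h1 (d m x) y + (-1 : k) ^ m • μ h2 x (d n y) = d N (μ h x y)) (m n : ℕ) :
    Coh d m →ₗ[k] Coh d n →ₗ[k] Coh d (m + n) :=
  Coh.map₂ (μ rfl)
    (fun x y hx hy => by
      rw [← hμ rfl (by omega) (by omega) x y, hx, hy]
      simp)
    (fun x y hx hy => by
      cases m with
      | zero =>
        have : x = 0 := hx
        subst this
        simp
      | succ m =>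
        obtain ⟨z, rfl⟩ := hx
        have h : m + 1 + n = (m + n) + 1 := by omega
        suffices ∀ N (h' : m + 1 + n = N), μ h' (d m z) y ∈ coboundaries d N from this _ rfl
        rintro N h'
        obtain rfl : N = (m + n) + 1 := by omega
        refine ⟨μ rfl z y, ?_⟩
        rw [← hμ rfl h' (by omega) z y, hy]
        simp)
    (fun x y hx hy => by
      cases n with
      | zero =>
        have : y = 0 := hy
        subst this
        simp
      | succ n =>
        obtain ⟨z, rfl⟩ := hy
        suffices ∀ N (h' : m + (n + 1) = N), μ h' x (d n z) ∈ coboundaries d N from this _ rfl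
        rintro N h'
        obtain rfl : N = (m + n) + 1 := by omega
        refine ⟨(-1 : k) ^ m • μ rfl x z, ?_⟩
        rw [map_smul, ← hμ rfl (by omega) h' x z, hx]
        simp [smul_smul, ← mul_pow])

variable (k R)

/-- The cup product `HH^m(R) × HH^n(R) → HH^{m+n}(R)`. -/
def HH.cup (m n : ℕ) : HH k R m →ₗ[k] HH k R n →ₗ[k] HH k R (m + n) :=
  Coh.cup (d := hochD k R) (hochCup k R)
    (hochCup_leibniz k R) m n

/-- The unit of Hochschild cohomology, the class of the multiplication map in `HH^0(R)`. -/
def HH.unit : HH k R 0 :=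
  Coh.mk (hochD k R) ⟨barAug k R, fun a x => barAug_smul a x⟩
    (Subtype.ext (LinearMap.ext fun x => barAug_barD x))

variable {k R}

end Hochschild

/-! ## Crossed products -/

/-- A normalized two-cocycle of `G` with values in the units of the centre of `S`. -/
structure TwoCocycle (G S : Type*) [Group G] [Ring S] [MulSemiringAction G S] where
  /-- the values of the cocycle -/
  val : G → G → Sˣ
  central : ∀ g h (s : S), (val g h : S) * s = s * val g h
  cocycle : ∀ g h l, (g • (val h l : S)) * val g (h * l) = val g h * val (g * h) l
  one_right : ∀ g, val g 1 = 1
  one_left : ∀ g, val 1 g = 1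

section CrossedProduct

variable {G S : Type*} [Group G] [Ring S] [MulSemiringAction G S]

/-- The crossed product `S #_σ G`: its elements are the finite sums `∑ s_g ḡ`, and
`(s ḡ) (t h̄) = s (g • t) σ(g, h) \overline{gh}`. -/
def CrossedProduct (_σ : TwoCocycle G S) : Type _ := G →₀ S

namespace CrossedProduct

variable {σ : TwoCocycle G S}

instance : AddCommGroup (CrossedProduct σ) := inferInstanceAs (AddCommGroup (G →₀ S))

instance {k : Type*} [CommRing k] [Algebra k S] : Module k (CrossedProduct σ) :=
  inferInstanceAs (Module k (G →₀ S))

variable (σ) in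
/-- The element `s ḡ` of the crossed product. -/
def mk (s : S) (g : G) : CrossedProduct σ := Finsupp.single g s

theorem mk_add (s t : S) (g : G) : mk σ (s + t) g = mk σ s g + mk σ t g :=
  Finsupp.single_add g s t

theorem mk_zero (g : G) : mk σ 0 g = 0 := Finsupp.single_zero g

theorem smul_mk {k : Type*} [CommRing k] [Algebra k S] (c : k) (s : S) (g : G) :
    c • mk σ s g = mk σ (c • s) g :=
  Finsupp.smul_single c g s

@[elab_as_elim]
theorem induction {p : CrossedProduct σ → Prop} (x : CrossedProduct σ) (h0 : p 0)
    (hadd : ∀ x y, p x → p y → p (x + y)) (hmk : ∀ s g, p (mk σ s g)) : p x :=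
  Finsupp.induction_linear x h0 hadd (fun g s => hmk s g)

variable (σ) in
/-- The product of `s ḡ` with an element of the crossed product. -/
def mulMk (s : S) (g : G) : CrossedProduct σ →+ CrossedProduct σ :=
  Finsupp.liftAddHom (fun h =>
    { toFun := fun t => mk σ (s * (g • t) * σ.val g h) (g * h)
      map_zero' := by simp [mk_zero]
      map_add' := fun t t' => by rw [smul_add, mul_add, add_mul, mk_add] })

theorem mulMk_mk (s t : S) (g h : G) :
    mulMk σ s g (mk σ t h) = mk σ (s * (g • t) * σ.val g h) (g * h) :=
  Finsupp.liftAddHom_apply_single _ _ _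

theorem addHom_ext {M : Type*} [AddCommGroup M] {f f' : CrossedProduct σ →+ M}
    (h : ∀ s g, f (mk σ s g) = f' (mk σ s g)) : f = f' :=
  Finsupp.addHom_ext fun g s => h s g

variable (σ) in
/-- The multiplication of the crossed product. -/
def mulHom : CrossedProduct σ →+ CrossedProduct σ →+ CrossedProduct σ :=
  Finsupp.liftAddHom (fun g =>
    { toFun := fun s => mulMk σ s g
      map_zero' := addHom_ext fun t h => by
        rw [mulMk_mk, zero_mul, zero_mul, mk_zero]
        rfl
      map_add' := fun s s' => addHom_ext fun t h => by
        rw [AddMonoidHom.add_apply, mulMk_mk, mulMk_mk, mulMk_mk, add_mul, add_mul, mk_add] })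

theorem mulHom_mk (s : S) (g : G) : mulHom σ (mk σ s g) = mulMk σ s g :=
  Finsupp.liftAddHom_apply_single _ _ _

instance : Mul (CrossedProduct σ) := ⟨fun x y => mulHom σ x y⟩

instance : One (CrossedProduct σ) := ⟨mk σ 1 1⟩

theorem one_def : (1 : CrossedProduct σ) = mk σ 1 1 := rfl

theorem mk_mul_mk (s t : S) (g h : G) :
    mk σ s g * mk σ t h = mk σ (s * (g • t) * σ.val g h) (g * h) := by
  change mulHom σ (mk σ s g) (mk σ t h) = _
  rw [mulHom_mk, mulMk_mk]

theorem add_mul' (x y z : CrossedProduct σ) : (x + y) * z = x * z + y * z :=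
  DFunLike.congr_fun (map_add (mulHom σ) x y) z

theorem mul_add' (x y z : CrossedProduct σ) : x * (y + z) = x * y + x * z :=
  map_add (mulHom σ x) y z

theorem zero_mul' (x : CrossedProduct σ) : 0 * x = 0 :=
  DFunLike.congr_fun (map_zero (mulHom σ)) x

theorem mul_zero' (x : CrossedProduct σ) : x * 0 = 0 :=
  map_zero (mulHom σ x)

instance : Ring (CrossedProduct σ) where
  __ := (inferInstance : AddCommGroup (CrossedProduct σ))
  left_distrib := mul_add'
  right_distrib := add_mul'
  zero_mul := zero_mul'
  mul_zero := mul_zero'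
  mul_assoc x y z := by
    induction x using induction with
    | h0 => simp only [zero_mul']
    | hadd x x' hx hx' => simp only [add_mul', hx, hx']
    | hmk s g =>
      induction y using induction with
      | h0 => simp only [zero_mul', mul_zero']
      | hadd y y' hy hy' => simp only [add_mul', mul_add', hy, hy']
      | hmk t h =>
        induction z using induction with
        | h0 => simp only [mul_zero']
        | hadd z z' hz hz' => simp only [mul_add', hz, hz']
        | hmk u l =>
          rw [mk_mul_mk, mk_mul_mk, mk_mul_mk, mk_mul_mk, mul_assoc g h l]
          congr 1
          have h1 := σ.cocycle g h l
          have h2 := σ.central g h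
          simp only [smul_mul', mul_smul, mul_assoc, h1]
          congr 2
          rw [← mul_assoc, h2, mul_assoc]
  one_mul x := by
    induction x using induction with
    | h0 => exact mul_zero' _
    | hadd x x' hx hx' => rw [mul_add', hx, hx']
    | hmk s g => rw [one_def, mk_mul_mk, σ.one_left]; simp
  mul_one x := by
    induction x using induction with
    | h0 => exact zero_mul' _
    | hadd x x' hx hx' => rw [add_mul', hx, hx']
    | hmk s g => rw [one_def, mk_mul_mk, σ.one_right]; simp

instance {k : Type*} [CommRing k] [Algebra k S] [SMulCommClass G k S] :
    Algebra k (CrossedProduct σ) :=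
  Algebra.ofModule
    (fun c x y => by
      induction x using induction with
      | h0 => simp
      | hadd x x' hx hx' => simp only [smul_add, add_mul, hx, hx']
      | hmk s g =>
        induction y using induction with
        | h0 => simp
        | hadd y y' hy hy' => simp only [smul_add, mul_add, hy, hy']
        | hmk t h => simp only [smul_mk, mk_mul_mk, smul_mul_assoc])
    (fun c x y => by
      induction x using induction with
      | h0 => simp
      | hadd x x' hx hx' => simp only [smul_add, add_mul, hx, hx']
      | hmk s g =>
        induction y using induction with
        | h0 => simp
        | hadd y y' hy hy' => simp only [smul_add, mul_add, hy, hy']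
        | hmk t h => simp only [smul_mk, mk_mul_mk, smul_comm g c t, mul_smul_comm,
            smul_mul_assoc])

variable (σ)

/-- The invertible element `ḡ` of the crossed product. -/
def bar (g : G) : (CrossedProduct σ)ˣ :=
  have h : g • (σ.val g⁻¹ g : S) = σ.val g g⁻¹ := by
    have := σ.cocycle g g⁻¹ g
    rw [inv_mul_cancel, mul_inv_cancel, σ.one_left, σ.one_right] at this
    simpa using this
  { val := mk σ 1 g
    inv := mk σ (((σ.val g⁻¹ g)⁻¹ : Sˣ) : S) g⁻¹
    val_inv := by
      rw [mk_mul_mk, ← h, one_mul, ← smul_mul', Units.inv_mul, smul_one, mul_inv_cancel, one_def]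
    inv_val := by
      rw [mk_mul_mk, smul_one, mul_one, Units.inv_mul, inv_mul_cancel, one_def] }

/-- The embedding of `S` into the crossed product. -/
def incl (s : S) : CrossedProduct σ := mk σ s 1

theorem mk_eq (s : S) (g : G) : mk σ s g = incl σ s * bar σ g := by
  change _ = mk σ s 1 * mk σ 1 g
  rw [mk_mul_mk, σ.one_left]
  simp

variable (k : Type*) [CommRing k] [Algebra k S]

/-- The subspace `S ḡ` of the crossed product. -/
def component (g : G) : Submodule k (CrossedProduct σ) :=
  LinearMap.range (Finsupp.lsingle (R := k) (M := S) g)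

/-- The projection of the crossed product `⨁ g, S ḡ` onto `S ḡ`. -/
def proj (g : G) : CrossedProduct σ →ₗ[k] CrossedProduct σ :=
  (Finsupp.lsingle (R := k) (M := S) g).comp (Finsupp.lapply g)

variable {σ k}

theorem mem_component {g : G} {x : CrossedProduct σ} :
    x ∈ component σ k g ↔ ∃ s, mk σ s g = x :=
  Iff.rfl

theorem mk_mem (s : S) (g : G) : mk σ s g ∈ component σ k g := ⟨s, rfl⟩

theorem proj_mk (s : S) (g h : G) [Decidable (g = h)] :
    proj σ k h (mk σ s g) = if g = h then mk σ s g else 0 := by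
  classical
  change Finsupp.single h ((Finsupp.single g s : G →₀ S) h) = _
  by_cases e : g = h
  · subst e
    simp [mk]
  · rw [Finsupp.single_apply, if_neg e, if_neg e, Finsupp.single_zero]
    rfl

theorem proj_mem (h : G) (x : CrossedProduct σ) : proj σ k h x ∈ component σ k h := ⟨_, rfl⟩

theorem sum_proj [Fintype G] (x : CrossedProduct σ) : ∑ g, proj σ k g x = x := by
  classical
  induction x using induction with
  | h0 => simp
  | hadd x y hx hy => simp only [map_add, Finset.sum_add_distrib, hx, hy]
  | hmk s g => simp [proj_mk]

theorem mul_mem_component {g h : G} {x y : CrossedProduct σ} (hx : x ∈ component σ k g)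
    (hy : y ∈ component σ k h) : x * y ∈ component σ k (g * h) := by
  obtain ⟨s, rfl⟩ := mem_component.1 hx
  obtain ⟨t, rfl⟩ := mem_component.1 hy
  rw [mk_mul_mk]
  exact mk_mem _ _

theorem bar_mem (g : G) : (bar σ g : CrossedProduct σ) ∈ component σ k g := mk_mem _ _

theorem bar_inv_mem (g : G) :
    (((bar σ g)⁻¹ : (CrossedProduct σ)ˣ) : CrossedProduct σ) ∈ component σ k g⁻¹ :=
  mk_mem _ _

theorem one_mem_component : (1 : CrossedProduct σ) ∈ component σ k 1 := mk_mem _ _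

theorem mem_component_iff_left {g : G} {x : CrossedProduct σ} :
    x ∈ component σ k g ↔ ∃ s : S, x = incl σ s * bar σ g := by
  rw [mem_component]
  simp only [mk_eq, eq_comm]

theorem mem_component_iff_inv {g : G} {x : CrossedProduct σ} :
    x ∈ component σ k g⁻¹ ↔
      ∃ s : S, x = incl σ s * ((bar σ g)⁻¹ : (CrossedProduct σ)ˣ) := by
  constructor
  · intro hx
    have h := mul_mem_component hx (bar_mem (k := k) g)
    rw [inv_mul_cancel] at h
    obtain ⟨s, hs⟩ := mem_component.1 h
    exact ⟨s, by rw [show incl σ s = _ from hs, mul_assoc, Units.mul_inv, mul_one]⟩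
  · rintro ⟨s, rfl⟩
    have h := mul_mem_component (mk_mem (k := k) (σ := σ) s 1) (bar_inv_mem g)
    rwa [one_mul] at h

end CrossedProduct

end CrossedProduct

/-! ## The algebras `Δ(H)` and the resolution `Δ_n` -/

section Tuples

variable {A : Type*} [Monoid A]

theorem prod_contract {n : ℕ} (i : ℕ) (hi : i < n) (g : Fin (n + 1) → A) :
    (List.ofFn (contract i g)).prod = (List.ofFn g).prod := by
  induction n generalizing i with
  | zero => omega
  | succ n ih =>
    rw [List.ofFn_succ, List.prod_cons, List.ofFn_succ, List.prod_cons]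
    cases i with
    | zero =>
      have h : (fun j : Fin n => contract 0 g j.succ) = fun j : Fin n => g j.succ.succ := by
        ext j
        simp [contract]
      rw [h, List.ofFn_succ, List.prod_cons, ← mul_assoc]
      rfl
    | succ i =>
      have h : (fun j : Fin n => contract (i + 1) g j.succ) =
          contract i (fun j : Fin (n + 1) => g j.succ) := by
        ext j
        simp [contract]
      rw [h, ih i (by omega)]
      rfl

theorem prod_sandwich {n : ℕ} (a b : A) (g : Fin (n + 2) → A) :
    (List.ofFn (sandwich a b g)).prod = a * (List.ofFn g).prod * b := by
  have key : ∀ f : Fin (n + 2) → A, (List.ofFn f).prod =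
      f 0 * (List.ofFn fun i : Fin n => f i.castSucc.succ).prod * f (Fin.last (n + 1)) := by
    intro f
    rw [List.ofFn_succ, List.ofFn_succ', List.concat_eq_append, List.prod_cons, List.prod_append]
    simp [mul_assoc]
  have h : (fun i : Fin n => sandwich a b g i.castSucc.succ) =
      fun i : Fin n => g i.castSucc.succ := by
    ext i
    have := i.2
    have h1 : (i : ℕ) ≠ n := by omega
    simp [sandwich, h1]
  rw [key, key g, h]
  simp [sandwich, mul_assoc]

theorem sandwich_sandwich {n : ℕ} (a b c d : A) (g : Fin (n + 2) → A) :
    sandwich a b (sandwich c d g) = sandwich (a * c) (d * b) g := by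
  ext i
  unfold sandwich
  split_ifs <;> simp [mul_assoc]

end Tuples

section Delta

set_option linter.unusedSectionVars false

open CrossedProduct

variable {G S : Type*} [Group G] [Ring S] [MulSemiringAction G S]
variable (k : Type*) [CommRing k] [Algebra k S] [SMulCommClass G k S]
variable (σ : TwoCocycle G S)

theorem deltaAux {h : G} {x y : CrossedProduct σ} (hx : x ∈ component σ k h)
    (hy : y ∈ component σ k h⁻¹) : ∃ s t : S, (x ⊗ₜ[k] op y : Env k (CrossedProduct σ)) =
      (incl σ s * bar σ h) ⊗ₜ[k] op (incl σ t * ((bar σ h)⁻¹ : (CrossedProduct σ)ˣ)) := by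
  obtain ⟨s, rfl⟩ := mem_component_iff_left.1 hx
  obtain ⟨t, rfl⟩ := mem_component_iff_inv.1 hy
  exact ⟨s, t, rfl⟩

/-- The subalgebra `Δ(H) = ⨁_{h ∈ H} S h̄ ⊗ S h̄⁻¹` of the enveloping algebra. -/
def Delta (H : Subgroup G) : Subalgebra k (Env k (CrossedProduct σ)) :=
  Submodule.toSubalgebra
    (Submodule.span k {z | ∃ h ∈ H, ∃ s t : S,
      z = (incl σ s * bar σ h) ⊗ₜ[k] op (incl σ t * ((bar σ h)⁻¹ : (CrossedProduct σ)ˣ))})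
    (by
      obtain ⟨s, t, h⟩ := deltaAux k σ (one_mem_component (k := k))
        (by rw [inv_one]; exact one_mem_component (k := k))
      exact Submodule.subset_span ⟨1, H.one_mem, s, t, h⟩)
    (fun x y hx hy => by
      induction hx using Submodule.span_induction with
      | zero => rw [zero_mul]; exact Submodule.zero_mem _
      | add a b _ _ ha hb => rw [add_mul]; exact Submodule.add_mem _ ha hb
      | smul c a _ ha => rw [smul_mul_assoc]; exact Submodule.smul_mem _ c ha
      | mem a ha =>
        induction hy using Submodule.span_induction with
        | zero => rw [mul_zero]; exact Submodule.zero_mem _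
        | add c d _ _ hc hd => rw [mul_add]; exact Submodule.add_mem _ hc hd
        | smul r c _ hc => rw [mul_smul_comm]; exact Submodule.smul_mem _ r hc
        | mem c hc =>
          obtain ⟨h, hh, s, t, rfl⟩ := ha
          obtain ⟨h', hh', s', t', rfl⟩ := hc
          rw [Algebra.TensorProduct.tmul_mul_tmul, ← op_mul]
          obtain ⟨u, v, e⟩ := deltaAux k σ (h := h * h')
            (mul_mem_component (mem_component_iff_left.2 ⟨s, rfl⟩)
              (mem_component_iff_left.2 ⟨s', rfl⟩))
            (by
              rw [mul_inv_rev]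
              exact mul_mem_component (mem_component_iff_inv.2 ⟨t', rfl⟩)
                (mem_component_iff_inv.2 ⟨t, rfl⟩))
          exact Submodule.subset_span ⟨h * h', H.mul_mem hh hh', u, v, e⟩)

variable {k σ}

theorem tmul_mem_Delta {H : Subgroup G} {h : G} (hh : h ∈ H) {x y : CrossedProduct σ}
    (hx : x ∈ component σ k h) (hy : y ∈ component σ k h⁻¹) :
    (x ⊗ₜ[k] op y : Env k (CrossedProduct σ)) ∈ Delta k σ H := by
  obtain ⟨s, t, e⟩ := deltaAux k σ hx hy
  exact Submodule.subset_span ⟨h, hh, s, t, e⟩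

theorem Delta_induction {H : Subgroup G} {p : Env k (CrossedProduct σ) → Prop} (h0 : p 0)
    (hadd : ∀ a ∈ Delta k σ H, ∀ b ∈ Delta k σ H, p a → p b → p (a + b))
    (hgen : ∀ h ∈ H, ∀ x ∈ component σ k h, ∀ y ∈ component σ k h⁻¹, p (x ⊗ₜ[k] op y))
    {a : Env k (CrossedProduct σ)} (ha : a ∈ Delta k σ H) : p a := by
  refine Submodule.closure_induction (p := fun a _ => p a) h0
    (fun a b ha hb => hadd a ?_ b ?_) ?_ ha
  · exact ha
  · exact hb
  rintro c _ ⟨h, hh, s, t, rfl⟩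
  rw [TensorProduct.smul_tmul']
  exact hgen h hh _ (Submodule.smul_mem _ c (mem_component_iff_left.2 ⟨s, rfl⟩)) _
    (mem_component_iff_inv.2 ⟨t, rfl⟩)

theorem Delta_mono {H K : Subgroup G} (h : K ≤ H) : Delta k σ K ≤ Delta k σ H := fun _ ha =>
  Delta_induction (p := fun a => a ∈ Delta k σ H) (Subalgebra.zero_mem _)
    (fun _ _ _ _ => Subalgebra.add_mem _)
    (fun _ hg _ hx _ hy => tmul_mem_Delta (h hg) hx hy) ha

variable (k σ)

/-- The action of `Δ(H) ⊆ R ⊗ Rᵒᵖ` on `R`, `(a ⊗ b) • r = a * r * b`. -/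
instance (H : Subgroup G) : Module (Delta k σ H) (CrossedProduct σ) :=
  Module.compHom _
    ((AlgHom.mulLeftRight k (CrossedProduct σ)).comp (Delta k σ H).val).toRingHom

instance (H : Subgroup G) : SMul (Delta k σ H) (CrossedProduct σ) :=
  (inferInstance : Module (Delta k σ H) (CrossedProduct σ)).toSMul

theorem Delta_smul_def {H : Subgroup G} (a : Delta k σ H) (r : CrossedProduct σ) :
    a • r = AlgHom.mulLeftRight k (CrossedProduct σ) a r :=
  rfl

instance (H : Subgroup G) : SMulCommClass (Delta k σ H) k (CrossedProduct σ) where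
  smul_comm a c r := by rw [Delta_smul_def, Delta_smul_def, map_smul]

/-- The subspace `Δ_n` of `R^{⊗ (n + 2)}` spanned by the tensors
`s_0 ḡ_0 ⊗ ⋯ ⊗ s_{n+1} ḡ_{n+1}` with `g_0 ⋯ g_{n+1} = 1`. -/
def deltaSub (n : ℕ) : Submodule k (Bar k (CrossedProduct σ) n) :=
  Submodule.span k {x | ∃ (s : Fin (n + 2) → S) (g : Fin (n + 2) → G),
    (List.ofFn g).prod = 1 ∧ x = Bar.tprod k (fun i => mk σ (s i) (g i))}

variable {k σ}

theorem tprod_mem_deltaSub {n : ℕ} {r : Fin (n + 2) → CrossedProduct σ} {g : Fin (n + 2) → G}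
    (hr : ∀ i, r i ∈ component σ k (g i)) (hg : (List.ofFn g).prod = 1) :
    Bar.tprod k r ∈ deltaSub k σ n := by
  choose s hs using fun i => mem_component.1 (hr i)
  exact Submodule.subset_span ⟨s, g, hg, by simp only [hs]⟩

theorem sandwich_mem_component {n : ℕ} {r : Fin (n + 2) → CrossedProduct σ} {g : Fin (n + 2) → G}
    (hr : ∀ i, r i ∈ component σ k (g i)) {h l : G} {x y : CrossedProduct σ}
    (hx : x ∈ component σ k h) (hy : y ∈ component σ k l) (i : Fin (n + 2)) :
    sandwich x y r i ∈ component σ k (sandwich h l g i) := by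
  unfold sandwich
  refine mul_mem_component (mul_mem_component ?_ (hr i)) ?_
  · split_ifs
    · exact hx
    · exact one_mem_component
  · split_ifs
    · exact hy
    · exact one_mem_component

theorem contract_mem_component {n : ℕ} {r : Fin (n + 3) → CrossedProduct σ}
    {g : Fin (n + 3) → G} (hr : ∀ i, r i ∈ component σ k (g i)) (i : ℕ) (j : Fin (n + 2)) :
    contract i r j ∈ component σ k (contract i g j) := by
  unfold contract
  split_ifs
  · exact hr _
  · exact mul_mem_component (hr _) (hr _)
  · exact hr _

theorem smul_mem_deltaSub {n : ℕ} {H : Subgroup G} {a : Env k (CrossedProduct σ)}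
    (ha : a ∈ Delta k σ H) {x : Bar k (CrossedProduct σ) n} (hx : x ∈ deltaSub k σ n) :
    a • x ∈ deltaSub k σ n := by
  refine Delta_induction (p := fun a => a • x ∈ deltaSub k σ n) ?_ ?_ ?_ ha
  · rw [show (0 : Env k (CrossedProduct σ)) • x = 0 from by rw [Bar.smul_def, map_zero]; rfl]
    exact Submodule.zero_mem _
  · intro a _ b _ ha hb
    rw [show (a + b) • x = a • x + b • x from add_smul _ _ _]
    exact Submodule.add_mem _ ha hb
  · intro h _ y hy z hz
    refine Submodule.span_induction (p := fun x _ =>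
      (y ⊗ₜ[k] op z : Env k (CrossedProduct σ)) • x ∈ deltaSub k σ n) ?_ ?_ ?_ ?_ hx
    · rintro _ ⟨s, g, hg, rfl⟩
      rw [Bar.tmul_smul_tprod]
      exact tprod_mem_deltaSub (sandwich_mem_component (fun i => mk_mem _ _) hy hz)
        (by rw [prod_sandwich, hg]; simp)
    · rw [smul_zero]; exact Submodule.zero_mem _
    · intro a b _ _ ha hb
      rw [smul_add]
      exact Submodule.add_mem _ ha hb
    · intro c a _ ha
      rw [Bar.smul_def, map_smul]
      exact Submodule.smul_mem _ c ha

variable (k σ)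

/-- The module `Δ_n`. It is a module over `Δ(H)` for every subgroup `H` of `G`. -/
def DeltaN (n : ℕ) : Type _ := deltaSub k σ n

instance (n : ℕ) : AddCommGroup (DeltaN k σ n) := inferInstanceAs (AddCommGroup (deltaSub k σ n))

instance (n : ℕ) : Module k (DeltaN k σ n) := inferInstanceAs (Module k (deltaSub k σ n))

instance (H : Subgroup G) (n : ℕ) : Module (Delta k σ H) (DeltaN k σ n) where
  smul a x := ⟨(a : Env k (CrossedProduct σ)) • x.1, smul_mem_deltaSub a.2 x.2⟩
  one_smul x := Subtype.ext (one_smul (Env k (CrossedProduct σ)) x.1)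
  mul_smul a b x := Subtype.ext (mul_smul (a : Env k (CrossedProduct σ)) b x.1)
  smul_zero a := Subtype.ext (smul_zero (a : Env k (CrossedProduct σ)))
  smul_add a x y := Subtype.ext (smul_add (a : Env k (CrossedProduct σ)) x.1 y.1)
  add_smul a b x := Subtype.ext (add_smul (a : Env k (CrossedProduct σ)) b x.1)
  zero_smul x := Subtype.ext (zero_smul (Env k (CrossedProduct σ)) x.1)

instance (H : Subgroup G) (n : ℕ) : SMul (Delta k σ H) (DeltaN k σ n) :=
  (inferInstance : Module (Delta k σ H) (DeltaN k σ n)).toSMul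

/-- The inclusion `Δ_n → R^{⊗ (n + 2)}`. -/
def deltaIncl (n : ℕ) : DeltaN k σ n →ₗ[k] Bar k (CrossedProduct σ) n :=
  (deltaSub k σ n).subtype

variable {k σ}

theorem deltaIncl_injective (n : ℕ) : Function.Injective (deltaIncl k σ n) :=
  Subtype.val_injective

theorem deltaIncl_smul {H : Subgroup G} {n : ℕ} (a : Delta k σ H) (x : DeltaN k σ n) :
    deltaIncl k σ n (a • x) = (a : Env k (CrossedProduct σ)) • deltaIncl k σ n x :=
  rfl

theorem barD_mem_deltaSub {n : ℕ} {x : Bar k (CrossedProduct σ) (n + 1)}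
    (hx : x ∈ deltaSub k σ (n + 1)) : barD k (CrossedProduct σ) n x ∈ deltaSub k σ n := by
  refine Submodule.span_induction (p := fun x _ => barD k (CrossedProduct σ) n x ∈ deltaSub k σ n)
    ?_ ?_ ?_ ?_ hx
  · rintro _ ⟨s, g, hg, rfl⟩
    rw [barD_tprod]
    refine Submodule.sum_mem _ fun i hi => Submodule.smul_mem _ _ ?_
    exact tprod_mem_deltaSub (contract_mem_component (fun i => mk_mem _ _) i)
      (by rw [prod_contract i (Finset.mem_range.1 hi), hg])
  · rw [map_zero]; exact Submodule.zero_mem _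
  · intro a b _ _ ha hb
    rw [map_add]
    exact Submodule.add_mem _ ha hb
  · intro c a _ ha
    rw [map_smul]
    exact Submodule.smul_mem _ c ha

variable (k σ)

/-- The differential `Δ_{n+1} → Δ_n`, the restriction of the differential of the Hochschild
resolution. -/
def deltaD (n : ℕ) : DeltaN k σ (n + 1) →ₗ[k] DeltaN k σ n :=
  (barD k (CrossedProduct σ) n).restrict (p := deltaSub k σ (n + 1)) (q := deltaSub k σ n)
    (fun _ hx => barD_mem_deltaSub hx)

/-- The augmentation `Δ_0 → R`, `r_0 ⊗ r_1 ↦ r_0 r_1`; its image is `S = S 1̄`. -/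
def deltaAug : DeltaN k σ 0 →ₗ[k] CrossedProduct σ :=
  (barAug k (CrossedProduct σ)).comp (deltaIncl k σ 0)

variable {k σ}

theorem deltaIncl_deltaD (n : ℕ) (x : DeltaN k σ (n + 1)) :
    deltaIncl k σ n (deltaD k σ n x) = barD k (CrossedProduct σ) n (deltaIncl k σ (n + 1) x) :=
  rfl

theorem deltaD_smul {H : Subgroup G} {n : ℕ} (a : Delta k σ H) (x : DeltaN k σ (n + 1)) :
    deltaD k σ n (a • x) = a • deltaD k σ n x :=
  deltaIncl_injective n (barD_smul n _ _)

/-! ### The projection of `R^{⊗ (n + 2)}` onto `Δ_n` -/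

theorem Bar.hom_ext_mk [Fintype G] {n : ℕ} {M : Type*} [AddCommGroup M] [Module k M]
    {f g : Bar k (CrossedProduct σ) n →ₗ[k] M}
    (h : ∀ (r : Fin (n + 2) → CrossedProduct σ) (d : Fin (n + 2) → G),
      (∀ i, r i ∈ component σ k (d i)) → f (Bar.tprod k r) = g (Bar.tprod k r)) : f = g := by
  refine Bar.hom_ext fun r => ?_
  have hr : r = fun i => ∑ g, proj σ k g (r i) := by
    ext1 i
    rw [sum_proj]
  rw [hr, MultilinearMap.map_sum, map_sum, map_sum]
  exact Finset.sum_congr rfl fun d _ => h _ d fun i => proj_mem _ _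

variable [Fintype G]

variable (k σ) in
open Classical in
/-- The projection of `R^{⊗ (n + 2)}` onto the direct summand `Δ_n` that sends a tensor
`s_0 ḡ_0 ⊗ ⋯ ⊗ s_{n+1} ḡ_{n+1}` with `g_0 ⋯ g_{n+1} ≠ 1` to zero. -/
def deltaProj (n : ℕ) : Bar k (CrossedProduct σ) n →ₗ[k] Bar k (CrossedProduct σ) n :=
  ∑ g : Fin (n + 2) → G, if (List.ofFn g).prod = 1 then
    Bar.map (fun i => proj σ k (g i)) else 0

theorem deltaProj_tprod {n : ℕ} {r : Fin (n + 2) → CrossedProduct σ} {g : Fin (n + 2) → G}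
    (hr : ∀ i, r i ∈ component σ k (g i)) [Decidable ((List.ofFn g).prod = 1)] :
    deltaProj k σ n (Bar.tprod k r) = if (List.ofFn g).prod = 1 then Bar.tprod k r else 0 := by
  classical
  unfold deltaProj
  rw [LinearMap.sum_apply, Finset.sum_eq_single g]
  · by_cases h : (List.ofFn g).prod = 1
    · rw [if_pos h, if_pos h, Bar.map_tprod]
      congr 1
      ext1 i
      obtain ⟨s, hs⟩ := mem_component.1 (hr i)
      rw [← hs, proj_mk, if_pos rfl]
    · rw [if_neg h, if_neg h, LinearMap.zero_apply]
  · intro d _ hd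
    by_cases h : (List.ofFn d).prod = 1
    · rw [if_pos h, Bar.map_tprod]
      obtain ⟨i, hi⟩ := Function.ne_iff.1 hd
      refine MultilinearMap.map_coord_zero _ i ?_
      obtain ⟨s, hs⟩ := mem_component.1 (hr i)
      rw [← hs, proj_mk, if_neg hi.symm]
    · rw [if_neg h, LinearMap.zero_apply]
  · intro h
    exact absurd (Finset.mem_univ _) h

theorem deltaProj_mem {n : ℕ} (x : Bar k (CrossedProduct σ) n) :
    deltaProj k σ n x ∈ deltaSub k σ n := by
  classical
  suffices h : (deltaSub k σ n).mkQ.comp (deltaProj k σ n) = 0 by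
    rw [← Submodule.Quotient.mk_eq_zero]
    exact LinearMap.congr_fun h x
  refine Bar.hom_ext_mk fun r g hr => ?_
  rw [LinearMap.comp_apply, deltaProj_tprod hr, LinearMap.zero_apply, Submodule.mkQ_apply,
    Submodule.Quotient.mk_eq_zero]
  split_ifs with h
  · exact tprod_mem_deltaSub hr h
  · exact Submodule.zero_mem _

variable (k σ) in
/-- The projection `R^{⊗ (n + 2)} → Δ_n`. -/
def deltaRetr (n : ℕ) : Bar k (CrossedProduct σ) n →ₗ[k] DeltaN k σ n :=
  (deltaProj k σ n).codRestrict (deltaSub k σ n) deltaProj_mem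

theorem deltaIncl_deltaRetr {n : ℕ} (x : Bar k (CrossedProduct σ) n) :
    deltaIncl k σ n (deltaRetr k σ n x) = deltaProj k σ n x :=
  rfl

theorem deltaRetr_deltaIncl {n : ℕ} (x : DeltaN k σ n) :
    deltaRetr k σ n (deltaIncl k σ n x) = x := by
  classical
  refine deltaIncl_injective n ?_
  rw [deltaIncl_deltaRetr]
  refine Submodule.span_induction (p := fun x _ => deltaProj k σ n x = x) ?_ ?_ ?_ ?_ x.2
  · rintro _ ⟨s, g, hg, rfl⟩
    rw [deltaProj_tprod (fun i => mk_mem _ _), if_pos hg]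
  · rw [map_zero]
  · intro a b _ _ ha hb
    rw [map_add, ha, hb]
  · intro c a _ ha
    rw [map_smul, ha]

theorem deltaRetr_barD {n : ℕ} (x : Bar k (CrossedProduct σ) (n + 1)) :
    deltaRetr k σ n (barD k (CrossedProduct σ) n x) = deltaD k σ n (deltaRetr k σ (n + 1) x) := by
  classical
  refine deltaIncl_injective n ?_
  rw [deltaIncl_deltaD, deltaIncl_deltaRetr, deltaIncl_deltaRetr]
  suffices h : (deltaProj k σ n).comp (barD k (CrossedProduct σ) n) =
      (barD k (CrossedProduct σ) n).comp (deltaProj k σ (n + 1)) from LinearMap.congr_fun h x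
  refine Bar.hom_ext_mk fun r g hr => ?_
  rw [LinearMap.comp_apply, LinearMap.comp_apply, deltaProj_tprod hr, barD_tprod, map_sum]
  have h : ∀ i ∈ Finset.range (n + 2), deltaProj k σ n ((-1 : k) ^ i • Bar.tprod k (contract i r)) =
      if (List.ofFn g).prod = 1 then (-1 : k) ^ i • Bar.tprod k (contract i r) else 0 := by
    intro i hi
    rw [map_smul, deltaProj_tprod (contract_mem_component hr i)]
    simp only [prod_contract i (Finset.mem_range.1 hi) g]
    split_ifs
    · rfl
    · rw [smul_zero]
  rw [Finset.sum_congr rfl h]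
  split_ifs with hg
  · rw [barD_tprod]
  · rw [map_zero, Finset.sum_const_zero]

theorem deltaRetr_smul {H : Subgroup G} {n : ℕ} (a : Delta k σ H)
    (x : Bar k (CrossedProduct σ) n) :
    deltaRetr k σ n ((a : Env k (CrossedProduct σ)) • x) = a • deltaRetr k σ n x := by
  classical
  refine deltaIncl_injective n ?_
  rw [deltaIncl_smul, deltaIncl_deltaRetr, deltaIncl_deltaRetr]
  refine Delta_induction (H := H)
    (p := fun a => deltaProj k σ n (a • x) = a • deltaProj k σ n x) ?_ ?_ ?_ a.2
  · rw [show (0 : Env k (CrossedProduct σ)) • x = 0 from by rw [Bar.smul_def, map_zero]; rfl, map_zero]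
    symm
    rw [Bar.smul_def, map_zero]
    rfl
  · intro a _ b _ ha hb
    rw [show (a + b) • x = a • x + b • x from add_smul _ _ _, map_add, ha, hb]
    exact (add_smul a b (deltaProj k σ n x)).symm
  · intro h _ y hy z hz
    suffices hs : (deltaProj k σ n).comp (Bar.act n (y ⊗ₜ[k] op z)) =
        (Bar.act n (y ⊗ₜ[k] op z)).comp (deltaProj k σ n) from LinearMap.congr_fun hs x
    refine Bar.hom_ext_mk fun r g hr => ?_
    rw [LinearMap.comp_apply, LinearMap.comp_apply, ← Bar.smul_def, ← Bar.smul_def,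
      Bar.tmul_smul_tprod, deltaProj_tprod hr, deltaProj_tprod (sandwich_mem_component hr hy hz)]
    have hg : (List.ofFn (sandwich h h⁻¹ g)).prod = 1 ↔ (List.ofFn g).prod = 1 := by
      rw [prod_sandwich]
      constructor
      · intro e
        have := congrArg (fun t => h⁻¹ * t * h) e
        simpa [mul_assoc] using this
      · intro e
        rw [e, mul_one, mul_inv_cancel]
    simp only [hg]
    split_ifs
    · rw [Bar.tmul_smul_tprod]
    · rw [smul_zero]

end Delta

/-! ## Cohomology of the algebras `Δ(H)` -/

section Ext

set_option linter.unusedSectionVars false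

open CrossedProduct

variable {G S : Type*} [Group G] [Ring S] [MulSemiringAction G S]
variable (k : Type*) [CommRing k] [Algebra k S] [SMulCommClass G k S]
variable (σ : TwoCocycle G S)

/-- For a subspace `N` of `R` stable under `Δ(H)`, the cochains `Hom_{Δ(H)}(Δ_n, N)`, written as
the space of `Δ(H)`-linear maps `Δ_n → R` with values in `N`. -/
def deltaCochain (H : Subgroup G) (N : Submodule k (CrossedProduct σ)) (n : ℕ) :
    Submodule k (DeltaN k σ n →ₗ[k] CrossedProduct σ) where
  carrier := {f | (∀ (a : Delta k σ H) (x : DeltaN k σ n),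
    f (a • x) = a • f x) ∧ ∀ x, f x ∈ N}
  add_mem' hf hg :=
    ⟨fun a x => by rw [LinearMap.add_apply, LinearMap.add_apply, hf.1, hg.1, smul_add],
      fun x => Submodule.add_mem _ (hf.2 x) (hg.2 x)⟩
  zero_mem' := ⟨fun a x => by rw [LinearMap.zero_apply, LinearMap.zero_apply, smul_zero],
    fun x => Submodule.zero_mem _⟩
  smul_mem' c f hf :=
    ⟨fun a x => by
        rw [LinearMap.smul_apply, LinearMap.smul_apply, hf.1]
        exact (smul_comm a c (f x)).symm,
      fun x => Submodule.smul_mem _ c (hf.2 x)⟩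

/-- The module of cochains `Hom_{Δ(H)}(Δ_n, N)`. -/
def DeltaCochain (H : Subgroup G) (N : Submodule k (CrossedProduct σ)) (n : ℕ) : Type _ :=
  deltaCochain k σ H N n

instance (H : Subgroup G) (N : Submodule k (CrossedProduct σ)) (n : ℕ) :
    AddCommGroup (DeltaCochain k σ H N n) :=
  inferInstanceAs (AddCommGroup (deltaCochain k σ H N n))

instance (H : Subgroup G) (N : Submodule k (CrossedProduct σ)) (n : ℕ) :
    Module k (DeltaCochain k σ H N n) :=
  inferInstanceAs (Module k (deltaCochain k σ H N n))

/-- The differential of the complex `Hom_{Δ(H)}(Δ_•, N)`, composition with `deltaD`. -/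
def cochainD (H : Subgroup G) (N : Submodule k (CrossedProduct σ)) (n : ℕ) :
    DeltaCochain k σ H N n →ₗ[k] DeltaCochain k σ H N (n + 1) :=
  (LinearMap.lcomp k (CrossedProduct σ) (deltaD k σ n)).restrict (p := deltaCochain k σ H N n)
    (q := deltaCochain k σ H N (n + 1))
    (fun f hf => ⟨fun a x => by simp only [LinearMap.lcomp_apply, deltaD_smul, hf.1 a],
      fun x => hf.2 _⟩)

/-- `Ext^n_{Δ(H)}(S, N)` for a subspace `N` of `R` stable under `Δ(H)`: the cohomology of the
complex `Hom_{Δ(H)}(Δ_•, N)`, where `Δ_•` is the projective resolution `deltaD`, `deltaAug` of the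
`Δ(H)`-module `S = S 1̄`. -/
abbrev ExtD (H : Subgroup G) (N : Submodule k (CrossedProduct σ)) (n : ℕ) : Type _ :=
  Coh (cochainD k σ H N) n

variable {k σ}

/-- A linear operation on maps `Δ_n → R` that is compatible with the differential and sends
`Δ(H)`-linear maps into `N` to `Δ(H')`-linear maps into `N'` induces a map on cohomology. -/
def ExtD.map {H H' : Subgroup G} {N N' : Submodule k (CrossedProduct σ)}
    (φ : ∀ n, (DeltaN k σ n →ₗ[k] CrossedProduct σ) →ₗ[k] (DeltaN k σ n →ₗ[k] CrossedProduct σ))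
    (h : ∀ n, ∀ f ∈ deltaCochain k σ H N n, φ n f ∈ deltaCochain k σ H' N' n)
    (hd : ∀ n f, φ (n + 1) (f.comp (deltaD k σ n)) = (φ n f).comp (deltaD k σ n)) (n : ℕ) :
    ExtD k σ H N n →ₗ[k] ExtD k σ H' N' n :=
  Coh.map (dX := cochainD k σ H N) (dY := cochainD k σ H' N')
    (fun n => (φ n).restrict (p := deltaCochain k σ H N n) (q := deltaCochain k σ H' N' n) (h n))
    (fun n f => Subtype.ext (hd n f.1)) n

theorem linear_mono {H K : Subgroup G} (hKH : K ≤ H) {n : ℕ}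
    {f : DeltaN k σ n →ₗ[k] CrossedProduct σ}
    (hf : ∀ (a : Delta k σ H) (x : DeltaN k σ n), f (a • x) = a • f x) (a : Delta k σ K)
    (x : DeltaN k σ n) : f (a • x) = a • f x := by
  have h := hf ⟨a.1, Delta_mono hKH a.2⟩ x
  have h1 : (⟨a.1, Delta_mono hKH a.2⟩ : Delta k σ H) • x = a • x := rfl
  have h2 : (⟨a.1, Delta_mono hKH a.2⟩ : Delta k σ H) • f x = a • f x := rfl
  rwa [h1, h2] at h

/-- The restriction map `Ext_{Δ(H)}(S, N) → Ext_{Δ(K)}(S, N)` for `K ≤ H`: a `Δ(H)`-linear map is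
regarded as a `Δ(K)`-linear one. -/
def ExtD.res {H K : Subgroup G} (hKH : K ≤ H) (N : Submodule k (CrossedProduct σ)) (n : ℕ) :
    ExtD k σ H N n →ₗ[k] ExtD k σ K N n :=
  ExtD.map (fun _ => LinearMap.id)
    (fun _ _ hf => ⟨fun a x => linear_mono hKH hf.1 a x, hf.2⟩) (fun _ _ => rfl) n

/-- The map `Ext_{Δ(H)}(S, N) → Ext_{Δ(H)}(S, N')` induced by an inclusion `N ≤ N'`. -/
def ExtD.incl {N N' : Submodule k (CrossedProduct σ)} (hN : N ≤ N') (H : Subgroup G) (n : ℕ) :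
    ExtD k σ H N n →ₗ[k] ExtD k σ H N' n :=
  ExtD.map (fun _ => LinearMap.id) (fun _ _ hf => ⟨hf.1, fun x => hN (hf.2 x)⟩) (fun _ _ => rfl) n

theorem linear_ext {H : Subgroup G} {L : CrossedProduct σ →ₗ[k] CrossedProduct σ}
    (h : ∀ g ∈ H, ∀ x ∈ component σ k g, ∀ y ∈ component σ k g⁻¹, ∀ r,
      L (x * r * y) = x * L r * y) (a : Delta k σ H) (r : CrossedProduct σ) :
    L (a • r) = a • L r := by
  rw [Delta_smul_def, Delta_smul_def]
  refine Delta_induction (H := H) (p := fun a => L (AlgHom.mulLeftRight k (CrossedProduct σ) a r) =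
      AlgHom.mulLeftRight k (CrossedProduct σ) a (L r)) ?_ ?_ ?_ a.2
  · rw [map_zero, LinearMap.zero_apply, map_zero, LinearMap.zero_apply]
  · intro a _ b _ ha hb
    rw [map_add, LinearMap.add_apply, map_add, ha, hb, LinearMap.add_apply]
  · intro g hg x hx y hy
    rw [AlgHom.mulLeftRight_apply, AlgHom.mulLeftRight_apply]
    exact h g hg x hx y hy r

theorem proj_mul {W : Subgroup G} {g : G} (hW : W ≤ Subgroup.centralizer {g}) (h : G) (hh : h ∈ W)
    {x y : CrossedProduct σ} (hx : x ∈ component σ k h) (hy : y ∈ component σ k h⁻¹)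
    (r : CrossedProduct σ) : proj σ k g (x * r * y) = x * proj σ k g r * y := by
  classical
  have hc : g * h = h * g := Subgroup.mem_centralizer_iff.1 (hW hh) g rfl
  induction r using CrossedProduct.induction with
  | h0 => simp
  | hadd a b ha hb => simp only [mul_add, add_mul, map_add, ha, hb]
  | hmk s l =>
    have h1 := mul_mem_component (mul_mem_component hx (mk_mem (k := k) (σ := σ) s l)) hy
    obtain ⟨t, ht⟩ := mem_component.1 h1
    rw [← ht, proj_mk, ht, proj_mk]
    have hiff : h * l * h⁻¹ = g ↔ l = g := by
      rw [mul_inv_eq_iff_eq_mul, hc, mul_right_inj]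
    simp only [hiff]
    split_ifs <;> simp

/-- The map `Ext_{Δ(W)}(S, R) → Ext_{Δ(W)}(S, S ḡ)` induced by the projection `R → S ḡ`, which is
`Δ(W)`-linear for `W ≤ C(g)`. -/
def ExtD.proj {W : Subgroup G} {g : G} (hW : W ≤ Subgroup.centralizer {g}) (n : ℕ) :
    ExtD k σ W ⊤ n →ₗ[k] ExtD k σ W (component σ k g) n :=
  ExtD.map (fun n => (CrossedProduct.proj σ k g).compRight k)
    (fun _ f hf => ⟨fun a x => by
      rw [LinearMap.compRight_apply, LinearMap.comp_apply, hf.1, LinearMap.comp_apply]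
      exact linear_ext (fun h hh x hx y hy r => proj_mul hW h hh hx hy r) a _,
      fun x => proj_mem _ _⟩) (fun _ _ => rfl) n

/-! ### Conjugation and corestriction -/

variable (k σ) in
/-- The element `x̄ ⊗ x̄⁻¹` of `Δ(G)`. -/
def conjElt (x : G) : Delta k σ (⊤ : Subgroup G) :=
  ⟨(bar σ x : CrossedProduct σ) ⊗ₜ[k] op (((bar σ x)⁻¹ : (CrossedProduct σ)ˣ) : CrossedProduct σ),
    tmul_mem_Delta (Subgroup.mem_top x) (bar_mem x) (bar_inv_mem x)⟩

variable (k σ) in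
/-- The inverse `x̄⁻¹ ⊗ x̄` of `conjElt`. -/
def conjEltInv (x : G) : Delta k σ (⊤ : Subgroup G) :=
  ⟨(((bar σ x)⁻¹ : (CrossedProduct σ)ˣ) : CrossedProduct σ) ⊗ₜ[k] op (bar σ x : CrossedProduct σ),
    tmul_mem_Delta (Subgroup.mem_top x⁻¹) (bar_inv_mem x) (by rw [inv_inv]; exact bar_mem x)⟩

theorem conjEltInv_mul (x : G) : conjEltInv k σ x * conjElt k σ x = 1 := by
  refine Subtype.ext ?_
  change (_ ⊗ₜ[k] _ : Env k (CrossedProduct σ)) * (_ ⊗ₜ[k] _) = 1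
  rw [Algebra.TensorProduct.tmul_mul_tmul, ← op_mul, Units.inv_mul, op_one]
  rfl

theorem conjElt_mul (x : G) : conjElt k σ x * conjEltInv k σ x = 1 := by
  refine Subtype.ext ?_
  change (_ ⊗ₜ[k] _ : Env k (CrossedProduct σ)) * (_ ⊗ₜ[k] _) = 1
  rw [Algebra.TensorProduct.tmul_mul_tmul, ← op_mul, Units.mul_inv, op_one]
  rfl

variable (k σ) in
/-- The conjugate `p ↦ x̄ f(x̄⁻¹ p x̄) x̄⁻¹` of a map `f : Δ_n → R`. -/
def conjMap (x : G) (n : ℕ) :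
    (DeltaN k σ n →ₗ[k] CrossedProduct σ) →ₗ[k] (DeltaN k σ n →ₗ[k] CrossedProduct σ) where
  toFun f :=
    { toFun := fun p => bar σ x * f (conjEltInv k σ x • p) * ((bar σ x)⁻¹ : (CrossedProduct σ)ˣ)
      map_add' := fun p q => by rw [smul_add, map_add, mul_add, add_mul]
      map_smul' := fun c p => by
        have : conjEltInv k σ x • c • p = c • conjEltInv k σ x • p :=
          Subtype.ext (map_smul (Bar.act n (conjEltInv k σ x).1) c p.1)
        rw [this, map_smul, mul_smul_comm, smul_mul_assoc]
        rfl }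
  map_add' f g := by
    refine LinearMap.ext fun p => ?_
    change bar σ x * (f _ + g _) * _ = bar σ x * f _ * _ + bar σ x * g _ * _
    rw [mul_add, add_mul]
  map_smul' c f := by
    refine LinearMap.ext fun p => ?_
    change bar σ x * (c • f _) * _ = c • (bar σ x * f _ * _)
    rw [mul_smul_comm, smul_mul_assoc]

theorem conjMap_apply (x : G) {n : ℕ} (f : DeltaN k σ n →ₗ[k] CrossedProduct σ)
    (p : DeltaN k σ n) : conjMap k σ x n f p =
      bar σ x * f (conjEltInv k σ x • p) * ((bar σ x)⁻¹ : (CrossedProduct σ)ˣ) :=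
  rfl

theorem conjMap_deltaD (x : G) (n : ℕ) (f : DeltaN k σ n →ₗ[k] CrossedProduct σ) :
    conjMap k σ x (n + 1) (f.comp (deltaD k σ n)) = (conjMap k σ x n f).comp (deltaD k σ n) := by
  ext p
  simp only [conjMap_apply, LinearMap.comp_apply, deltaD_smul]

/-- A convenient form of `Δ(H)`-linearity. -/
theorem linear_iff {H : Subgroup G} {n : ℕ} {f : DeltaN k σ n →ₗ[k] CrossedProduct σ} :
    (∀ (a : Delta k σ H) (x : DeltaN k σ n),
      f (a • x) = a • f x) ↔
    ∀ h ∈ H, ∀ (y z : CrossedProduct σ) (hy : y ∈ component σ k h) (hz : z ∈ component σ k h⁻¹)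
      (x : DeltaN k σ n), f ((⟨y ⊗ₜ[k] op z, tmul_mem_Delta (Subgroup.mem_top h) hy hz⟩ :
        Delta k σ (⊤ : Subgroup G)) • x) = y * f x * z := by
  constructor
  · intro hf h hh y z hy hz x
    have := hf ⟨y ⊗ₜ[k] op z, tmul_mem_Delta hh hy hz⟩ x
    rwa [Delta_smul_def, AlgHom.mulLeftRight_apply] at this
  · intro hf a x
    refine Delta_induction (H := H) (p := fun a => ∀ ha : a ∈ Delta k σ H,
      f ((⟨a, ha⟩ : Delta k σ H) • x) = (⟨a, ha⟩ : Delta k σ H) • f x)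
      ?_ ?_ ?_ a.2 a.2
    · intro h0
      have : ((⟨0, h0⟩ : Delta k σ H) • x) = 0 := zero_smul (Delta k σ H) x
      rw [this, map_zero]
      exact (zero_smul (Delta k σ H) (f x)).symm
    · intro a ha' b hb' ha hb hab
      have : ((⟨a + b, hab⟩ : Delta k σ H) • x) =
          (⟨a, ha'⟩ : Delta k σ H) • x + (⟨b, hb'⟩ : Delta k σ H) • x :=
        add_smul (⟨a, ha'⟩ : Delta k σ H) ⟨b, hb'⟩ x
      rw [this, map_add, ha ha', hb hb']
      exact (add_smul (⟨a, ha'⟩ : Delta k σ H) ⟨b, hb'⟩ (f x)).symm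
    · intro h hh y hy z hz _
      rw [Delta_smul_def, AlgHom.mulLeftRight_apply]
      exact hf h hh y z hy hz x

end Ext

section Conj

set_option linter.unusedSectionVars false

open CrossedProduct

variable {G S : Type*} [Group G] [Ring S] [MulSemiringAction G S]
variable {k : Type*} [CommRing k] [Algebra k S] [SMulCommClass G k S]
variable {σ : TwoCocycle G S}

theorem tmul_mul_tmul_op (a b c d : CrossedProduct σ) :
    (a ⊗ₜ[k] op b * c ⊗ₜ[k] op d : Env k (CrossedProduct σ)) = (a * c) ⊗ₜ[k] op (d * b) := by
  rw [Algebra.TensorProduct.tmul_mul_tmul, ← op_mul]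

theorem conjMap_tmul {K : Subgroup G} {n : ℕ} {f : DeltaN k σ n →ₗ[k] CrossedProduct σ}
    (hf : ∀ (a : Delta k σ K) (x : DeltaN k σ n), f (a • x) = a • f x) {g g' h : G}
    (hK : g⁻¹ * h * g' ∈ K) {y z : CrossedProduct σ} (hy : y ∈ component σ k h)
    (hz : z ∈ component σ k h⁻¹) (p : DeltaN k σ n) :
    conjMap k σ g n f ((⟨y ⊗ₜ[k] op z, tmul_mem_Delta (Subgroup.mem_top h) hy hz⟩ :
        Delta k σ (⊤ : Subgroup G)) • p) = y * conjMap k σ g' n f p * z := by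
  set a : CrossedProduct σ := (((bar σ g)⁻¹ : (CrossedProduct σ)ˣ) : CrossedProduct σ) with ha
  set a' : CrossedProduct σ := (((bar σ g')⁻¹ : (CrossedProduct σ)ˣ) : CrossedProduct σ) with ha'
  have h1 : a * y * bar σ g' ∈ component σ k (g⁻¹ * h * g') :=
    mul_mem_component (mul_mem_component (bar_inv_mem g) hy) (bar_mem g')
  have h2 : a' * z * bar σ g ∈ component σ k (g⁻¹ * h * g')⁻¹ := by
    have := mul_mem_component (mul_mem_component (bar_inv_mem (k := k) g') hz) (bar_mem g)
    rwa [show g'⁻¹ * h⁻¹ * g = (g⁻¹ * h * g')⁻¹ by group] at this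
  have key : conjEltInv k σ g • ((⟨y ⊗ₜ[k] op z, tmul_mem_Delta (Subgroup.mem_top h) hy hz⟩ :
        Delta k σ (⊤ : Subgroup G)) • p) =
      (⟨(a * y * bar σ g') ⊗ₜ[k] op (a' * z * bar σ g),
        tmul_mem_Delta (Subgroup.mem_top _) h1 h2⟩ : Delta k σ (⊤ : Subgroup G)) •
        conjEltInv k σ g' • p := by
    refine (smul_smul (M := Delta k σ (⊤ : Subgroup G)) (α := DeltaN k σ n) _ _ _).trans
      (Eq.trans ?_
        (smul_smul (M := Delta k σ (⊤ : Subgroup G)) (α := DeltaN k σ n) _ _ _).symm)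
    congr 1
    refine Subtype.ext ?_
    change (a ⊗ₜ[k] op (bar σ g : CrossedProduct σ) * y ⊗ₜ[k] op z : Env k (CrossedProduct σ)) =
      (a * y * bar σ g') ⊗ₜ[k] op (a' * z * bar σ g) *
        a' ⊗ₜ[k] op (bar σ g' : CrossedProduct σ)
    rw [tmul_mul_tmul_op, tmul_mul_tmul_op, mul_assoc (a * y), ha', Units.mul_inv, mul_one,
      ← mul_assoc, ← mul_assoc, Units.mul_inv, one_mul]
  rw [conjMap_apply, conjMap_apply, key, linear_iff.1 hf _ hK _ _ h1 h2]
  simp only [ha, ha', mul_assoc, Units.mul_inv_cancel_left, Units.mul_inv, mul_one]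

/-- The subgroup `x H x⁻¹`. -/
def conjSub (x : G) (H : Subgroup G) : Subgroup G := H.map (MulAut.conj x).toMonoidHom

theorem mem_conjSub {x g : G} {H : Subgroup G} : g ∈ conjSub x H ↔ x⁻¹ * g * x ∈ H := by
  constructor
  · rintro ⟨h, hh, rfl⟩
    change x⁻¹ * (x * h * x⁻¹) * x ∈ H
    rwa [show x⁻¹ * (x * h * x⁻¹) * x = h by group]
  · intro h
    refine ⟨_, h, ?_⟩
    change x * (x⁻¹ * g * x) * x⁻¹ = g
    group

theorem conj_mem_component (x : G) {g : G} {r : CrossedProduct σ} (hr : r ∈ component σ k g) :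
    bar σ x * r * ((bar σ x)⁻¹ : (CrossedProduct σ)ˣ) ∈ component σ k (x * g * x⁻¹) :=
  mul_mem_component (mul_mem_component (bar_mem x) hr) (bar_inv_mem x)

/-- The conjugation map `x^* : Ext_{Δ(H)}(S, N) → Ext_{Δ(x H x⁻¹)}(S, N')`, where `N'` contains
`x̄ N x̄⁻¹`; on cochains it sends `f` to `p ↦ x̄ f(x̄⁻¹ p x̄) x̄⁻¹`. -/
def ExtD.conj (x : G) (H : Subgroup G) {N N' : Submodule k (CrossedProduct σ)}
    (hN : ∀ r ∈ N, bar σ x * r * ((bar σ x)⁻¹ : (CrossedProduct σ)ˣ) ∈ N') (n : ℕ) :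
    ExtD k σ H N n →ₗ[k] ExtD k σ (conjSub x H) N' n :=
  ExtD.map (conjMap k σ x)
    (fun _ _ hf => ⟨linear_iff.2 (fun _ hh _ _ hy hz p =>
      conjMap_tmul hf.1 (mem_conjSub.1 hh) hy hz p), fun _ => hN _ (hf.2 _)⟩)
    (conjMap_deltaD x) n

variable [Finite G]

variable (k σ) in
open Classical in
/-- The map `f ↦ ∑_{g ∈ H / K} (p ↦ ḡ f(ḡ⁻¹ p ḡ) ḡ⁻¹)`, where the sum runs over a set of
representatives of the cosets `g K` in `H`. -/
def coresMap (H K : Subgroup G) (n : ℕ) :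
    (DeltaN k σ n →ₗ[k] CrossedProduct σ) →ₗ[k] (DeltaN k σ n →ₗ[k] CrossedProduct σ) :=
  letI := Fintype.ofFinite (H ⧸ K.subgroupOf H)
  ∑ q : H ⧸ K.subgroupOf H, conjMap k σ ((q.out : H) : G) n

theorem coresMap_tmul {H K : Subgroup G} {n : ℕ} {f : DeltaN k σ n →ₗ[k] CrossedProduct σ}
    (hf : ∀ (a : Delta k σ K) (x : DeltaN k σ n), f (a • x) = a • f x) {h : G} (hh : h ∈ H)
    {y z : CrossedProduct σ} (hy : y ∈ component σ k h) (hz : z ∈ component σ k h⁻¹)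
    (p : DeltaN k σ n) :
    coresMap k σ H K n f ((⟨y ⊗ₜ[k] op z, tmul_mem_Delta (Subgroup.mem_top h) hy hz⟩ :
        Delta k σ (⊤ : Subgroup G)) • p) = y * coresMap k σ H K n f p * z := by
  let _ := Fintype.ofFinite (H ⧸ K.subgroupOf H)
  unfold coresMap
  simp only [LinearMap.sum_apply, Finset.mul_sum, Finset.sum_mul]
  refine Fintype.sum_equiv (MulAction.toPerm (⟨h, hh⟩⁻¹ : H)) _ _ fun q => ?_
  refine conjMap_tmul hf ?_ hy hz p
  have h1 : (QuotientGroup.mk q.out : H ⧸ K.subgroupOf H) =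
      QuotientGroup.mk (⟨h, hh⟩ * (MulAction.toPerm (⟨h, hh⟩⁻¹ : H) q).out) := by
    rw [QuotientGroup.out_eq', ← smul_eq_mul, ← MulAction.Quotient.smul_mk,
      QuotientGroup.out_eq', MulAction.toPerm_apply, smul_inv_smul]
  have h2 := QuotientGroup.eq.1 h1
  rw [Subgroup.mem_subgroupOf] at h2
  simpa [mul_assoc] using h2

theorem coresMap_deltaD (H K : Subgroup G) (n : ℕ) (f : DeltaN k σ n →ₗ[k] CrossedProduct σ) :
    coresMap k σ H K (n + 1) (f.comp (deltaD k σ n)) =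
      (coresMap k σ H K n f).comp (deltaD k σ n) := by
  unfold coresMap
  simp only [LinearMap.sum_apply, conjMap_deltaD]
  ext p
  simp only [LinearMap.sum_apply, LinearMap.comp_apply]

theorem coresMap_mem {H K : Subgroup G} {N : Submodule k (CrossedProduct σ)}
    (hN : ∀ g ∈ H, ∀ r ∈ N, bar σ g * r * ((bar σ g)⁻¹ : (CrossedProduct σ)ˣ) ∈ N) {n : ℕ}
    {f : DeltaN k σ n →ₗ[k] CrossedProduct σ} (hf : ∀ x, f x ∈ N) (p : DeltaN k σ n) :
    coresMap k σ H K n f p ∈ N := by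
  unfold coresMap
  rw [LinearMap.sum_apply, LinearMap.sum_apply]
  exact Submodule.sum_mem _ fun q _ => hN _ q.out.2 _ (hf _)

/-- The corestriction map `Ext_{Δ(K)}(S, N) → Ext_{Δ(H)}(S, N)` for `K ≤ H` and a subspace `N`
of `R` stable under `Δ(H)`; on cochains it is `f ↦ ∑_{g ∈ H / K} g f g⁻¹`. -/
def ExtD.cores {H K : Subgroup G} (_hKH : K ≤ H) {N : Submodule k (CrossedProduct σ)}
    (hN : ∀ g ∈ H, ∀ r ∈ N, bar σ g * r * ((bar σ g)⁻¹ : (CrossedProduct σ)ˣ) ∈ N) (n : ℕ) :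
    ExtD k σ K N n →ₗ[k] ExtD k σ H N n :=
  ExtD.map (coresMap k σ H K)
    (fun _ _ hf => ⟨linear_iff.2 (fun _ hh _ _ hy hz p => coresMap_tmul hf.1 hh hy hz p),
      coresMap_mem hN hf.2⟩)
    (coresMap_deltaD H K) n

end Conj

/-! ### The cup product -/

section Cup

set_option linter.unusedSectionVars false

open CrossedProduct

variable {G S : Type*} [Group G] [Fintype G] [Ring S] [MulSemiringAction G S]
variable {k : Type*} [CommRing k] [Algebra k S] [SMulCommClass G k S]
variable {σ : TwoCocycle G S}

theorem retr_sandwich {H : Subgroup G} {N : Submodule k (CrossedProduct σ)} {n : ℕ}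
    (f : DeltaCochain k σ H N n) {h : G} (hh : h ∈ H) {y z : CrossedProduct σ}
    (hy : y ∈ component σ k h) (hz : z ∈ component σ k h⁻¹)
    (r : Fin (n + 2) → CrossedProduct σ) :
    f.1.comp (deltaRetr k σ n) (Bar.tprod k (sandwich y z r)) =
      y * f.1.comp (deltaRetr k σ n) (Bar.tprod k r) * z := by
  have h1 := deltaRetr_smul (k := k) (σ := σ) (H := H)
    ⟨y ⊗ₜ[k] op z, tmul_mem_Delta hh hy hz⟩ (Bar.tprod k r)
  have h2 := f.2.1 ⟨y ⊗ₜ[k] op z, tmul_mem_Delta hh hy hz⟩ (deltaRetr k σ n (Bar.tprod k r))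
  rw [Delta_smul_def, AlgHom.mulLeftRight_apply] at h2
  rw [← Bar.tmul_smul_tprod, LinearMap.comp_apply, LinearMap.comp_apply]
  exact (congrArg f.1 h1).trans h2

theorem bar_mul_mem (h e : G) : (bar σ (h * e) : CrossedProduct σ) *
    ((bar σ e)⁻¹ : (CrossedProduct σ)ˣ) ∈ component σ k h := by
  have := mul_mem_component (bar_mem (k := k) (σ := σ) (h * e)) (bar_inv_mem e)
  rwa [mul_inv_cancel_right] at this

theorem bar_mul_inv_mem (h e : G) : (bar σ e : CrossedProduct σ) *
    ((bar σ (h * e))⁻¹ : (CrossedProduct σ)ˣ) ∈ component σ k h⁻¹ := by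
  have := mul_mem_component (bar_mem (k := k) (σ := σ) e) (bar_inv_mem (h * e))
  rwa [mul_inv_rev, mul_inv_cancel_left] at this

variable (k σ) in
/-- The cup product of cochains in `Hom_{Δ(H)}(Δ_•, R)`. On a tensor `r_0 ⊗ ⋯ ⊗ r_{m+n+1}` with
`r_i ∈ S ḡ_i` and `g_0 ⋯ g_{m+n+1} = 1` it is
`(f ⌣ f')(r_0 ⊗ ⋯ ⊗ r_{m+n+1}) = f (r_0 ⊗ ⋯ ⊗ r_m ⊗ h̄⁻¹) * f' (h̄ ⊗ r_{m+1} ⊗ ⋯ ⊗ r_{m+n+1})`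
with `h = g_0 ⋯ g_m` (see `deltaCup_tprod`). -/
def deltaCup (H : Subgroup G) {m n N : ℕ} (h : m + n = N) :
    DeltaCochain k σ H ⊤ m →ₗ[k] DeltaCochain k σ H ⊤ n →ₗ[k] DeltaCochain k σ H ⊤ N :=
  LinearMap.mk₂ k (fun f f' =>
    ⟨(barCup (fun e : G => (((bar σ e)⁻¹ : (CrossedProduct σ)ˣ) : CrossedProduct σ))
      (fun e : G => (bar σ e : CrossedProduct σ)) h (f.1.comp (deltaRetr k σ m))
      (f'.1.comp (deltaRetr k σ n))).comp (deltaIncl k σ N), by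
      refine ⟨linear_iff.2 ?_, fun _ => Submodule.mem_top⟩
      intro l hl y z hy hz x
      rw [LinearMap.comp_apply, LinearMap.comp_apply, deltaIncl_smul]
      generalize deltaIncl k σ N x = w
      suffices hs : (barCup (fun e : G => (((bar σ e)⁻¹ : (CrossedProduct σ)ˣ) : CrossedProduct σ))
          (fun e : G => (bar σ e : CrossedProduct σ)) h (f.1.comp (deltaRetr k σ m))
          (f'.1.comp (deltaRetr k σ n))).comp (Bar.act N (y ⊗ₜ[k] op z)) =
          ((LinearMap.mulRight k z).comp (LinearMap.mulLeft k y)).comp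
          (barCup (fun e : G => (((bar σ e)⁻¹ : (CrossedProduct σ)ˣ) : CrossedProduct σ))
          (fun e : G => (bar σ e : CrossedProduct σ)) h (f.1.comp (deltaRetr k σ m))
          (f'.1.comp (deltaRetr k σ n))) from LinearMap.congr_fun hs w
      refine Bar.hom_ext fun r => ?_
      rw [LinearMap.comp_apply, LinearMap.comp_apply, LinearMap.comp_apply, ← Bar.smul_def,
        Bar.tmul_smul_tprod, barCup_tprod, barCup_tprod, LinearMap.mulLeft_apply,
        LinearMap.mulRight_apply, Finset.mul_sum, Finset.sum_mul]
      symm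
      refine Fintype.sum_equiv (Equiv.mulLeft l) _ _ fun e => ?_
      simp only [Equiv.coe_mulLeft]
      have e1 : (((bar σ (l * e))⁻¹ : (CrossedProduct σ)ˣ) : CrossedProduct σ) =
          ((bar σ e)⁻¹ : (CrossedProduct σ)ˣ) *
            (bar σ e * ((bar σ (l * e))⁻¹ : (CrossedProduct σ)ˣ)) := by
        rw [← mul_assoc, Units.inv_mul, one_mul]
      have e2 : (bar σ (l * e) : CrossedProduct σ) =
          bar σ (l * e) * ((bar σ e)⁻¹ : (CrossedProduct σ)ˣ) * bar σ e := by
        rw [mul_assoc, Units.inv_mul, mul_one]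
      have t1 : headTuple (m := m) (by omega) (sandwich y z r)
          (((bar σ (l * e))⁻¹ : (CrossedProduct σ)ˣ) : CrossedProduct σ) =
          sandwich y ((bar σ e : CrossedProduct σ) *
            (((bar σ (l * e))⁻¹ : (CrossedProduct σ)ˣ) : CrossedProduct σ))
            (headTuple (by omega) r (((bar σ e)⁻¹ : (CrossedProduct σ)ˣ) : CrossedProduct σ)) := by
        rw [headTuple_sandwich]
        ext j
        by_cases hj : (j : ℕ) ≤ m
        · have h1 : (j : ℕ) ≠ m + 1 := by omega
          simp [headTuple, sandwich, hj, h1]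
        · have h1 : (j : ℕ) = m + 1 := by omega
          simp [headTuple, sandwich, h1]
      have t2 : tailTuple h (bar σ (l * e) : CrossedProduct σ) (sandwich y z r) =
          sandwich ((bar σ (l * e) : CrossedProduct σ) *
            (((bar σ e)⁻¹ : (CrossedProduct σ)ˣ) : CrossedProduct σ)) z
            (tailTuple h (bar σ e : CrossedProduct σ) r) := by
        rw [tailTuple_sandwich]
        ext j
        by_cases hj : j = 0
        · subst hj
          simp [tailTuple, sandwich]
        · simp [tailTuple, sandwich, hj]
      rw [t1, t2, retr_sandwich f hl hy (bar_mul_inv_mem l e),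
        retr_sandwich f' hl (bar_mul_mem l e) hz]
      simp only [mul_assoc, Units.inv_mul_cancel_left, Units.mul_inv_cancel_left]⟩)
    (fun f g f' => Subtype.ext (by
      change LinearMap.comp (barCup _ _ h ((f.1 + g.1).comp _) _) _ =
        LinearMap.comp _ _ + LinearMap.comp _ _
      rw [LinearMap.add_comp, map_add, LinearMap.add_apply, LinearMap.add_comp]))
    (fun c f f' => Subtype.ext (by
      change LinearMap.comp (barCup _ _ h ((c • f.1).comp _) _) _ = c • LinearMap.comp _ _
      rw [LinearMap.smul_comp, map_smul, LinearMap.smul_apply, LinearMap.smul_comp]))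
    (fun f f' g' => Subtype.ext (by
      change LinearMap.comp (barCup _ _ h _ ((f'.1 + g'.1).comp _)) _ =
        LinearMap.comp _ _ + LinearMap.comp _ _
      rw [LinearMap.add_comp, map_add, LinearMap.add_comp]))
    (fun c f f' => Subtype.ext (by
      change LinearMap.comp (barCup _ _ h _ ((c • f'.1).comp _)) _ = c • LinearMap.comp _ _
      rw [LinearMap.smul_comp, map_smul, LinearMap.smul_comp]))

theorem deltaCup_apply {H : Subgroup G} {m n N : ℕ} (h : m + n = N)
    (f : DeltaCochain k σ H ⊤ m) (f' : DeltaCochain k σ H ⊤ n) (x : DeltaN k σ N) :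
    (deltaCup k σ H h f f').1 x =
      barCup (fun e : G => (((bar σ e)⁻¹ : (CrossedProduct σ)ˣ) : CrossedProduct σ))
        (fun e : G => (bar σ e : CrossedProduct σ)) h (f.1.comp (deltaRetr k σ m))
        (f'.1.comp (deltaRetr k σ n)) (deltaIncl k σ N x) :=
  rfl

theorem deltaCup_balanced {H : Subgroup G} {m n : ℕ}
    (f : DeltaCochain k σ H ⊤ m) (f' : DeltaCochain k σ H ⊤ n) (x : CrossedProduct σ)
    (p : Fin (m + 2) → CrossedProduct σ) (q : Fin (n + 2) → CrossedProduct σ) :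
    ∑ e : G, f.1.comp (deltaRetr k σ m) (Bar.tprod k (Function.update p (Fin.last _)
        (x * (((bar σ e)⁻¹ : (CrossedProduct σ)ˣ) : CrossedProduct σ)))) *
      f'.1.comp (deltaRetr k σ n) (Bar.tprod k (Function.update q 0 (bar σ e : CrossedProduct σ))) =
    ∑ e : G, f.1.comp (deltaRetr k σ m) (Bar.tprod k (Function.update p (Fin.last _)
        (((bar σ e)⁻¹ : (CrossedProduct σ)ˣ) : CrossedProduct σ))) *
      f'.1.comp (deltaRetr k σ n) (Bar.tprod k (Function.update q 0
        ((bar σ e : CrossedProduct σ) * x))) := by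
  induction x using CrossedProduct.induction with
  | h0 =>
    simp only [zero_mul, mul_zero, MultilinearMap.map_update_zero, map_zero]
  | hadd x y hx hy =>
    simp only [add_mul, mul_add, MultilinearMap.map_update_add, map_add, Finset.sum_add_distrib,
      hx, hy]
  | hmk s g =>
    symm
    refine Fintype.sum_equiv (Equiv.mulRight g) _ _ fun e => ?_
    simp only [Equiv.coe_mulRight]
    set w : CrossedProduct σ := (bar σ e : CrossedProduct σ) * mk σ s g *
      (((bar σ (e * g))⁻¹ : (CrossedProduct σ)ˣ) : CrossedProduct σ) with hw
    have hw1 : w ∈ component σ k 1 := by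
      have := mul_mem_component (mul_mem_component (bar_mem (k := k) (σ := σ) e) (mk_mem s g))
        (bar_inv_mem (e * g))
      rwa [mul_inv_cancel] at this
    have e1 : mk σ s g * (((bar σ (e * g))⁻¹ : (CrossedProduct σ)ˣ) : CrossedProduct σ) =
        (((bar σ e)⁻¹ : (CrossedProduct σ)ˣ) : CrossedProduct σ) * w := by
      rw [hw, mul_assoc, Units.inv_mul_cancel_left]
    have e2 : (bar σ e : CrossedProduct σ) * mk σ s g = w * (bar σ (e * g) : CrossedProduct σ) := by
      rw [hw, mul_assoc _ _ (bar σ (e * g) : CrossedProduct σ), Units.inv_mul, mul_one]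
    have h1 : (1 : CrossedProduct σ) ∈ component σ k 1 := one_mem_component
    have h1' : (1 : CrossedProduct σ) ∈ component σ k 1⁻¹ := by rw [inv_one]; exact h1
    have hw1' : w ∈ component σ k 1⁻¹ := by rw [inv_one]; exact hw1
    rw [e1, e2, update_last_eq_sandwich, update_zero_eq_sandwich,
      retr_sandwich f H.one_mem h1 hw1', retr_sandwich f' H.one_mem hw1 h1', one_mul, mul_one]
    simp only [mul_assoc]

theorem deltaCup_leibniz (H : Subgroup G) {m n N : ℕ} (h : m + n = N) (h1 : (m + 1) + n = N + 1)
    (h2 : m + (n + 1) = N + 1) (f : DeltaCochain k σ H ⊤ m) (f' : DeltaCochain k σ H ⊤ n) :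
    deltaCup k σ H h1 (cochainD k σ H ⊤ m f) f' +
        (-1 : k) ^ m • deltaCup k σ H h2 f (cochainD k σ H ⊤ n f') =
      cochainD k σ H ⊤ N (deltaCup k σ H h f f') := by
  have key := barCup_leibniz (k := k)
    (fun e : G => (((bar σ e)⁻¹ : (CrossedProduct σ)ˣ) : CrossedProduct σ))
    (fun e : G => (bar σ e : CrossedProduct σ)) h h1 h2 (f.1.comp (deltaRetr k σ m))
    (f'.1.comp (deltaRetr k σ n)) (deltaCup_balanced f f')
  have d : ∀ {l : ℕ} (u : DeltaCochain k σ H ⊤ l),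
      (u.1.comp (deltaRetr k σ l)).comp (barD k (CrossedProduct σ) l) =
        (cochainD k σ H ⊤ l u).1.comp (deltaRetr k σ (l + 1)) := by
    intro l u
    refine LinearMap.ext fun x => ?_
    exact congrArg u.1 (deltaRetr_barD x)
  rw [d, d] at key
  refine Subtype.ext (LinearMap.ext fun x => ?_)
  exact LinearMap.congr_fun key (deltaIncl k σ (N + 1) x)

/-- The value of the cup product on a homogeneous tensor of `Δ_{m+n}`. -/
theorem deltaCup_tprod {H : Subgroup G} {m n N : ℕ} (h : m + n = N) (hm : m ≤ N)
    (f : DeltaCochain k σ H ⊤ m) (f' : DeltaCochain k σ H ⊤ n)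
    (r : Fin (N + 2) → CrossedProduct σ) (g : Fin (N + 2) → G)
    (hr : ∀ i, r i ∈ component σ k (g i)) (e : G) (he : (List.ofFn (headTuple hm g e⁻¹)).prod = 1)
    (x : DeltaN k σ N) (hx : deltaIncl k σ N x = Bar.tprod k r) (x₁ : DeltaN k σ m)
    (hx₁ : deltaIncl k σ m x₁ = Bar.tprod k
      (headTuple hm r (((bar σ e)⁻¹ : (CrossedProduct σ)ˣ) : CrossedProduct σ)))
    (x₂ : DeltaN k σ n)
    (hx₂ : deltaIncl k σ n x₂ = Bar.tprod k (tailTuple h (bar σ e : CrossedProduct σ) r)) :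
    (deltaCup k σ H h f f').1 x = f.1 x₁ * f'.1 x₂ := by
  classical
  rw [deltaCup_apply, hx, barCup_tprod, Finset.sum_eq_single e, ← hx₁, ← hx₂,
    LinearMap.comp_apply, LinearMap.comp_apply, deltaRetr_deltaIncl, deltaRetr_deltaIncl]
  · intro e' _ hne
    have h0 : deltaRetr k σ m (Bar.tprod k
        (headTuple hm r (((bar σ e')⁻¹ : (CrossedProduct σ)ˣ) : CrossedProduct σ))) = 0 := by
      refine deltaIncl_injective m ?_
      have hc : ∀ i, headTuple hm r (((bar σ e')⁻¹ : (CrossedProduct σ)ˣ) : CrossedProduct σ) i ∈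
          component σ k (headTuple hm g e'⁻¹ i) := by
        intro i
        unfold headTuple
        split_ifs
        · exact hr _
        · exact bar_inv_mem e'
      have hs : headTuple hm g e'⁻¹ = sandwich 1 (e * e'⁻¹) (headTuple hm g e⁻¹) := by
        ext j
        by_cases hj : (j : ℕ) ≤ m
        · have h1 : (j : ℕ) ≠ m + 1 := by omega
          simp [headTuple, sandwich, hj, h1]
        · have h1 : (j : ℕ) = m + 1 := by omega
          simp [headTuple, sandwich, h1]
      rw [deltaIncl_deltaRetr, deltaProj_tprod hc, if_neg, map_zero]
      rw [hs, prod_sandwich, he, one_mul, one_mul, mul_inv_eq_one]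
      exact fun h' => hne h'.symm
    rw [LinearMap.comp_apply, h0, map_zero, zero_mul]
  · intro h'
    exact absurd (Finset.mem_univ _) h'

/-- The cup product on `Ext_{Δ(H)}(S, R)`. -/
def ExtD.cup (H : Subgroup G) (m n : ℕ) :
    ExtD k σ H ⊤ m →ₗ[k] ExtD k σ H ⊤ n →ₗ[k] ExtD k σ H ⊤ (m + n) :=
  Coh.cup (d := cochainD k σ H ⊤) (deltaCup k σ H) (deltaCup_leibniz H) m n

variable (k σ) in
/-- The map `HH^n(R) → Ext^n_Δ(S, R)` given by restricting maps from `R^{⊗ (n + 2)}` to `Δ_n`. -/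
def HH.toExt (n : ℕ) : HH k (CrossedProduct σ) n →ₗ[k] ExtD k σ (⊤ : Subgroup G) ⊤ n :=
  Coh.map (dX := hochD k (CrossedProduct σ)) (dY := cochainD k σ ⊤ ⊤)
    (fun n => (LinearMap.lcomp k (CrossedProduct σ) (deltaIncl k σ n)).restrict
      (p := hochCochain k (CrossedProduct σ) n) (q := deltaCochain k σ ⊤ ⊤ n)
      (fun _ hf => ⟨fun a x => hf a.1 (deltaIncl k σ n x), fun _ => Submodule.mem_top⟩))
    (fun _ _ => rfl) n

end Cup

/-! ## Total cohomology -/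

section Total

set_option linter.unusedSectionVars false

/-- The bilinear product on `⨁ n, M n` defined by a family of products `M m × M n → M (m + n)`. -/
def totalMul {k : Type*} [CommRing k] {M : ℕ → Type*} [∀ n, AddCommGroup (M n)]
    [∀ n, Module k (M n)] (μ : ∀ m n, M m →ₗ[k] M n →ₗ[k] M (m + n)) :
    (⨁ n, M n) →ₗ[k] (⨁ n, M n) →ₗ[k] (⨁ n, M n) :=
  DirectSum.toModule k ℕ _ fun m => LinearMap.flip (DirectSum.toModule k ℕ _ fun n =>
    LinearMap.flip ((μ m n).compr₂ (DirectSum.lof k ℕ M (m + n))))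

/-- The Hochschild cohomology `HH^*(R) = ⨁ n, HH^n(R)`. -/
abbrev HHTot (k R : Type*) [CommRing k] [Ring R] [Algebra k R] : Type _ := ⨁ n, HH k R n

/-- The cup product on `HH^*(R)`. -/
def HHTot.mul (k R : Type*) [CommRing k] [Ring R] [Algebra k R] :
    HHTot k R →ₗ[k] HHTot k R →ₗ[k] HHTot k R :=
  totalMul (HH.cup k R)

/-- The unit of `HH^*(R)`. -/
def HHTot.one (k R : Type*) [CommRing k] [Ring R] [Algebra k R] : HHTot k R :=
  DirectSum.lof k ℕ (fun n => HH k R n) 0 (HH.unit k R)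

open CrossedProduct

variable {G S : Type*} [Group G] [Fintype G] [Ring S] [MulSemiringAction G S]
variable (k : Type*) [CommRing k] [Algebra k S] [SMulCommClass G k S]
variable (σ : TwoCocycle G S)

/-- `Ext^*_{Δ(H)}(S, N) = ⨁ n, Ext^n_{Δ(H)}(S, N)`. -/
abbrev ExtTot (H : Subgroup G) (N : Submodule k (CrossedProduct σ)) : Type _ :=
  ⨁ n, ExtD k σ H N n

/-- The map `HH^*(R) → Ext^*_Δ(S, R)` given by restricting maps from `R^{⊗ (n + 2)}` to `Δ_n`. -/
def HHTot.toExt : HHTot k (CrossedProduct σ) →ₗ[k] ExtTot k σ (⊤ : Subgroup G) ⊤ :=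
  DirectSum.lmap (HH.toExt k σ)

variable {k σ}

/-- The cup product on `Ext^*_{Δ(H)}(S, R)`. -/
def ExtTot.mul (H : Subgroup G) :
    ExtTot k σ H ⊤ →ₗ[k] ExtTot k σ H ⊤ →ₗ[k] ExtTot k σ H ⊤ :=
  totalMul (ExtD.cup H)

/-- The restriction map `res^H_K`. -/
def ExtTot.res {H K : Subgroup G} (hKH : K ≤ H) (N : Submodule k (CrossedProduct σ)) :
    ExtTot k σ H N →ₗ[k] ExtTot k σ K N :=
  DirectSum.lmap (ExtD.res hKH N)

/-- The conjugation map `x^*`. -/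
def ExtTot.conj (x : G) (H : Subgroup G) {N N' : Submodule k (CrossedProduct σ)}
    (hN : ∀ r ∈ N, bar σ x * r * ((bar σ x)⁻¹ : (CrossedProduct σ)ˣ) ∈ N') :
    ExtTot k σ H N →ₗ[k] ExtTot k σ (conjSub x H) N' :=
  DirectSum.lmap (ExtD.conj x H hN)

/-- The corestriction map `cores^H_K`. -/
def ExtTot.cores {H K : Subgroup G} (hKH : K ≤ H) {N : Submodule k (CrossedProduct σ)}
    (hN : ∀ g ∈ H, ∀ r ∈ N, bar σ g * r * ((bar σ g)⁻¹ : (CrossedProduct σ)ˣ) ∈ N) :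
    ExtTot k σ K N →ₗ[k] ExtTot k σ H N :=
  DirectSum.lmap (ExtD.cores hKH hN)

/-- The map `θ_g^* : Ext^*_{Δ(H)}(S, S ḡ) → Ext^*_{Δ(H)}(S, R)` induced by the inclusion
`θ_g : S ḡ → R`. -/
def ExtTot.theta (g : G) (H : Subgroup G) :
    ExtTot k σ H (component σ k g) →ₗ[k] ExtTot k σ H ⊤ :=
  DirectSum.lmap (ExtD.incl le_top H)

/-- The map `π_g^* : Ext^*_{Δ(H)}(S, R) → Ext^*_{Δ(H)}(S, S ḡ)`, for `H ≤ C(g)`, induced by the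
projection `π_g : R → S ḡ`. -/
def ExtTot.pi (g : G) {H : Subgroup G} (hH : H ≤ Subgroup.centralizer {g}) :
    ExtTot k σ H ⊤ →ₗ[k] ExtTot k σ H (component σ k g) :=
  DirectSum.lmap (ExtD.proj hH)

theorem conj_mem_component_of_eq {x g g' : G} (e : g' = x * g * x⁻¹) (r : CrossedProduct σ)
    (hr : r ∈ component σ k g) :
    bar σ x * r * ((bar σ x)⁻¹ : (CrossedProduct σ)ˣ) ∈ component σ k g' :=
  e ▸ conj_mem_component x hr

theorem eq_conj_of_mem {g x : G} (hx : x ∈ Subgroup.centralizer {g}) : g = x * g * x⁻¹ := by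
  rw [← Subgroup.mem_centralizer_iff.1 hx g rfl, mul_inv_cancel_right]

theorem centralizer_le_conjSub {x g g' : G} (e : g' = x * g * x⁻¹) :
    Subgroup.centralizer {g'} ≤ conjSub x (Subgroup.centralizer {g}) := by
  intro z hz
  rw [mem_conjSub, Subgroup.mem_centralizer_iff]
  rintro _ rfl
  have := Subgroup.mem_centralizer_iff.1 hz g' rfl
  subst e
  have h2 := congrArg (fun t => x⁻¹ * t * x) this
  simpa [mul_assoc] using h2

theorem conjSub_centralizer_le {x g g' : G} (e : g' = x * g * x⁻¹) :
    conjSub x (Subgroup.centralizer {g}) ≤ Subgroup.centralizer {g'} := by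
  intro z hz
  rw [mem_conjSub, Subgroup.mem_centralizer_iff] at hz
  rw [Subgroup.mem_centralizer_iff]
  rintro _ rfl
  have := hz g rfl
  subst e
  have h2 := congrArg (fun t => x * t * x⁻¹) this
  simpa [mul_assoc] using h2

theorem centralizer_inf_le {g h l : G} (e : g * h = l) :
    Subgroup.centralizer {g} ⊓ Subgroup.centralizer {h} ≤ Subgroup.centralizer {l} := by
  rintro z ⟨h1, h2⟩
  have h1 := Subgroup.mem_centralizer_iff.1 h1 g rfl
  have h2 := Subgroup.mem_centralizer_iff.1 h2 h rfl
  rw [Subgroup.mem_centralizer_iff]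
  rintro _ rfl
  rw [← e, mul_assoc, h2, ← mul_assoc, h1, mul_assoc]

theorem conjSub_inf_le {x y g h l : G} (e : (x * g * x⁻¹) * (y * h * y⁻¹) = l) :
    conjSub x (Subgroup.centralizer {g}) ⊓ conjSub y (Subgroup.centralizer {h}) ≤
      Subgroup.centralizer {l} :=
  (inf_le_inf (conjSub_centralizer_le rfl) (conjSub_centralizer_le rfl)).trans
    (centralizer_inf_le e)

variable (k σ)

/-- `A(g) = Ext^*_{Δ(C(g))}(S, S ḡ)`. -/
abbrev A (g : G) : Type _ := ExtTot k σ (Subgroup.centralizer {g}) (component σ k g)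

variable {k σ}

/-- `γ_g = cores^G_{C(g)} ∘ θ_g^* : A(g) → Ext^*_Δ(S, R)`. -/
def gamma (g : G) : A k σ g →ₗ[k] ExtTot k σ (⊤ : Subgroup G) ⊤ :=
  (ExtTot.cores le_top fun _ _ _ _ => Submodule.mem_top).comp (ExtTot.theta g _)

/-- The map `π_g^* ∘ res^G_{C(g)} : Ext^*_Δ(S, R) → A(g)`. -/
def piRes (g : G) : ExtTot k σ (⊤ : Subgroup G) ⊤ →ₗ[k] A k σ g :=
  (ExtTot.pi g le_rfl).comp (ExtTot.res le_top ⊤)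

/-- The bilinear map
`(α, β) ↦ cores^{C(l)}_W (π_l^* (θ_g^* res^L_W α ⌣ θ_h^* res^M_W β))`, where `W = L ∩ M ≤ C(l)`,
from `Ext^*_{Δ(L)}(S, S ḡ) × Ext^*_{Δ(M)}(S, S h̄)` to `A(l)`. -/
def pairing {g h l : G} {L M : Subgroup G} (hW : L ⊓ M ≤ Subgroup.centralizer {l}) :
    ExtTot k σ L (component σ k g) →ₗ[k] ExtTot k σ M (component σ k h) →ₗ[k] A k σ l :=
  ((ExtTot.mul (L ⊓ M)).compl₁₂
      ((ExtTot.theta g (L ⊓ M)).comp (ExtTot.res inf_le_left (component σ k g)))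
      ((ExtTot.theta h (L ⊓ M)).comp (ExtTot.res inf_le_right (component σ k h)))).compr₂
    ((ExtTot.cores hW fun _ hz => conj_mem_component_of_eq (eq_conj_of_mem hz)).comp
      (ExtTot.pi l hW))

/-- The conjugation map `x^*` from `A(g)` to
`Ext^*_{Δ(x C(g) x⁻¹)}(S, S \overline{x g x⁻¹})`. -/
def conjTo (x g : G) : A k σ g →ₗ[k]
    ExtTot k σ (conjSub x (Subgroup.centralizer {g})) (component σ k (x * g * x⁻¹)) :=
  ExtTot.conj x _ (conj_mem_component_of_eq rfl)

/-! ### The structure maps `c` and `m`, and the product on the invariants -/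

/-- The map `c_x : A(g) → A(g')` for `g' = x g x⁻¹`, the conjugation map `x^*`. (The restriction
map is along the equality `C(g') = x C(g) x⁻¹`.) -/
def cMap (x : G) {g g' : G} (e : g' = x * g * x⁻¹) : A k σ g →ₗ[k] A k σ g' :=
  (ExtTot.res (centralizer_le_conjSub e) _).comp
    (ExtTot.conj x _ (conj_mem_component_of_eq e))

/-- The map `m_{g,h} : A(g) × A(h) → A(l)` for `l = g h`,
`m_{g,h}(α, β) =
  cores^{C(l)}_{C(g) ∩ C(h)} (π_l^* (θ_g^* res^{C(g)}_{C(g) ∩ C(h)} α ⌣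
    θ_h^* res^{C(h)}_{C(g) ∩ C(h)} β))`. -/
def mMap {g h l : G} (e : g * h = l) : A k σ g →ₗ[k] A k σ h →ₗ[k] A k σ l :=
  pairing (centralizer_inf_le e)

variable (k σ) in
/-- The `G`-invariants `A^G` of `A = ⨁ g, A(g)` (the group `G` is finite). -/
def invA : Submodule k (∀ g : G, A k σ g) where
  carrier := {α | ∀ (x g g' : G) (e : g' = x * g * x⁻¹), cMap x e (α g) = α g'}
  add_mem' ha hb := fun x g g' e => by
    rw [Pi.add_apply, map_add, ha x g g' e, hb x g g' e, Pi.add_apply]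
  zero_mem' := fun x g g' e => map_zero _
  smul_mem' c a ha := fun x g g' e => by
    rw [Pi.smul_apply, map_smul, ha x g g' e, Pi.smul_apply]

/-- The pairs `(h, l)` with `h l = g`. -/
abbrev PairsOf (g : G) : Type _ := {p : G × G // p.1 * p.2 = g}

/-- Two pairs with product `g` are equivalent if they lie in the same orbit of `C(g)`, acting by
simultaneous conjugation. -/
def pairSetoid (g : G) : Setoid (PairsOf g) where
  r p q := ∃ x ∈ Subgroup.centralizer {g},
    x * p.1.1 * x⁻¹ = q.1.1 ∧ x * p.1.2 * x⁻¹ = q.1.2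
  iseqv :=
    { refl := fun p => ⟨1, Subgroup.one_mem _, by simp, by simp⟩
      symm := by
        rintro p q ⟨x, hx, h1, h2⟩
        refine ⟨x⁻¹, Subgroup.inv_mem _ hx, ?_, ?_⟩
        · rw [← h1]; group
        · rw [← h2]; group
      trans := by
        rintro p q r ⟨x, hx, h1, h2⟩ ⟨y, hy, h3, h4⟩
        refine ⟨y * x, Subgroup.mul_mem _ hy hx, ?_, ?_⟩
        · rw [← h3, ← h1]; group
        · rw [← h4, ← h2]; group }

open Classical in
/-- The product `(α · β)_g = ∑ m_{h,l}(α_h, β_l)`, where the sum runs over a set of representatives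
of the `C(g)`-orbits of pairs `(h, l)` with `h l = g`. -/
def mulA (α β : ∀ g : G, A k σ g) (g : G) : A k σ g :=
  letI := Fintype.ofFinite (Quotient (pairSetoid g))
  ∑ q : Quotient (pairSetoid g), mMap q.out.2 (α q.out.1.1) (β q.out.1.2)

open Classical in
/-- The element of `⨁ g, A(g)` with component `u` at `1` and all other components zero. -/
def unitA (u : A k σ 1) : ∀ g : G, A k σ g := Pi.single 1 u

end Total

end CrossedHH

end

open CrossedHH

/-! Everything is controlled by the grading by `G`. The tensor power R^{⊗(n+2)} splits according to
the product g_0⋯g_{n+1}, and Δ_n is the part of degree 1. The bar complex is contracted by inserting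
a 1 in front, and over a field its terms are retracts of the modules R^e ⊗ R^{⊗n}. The projection
onto Δ_n is a Δ-linear chain map (`deltaRetr_barD`, `deltaRetr_smul`), so exactness passes to the
summand Δ_•; projectivity passes too, because R^e is projective over Δ(H) (`env_projective`). A
homogeneous tensor of degree p is an element of Δ_n times p̄, so an R^e-linear map is determined by
its restriction to Δ_n, and every Δ-linear map extends. Thus HH^*(R) ≅ Ext^*_Δ(S,R) already as
complexes (`restrictCochain_bijective`), and the two cup products agree because h̄⁻¹ and h̄ cancel
(`restrictCochain_hochCup`).

The remaining identities hold strictly for maps Δ_n → R, with no homotopies. A Δ-linear map f is the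
sum of its components π_g f, which conjugation by G permutes. Conjugation is multiplicative in the
group element and for cup products (`conjMap_conjMap`, `conjMap_rawCup`), and corestriction is a sum
over any transversal (`coresMap_eq_sum`). One orbit-stabilizer principle, `sum_eq_sum_coresMap`,
does the counting: the sum of an equivariant family over a finite set is the sum, over orbit
representatives, of corestrictions from their stabilizers. It is applied to three sets. For `G`
under conjugation it gives the decomposition of Ext^*_Δ(S,R) into the A(g_i). For G/C(g_i) ×
G/C(g_j), whose orbits are the double cosets, it gives the product formula. For the pairs (h,l) with
hl = g under C(g), it gives the product on A^G.

The relation `Rep` transfers identities of cochains to identities of classes. Finally ζ ↦ (π_g^* res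
ζ)_g is a bijection from Ext^*_Δ(S,R) onto A^G which carries the cup product to `mulA`
(`piRes_mul`). Associativity and unit laws of A^G are therefore transported from HH^*(R), where they
hold on cochains. The unit u is the class of the augmentation of Δ_•. -/

noncomputable section

namespace CrossedHH

/-! ## The Hochschild complex is a projective resolution -/

section BarResolution

variable {k : Type*} [CommRing k] {R : Type*} [Ring R] [Algebra k R]

/-- The contracting homotopy `r_0 ⊗ ⋯ ⊗ r_{n+1} ↦ 1 ⊗ r_0 ⊗ ⋯ ⊗ r_{n+1}`. -/
def barHomotopy (n : ℕ) : Bar k R n →ₗ[k] Bar k R (n + 1) :=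
  Bar.lift (mkMultilinear (fun r => Bar.tprod k (Fin.cons 1 r : Fin (n + 3) → R)) (fun r j =>
    ⟨(Bar.tprod k).toLinearMap (Fin.cons 1 r : Fin (n + 3) → R) j.succ, fun x => by
      rw [MultilinearMap.toLinearMap_apply, Fin.cons_update]⟩))

theorem barHomotopy_tprod {n : ℕ} (r : Fin (n + 2) → R) :
    barHomotopy n (Bar.tprod k r) = Bar.tprod k (Fin.cons 1 r : Fin (n + 3) → R) := by
  rw [barHomotopy, Bar.lift_tprod]
  rfl

theorem contract_zero_cons {A : Type*} [Monoid A] {n : ℕ} (r : Fin (n + 1) → A) :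
    contract 0 (Fin.cons 1 r : Fin (n + 2) → A) = r := by
  ext j
  refine Fin.cases ?_ (fun j => ?_) j <;> simp [contract]

theorem contract_succ_cons {A : Type*} [Mul A] {n : ℕ} (i : ℕ) (a : A) (r : Fin (n + 2) → A) :
    contract (i + 1) (Fin.cons a r : Fin (n + 3) → A) = (Fin.cons a (contract i r) :
      Fin (n + 2) → A) := by
  ext j
  refine Fin.cases ?_ (fun j => ?_) j <;> simp [contract]

/-- The face of index 0 absorbs the inserted 1 and returns the tensor. The other faces are the faces
of the tensor behind that 1, with index raised by one, hence with the opposite sign. -/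
theorem barD_barHomotopy {n : ℕ} (x : Bar k R (n + 1)) :
    barD k R (n + 1) (barHomotopy (n + 1) x) = x - barHomotopy n (barD k R n x) := by
  suffices h : (barD k R (n + 1)).comp (barHomotopy (n + 1)) =
      LinearMap.id - (barHomotopy n).comp (barD k R n) from LinearMap.congr_fun h x
  refine Bar.hom_ext fun r => ?_
  simp only [LinearMap.comp_apply, LinearMap.sub_apply, LinearMap.id_apply, barHomotopy_tprod,
    barD_tprod, map_sum, map_smul]
  rw [Finset.sum_range_succ', contract_zero_cons, pow_zero, one_smul, sub_eq_neg_add,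
    ← Finset.sum_neg_distrib]
  congr 1
  refine Finset.sum_congr rfl fun i _ => ?_
  rw [contract_succ_cons, pow_succ, mul_neg_one, neg_smul]

/-- In lowest degree the map r ↦ 1 ⊗ r from R plays the part of the homotopy, so the augmentation
takes the place of the missing differential. -/
theorem barD_barHomotopy_zero (x : Bar k R 0) :
    barD k R 0 (barHomotopy 0 x) = x - (Bar.tprod k).toLinearMap ![1, 1] 1 (barAug k R x) := by
  suffices h : (barD k R 0).comp (barHomotopy 0) =
      LinearMap.id - ((Bar.tprod k).toLinearMap ![1, 1] 1).comp (barAug k R) from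
    LinearMap.congr_fun h x
  refine Bar.hom_ext fun r => ?_
  have h1 : contract 1 (Fin.cons 1 r : Fin 3 → R) = Function.update ![1, 1] 1 (r 0 * r 1) := by
    ext j
    fin_cases j
    · simp [contract]
    · simp only [contract, Function.update]
      rfl
  simp only [LinearMap.comp_apply, LinearMap.sub_apply, LinearMap.id_apply, barHomotopy_tprod,
    barD_tprod, barAug_tprod, MultilinearMap.toLinearMap_apply, Finset.sum_range_succ,
    Finset.sum_range_zero]
  rw [contract_zero_cons, h1]
  simp [sub_eq_add_neg]

theorem barAug_tensor_one (r : R) :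
    barAug k R ((Bar.tprod k).toLinearMap ![1, 1] 1 r) = r := by
  rw [MultilinearMap.toLinearMap_apply, barAug_tprod]
  simp

/-- The image of the homotopy generates the target as an R^e-module: r_0 ⊗ r_1 ⊗ ⋯ is r_0 times 1 ⊗
r_1 ⊗ ⋯. -/
theorem Bar.ext_of_homotopy {n : ℕ} {M : Type*} [AddCommGroup M] [Module k M]
    [Module (Env k R) M] {f : Bar k R (n + 1) →ₗ[k] M}
    (hf : ∀ (a : Env k R) x, f (a • x) = a • f x) (h : ∀ x, f (barHomotopy n x) = 0) : f = 0 := by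
  refine Bar.hom_ext fun r => ?_
  have hr : r = sandwich (r 0) 1 (Fin.cons 1 (Fin.tail r) : Fin (n + 3) → R) := by
    ext j
    refine Fin.cases ?_ (fun j => ?_) j <;> simp [sandwich, Fin.tail]
  rw [hr, ← Bar.tmul_smul_tprod, hf, ← barHomotopy_tprod, h, smul_zero, LinearMap.zero_apply]

/-- No face identities are needed. With s the homotopy, dds = d(1 − sd) = d − (1 − sd)d = sdd, which
vanishes by induction, and R^e-linearity extends dd = 0 from the image of s. The induction starts
from the augmentation. -/
theorem barD_barD (n : ℕ) (x : Bar k R (n + 2)) : barD k R n (barD k R (n + 1) x) = 0 := by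
  suffices h : (barD k R n).comp (barD k R (n + 1)) = 0 from LinearMap.congr_fun h x
  refine Bar.ext_of_homotopy (fun a x => by simp only [LinearMap.comp_apply, barD_smul])
    fun x => ?_
  rw [LinearMap.comp_apply, barD_barHomotopy, map_sub]
  cases n with
  | zero => rw [barD_barHomotopy_zero, barAug_barD, map_zero, sub_zero, sub_self]
  | succ n => rw [barD_barHomotopy, barD_barD n x, map_zero, sub_zero, sub_self]

theorem bar_exact (n : ℕ) : Function.Exact (barD k R (n + 1)) (barD k R n) := fun x =>
  ⟨fun hx => ⟨barHomotopy (n + 1) x, by rw [barD_barHomotopy, hx, map_zero, sub_zero]⟩, by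
    rintro ⟨y, rfl⟩
    exact barD_barD n y⟩

theorem bar_exact_zero : Function.Exact (barD k R 0) (barAug k R) := fun x =>
  ⟨fun hx => ⟨barHomotopy 0 x, by rw [barD_barHomotopy_zero, hx, map_zero, sub_zero]⟩, by
    rintro ⟨y, rfl⟩
    exact barAug_barD y⟩

theorem barAug_surjective : Function.Surjective (barAug k R) := fun r => ⟨_, barAug_tensor_one r⟩

/-! ### Projectivity of the bar resolution. -/

instance (n : ℕ) : IsScalarTower k (Env k R) (Bar k R n) where
  smul_assoc c a x := by
    rw [Bar.smul_def, Bar.smul_def, map_smul, LinearMap.smul_apply]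

theorem Bar.map_smul_of_tprod {n : ℕ} {M : Type*} [AddCommGroup M] [Module k M]
    [Module (Env k R) M] [IsScalarTower k (Env k R) M] (f : Bar k R n →ₗ[k] M)
    (h : ∀ a b r, f (Bar.tprod k (sandwich a b r)) =
      (a ⊗ₜ[k] op b : Env k R) • f (Bar.tprod k r)) (a : Env k R) (x : Bar k R n) :
    f (a • x) = a • f x := by
  suffices hs : f.comp (Bar.act n a) = (Algebra.lsmul k k M a).comp f from LinearMap.congr_fun hs x
  induction a using TensorProduct.induction_on with
  | zero => simp
  | add a b ha hb => rw [map_add, map_add, LinearMap.comp_add, LinearMap.add_comp, ha, hb]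
  | tmul a b =>
    refine Bar.hom_ext fun r => ?_
    rw [LinearMap.comp_apply, LinearMap.comp_apply, Algebra.lsmul_coe, ← Bar.smul_def,
      ← op_unop b, Bar.tmul_smul_tprod, h]

/-- The tuple `(1, v_0, …, v_{n-1}, 1)`. -/
def padOne {n : ℕ} (v : Fin n → R) : Fin (n + 2) → R := Fin.cons 1 (Fin.snoc v 1 : Fin (n + 1) → R)

/-- The map `v_0 ⊗ ⋯ ⊗ v_{n-1} ↦ 1 ⊗ v_0 ⊗ ⋯ ⊗ v_{n-1} ⊗ 1`. -/
def padMap (n : ℕ) : PiTensorProduct k (fun _ : Fin n => R) →ₗ[k] Bar k R n :=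
  PiTensorProduct.lift (mkMultilinear (fun v => Bar.tprod k (padOne v)) (fun v j =>
    ⟨(Bar.tprod k).toLinearMap (padOne v) j.castSucc.succ, fun x => by
      rw [MultilinearMap.toLinearMap_apply, padOne, padOne, ← Fin.cons_update,
        ← Fin.snoc_update]⟩))

/-- The `R ⊗ Rᵒᵖ`-linear map `(R ⊗ Rᵒᵖ) ⊗ R^{⊗ n} → R^{⊗ (n + 2)}`. -/
def barOfFree (n : ℕ) :
    Env k R ⊗[k] PiTensorProduct k (fun _ : Fin n => R) →ₗ[Env k R] Bar k R n :=
  TensorProduct.AlgebraTensorModule.lift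
    { toFun := fun a => (Algebra.lsmul k k (Bar k R n) a).comp (padMap n)
      map_add' := fun a b => by rw [map_add, LinearMap.add_comp]
      map_smul' := fun a b => LinearMap.ext fun x => mul_smul a b (padMap n x) }

/-- The map `R^{⊗ (n + 2)} → (R ⊗ Rᵒᵖ) ⊗ R^{⊗ n}`,
`r_0 ⊗ ⋯ ⊗ r_{n+1} ↦ (r_0 ⊗ r_{n+1}) ⊗ (r_1 ⊗ ⋯ ⊗ r_n)`. -/
def freeOfBar (n : ℕ) :
    Bar k R n →ₗ[k] Env k R ⊗[k] PiTensorProduct k (fun _ : Fin n => R) :=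
  Bar.lift (mkMultilinear (R := R) (fun r => (r 0 ⊗ₜ[k] op (r (Fin.last _))) ⊗ₜ[k]
    PiTensorProduct.tprod k (fun i : Fin n => r i.castSucc.succ)) (fun r j => by
      have h0 : ∀ i : Fin (n + 1), i.succ ≠ 0 := fun i => Fin.succ_ne_zero i
      have h1 : ∀ i : Fin n, i.castSucc.succ ≠ Fin.last (n + 1) := fun i => by
        rw [← Fin.succ_last, Ne, Fin.succ_inj]
        exact i.castSucc_ne_last
      refine Fin.cases ?_ (fun j => Fin.lastCases ?_ (fun j => ?_) j) j
      · refine ⟨((TensorProduct.mk k _ _).flip (PiTensorProduct.tprod k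
          (fun i : Fin n => r i.castSucc.succ))).comp
          ((TensorProduct.mk k R Rᵐᵒᵖ).flip (op (r (Fin.last _)))), fun x => ?_⟩
        simp
      · refine ⟨((TensorProduct.mk k _ _).flip (PiTensorProduct.tprod k
          (fun i : Fin n => r i.castSucc.succ))).comp
          ((TensorProduct.mk k R Rᵐᵒᵖ (r 0)).comp (opLinearEquiv k).toLinearMap), fun x => ?_⟩
        rw [Fin.succ_last, Function.update_self]
        simp [h1]
      · refine ⟨(TensorProduct.mk k _ _ (r 0 ⊗ₜ[k] op (r (Fin.last _)))).comp
          ((PiTensorProduct.tprod k).toLinearMap (fun i : Fin n => r i.castSucc.succ) j),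
          fun x => ?_⟩
        have h2 : (fun i : Fin n => Function.update r j.castSucc.succ x i.castSucc.succ) =
            Function.update (fun i : Fin n => r i.castSucc.succ) j x := by
          ext i
          by_cases hi : i = j
          · subst hi
            simp
          · have hi' : i.castSucc.succ ≠ j.castSucc.succ := by simpa using hi
            rw [Function.update_of_ne hi, Function.update_of_ne hi']
        rw [h2, Function.update_of_ne (h0 _).symm, Function.update_of_ne (h1 _).symm]
        rfl))

theorem freeOfBar_tprod {n : ℕ} (r : Fin (n + 2) → R) :
    freeOfBar n (Bar.tprod k r) = (r 0 ⊗ₜ[k] op (r (Fin.last _))) ⊗ₜ[k]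
      PiTensorProduct.tprod k (fun i : Fin n => r i.castSucc.succ) := by
  rw [freeOfBar, Bar.lift_tprod]
  rfl

/-- The enveloping algebra acts only through the two outer factors, and these are the ones collected
into R ⊗ Rᵒᵖ. -/
theorem freeOfBar_smul {n : ℕ} (a : Env k R) (x : Bar k R n) :
    freeOfBar n (a • x) = a • freeOfBar n x := by
  refine Bar.map_smul_of_tprod (M := Env k R ⊗[k] PiTensorProduct k (fun _ : Fin n => R))
    (freeOfBar n) (fun a b r => ?_) a x
  have h1 : (fun i : Fin n => sandwich a b r i.castSucc.succ) =
      fun i : Fin n => r i.castSucc.succ := by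
    ext i
    have := i.2
    have h2 : (i : ℕ) ≠ n := by omega
    simp [sandwich, h2]
  rw [freeOfBar_tprod, freeOfBar_tprod, h1, TensorProduct.smul_tmul', smul_eq_mul,
    Algebra.TensorProduct.tmul_mul_tmul, ← op_mul]
  simp [sandwich]

theorem barOfFree_freeOfBar {n : ℕ} (x : Bar k R n) : barOfFree n (freeOfBar n x) = x := by
  suffices h : ((barOfFree n).restrictScalars k).comp (freeOfBar n) = LinearMap.id from
    LinearMap.congr_fun h x
  refine Bar.hom_ext fun r => ?_
  change barOfFree n (freeOfBar n (Bar.tprod k r)) = Bar.tprod k r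
  rw [freeOfBar_tprod]
  change (r 0 ⊗ₜ[k] op (r (Fin.last _)) : Env k R) • padMap n
    (PiTensorProduct.tprod k fun i : Fin n => r i.castSucc.succ) = _
  rw [padMap, PiTensorProduct.lift.tprod]
  change _ • Bar.tprod k (padOne _) = _
  rw [Bar.tmul_smul_tprod]
  congr 1
  ext j
  refine Fin.cases ?_ (fun j => Fin.lastCases ?_ (fun j => ?_) j) j
  · simp [sandwich, padOne]
  · simp [sandwich, padOne]
  · have := j.2
    have h2 : (j : ℕ) ≠ n := by omega
    simp [sandwich, padOne, h2]

/-- Here a field is needed: R^{⊗n} is then free over k, so its base change to R^e is projective.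
Only one composite, `barOfFree_freeOfBar`, is required for a retract. -/
theorem bar_projective {k : Type*} [Field k] {R : Type*} [Ring R] [Algebra k R] (n : ℕ) :
    Module.Projective (Env k R) (Bar k R n) :=
  Module.Projective.of_split
    ({ toFun := freeOfBar n
       map_add' := map_add _
       map_smul' := freeOfBar_smul } :
      Bar k R n →ₗ[Env k R] Env k R ⊗[k] PiTensorProduct k (fun _ : Fin n => R))
    (barOfFree n) (LinearMap.ext barOfFree_freeOfBar)

end BarResolution

/-! ## The complex `Δ_•` is a projective resolution -/

section DeltaResolution

set_option linter.unusedSectionVars false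

open CrossedProduct

variable {G S : Type*} [Group G] [Fintype G] [Ring S] [MulSemiringAction G S]
variable {k : Type*} [CommRing k] [Algebra k S] [SMulCommClass G k S]
variable {σ : TwoCocycle G S}

theorem deltaIncl_deltaRetr_of_mem {n : ℕ} (x : Bar k (CrossedProduct σ) n)
    (hx : x ∈ deltaSub k σ n) : deltaIncl k σ n (deltaRetr k σ n x) = x :=
  congrArg (deltaIncl k σ n) (deltaRetr_deltaIncl ⟨x, hx⟩)

theorem deltaD_deltaD (n : ℕ) (x : DeltaN k σ (n + 2)) :
    deltaD k σ n (deltaD k σ (n + 1) x) = 0 :=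
  deltaIncl_injective n (by rw [deltaIncl_deltaD, deltaIncl_deltaD, barD_barD, map_zero])

theorem deltaAug_deltaD (x : DeltaN k σ 1) : deltaAug k σ (deltaD k σ 0 x) = 0 := by
  rw [deltaAug, LinearMap.comp_apply, deltaIncl_deltaD, barAug_barD]

/-- A direct summand of an exact complex is exact: a preimage found in the bar complex is projected
back by the chain map `deltaRetr`. -/
theorem delta_exact (n : ℕ) : Function.Exact (deltaD k σ (n + 1)) (deltaD k σ n) := by
  refine fun x => ⟨fun hx => ?_, ?_⟩
  · obtain ⟨y, hy⟩ := (bar_exact n (deltaIncl k σ (n + 1) x)).1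
      (by rw [← deltaIncl_deltaD, hx, map_zero])
    exact ⟨deltaRetr k σ _ y, by rw [← deltaRetr_barD, hy, deltaRetr_deltaIncl]⟩
  · rintro ⟨y, rfl⟩
    exact deltaD_deltaD n y

theorem delta_exact_zero : Function.Exact (deltaD k σ 0) (deltaAug k σ) := by
  refine fun x => ⟨fun hx => ?_, ?_⟩
  · obtain ⟨y, hy⟩ := (bar_exact_zero (deltaIncl k σ 0 x)).1 hx
    exact ⟨deltaRetr k σ _ y, by rw [← deltaRetr_barD, hy, deltaRetr_deltaIncl]⟩
  · rintro ⟨y, rfl⟩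
    exact deltaAug_deltaD y

theorem deltaAug_mem (x : DeltaN k σ 0) : deltaAug k σ x ∈ component σ k 1 := by
  refine Submodule.span_induction (p := fun x _ => barAug k (CrossedProduct σ) x ∈ component σ k 1)
    ?_ ?_ ?_ ?_ x.2
  · rintro _ ⟨s, g, hg, rfl⟩
    have h : g 0 * g 1 = 1 := by simpa [List.ofFn_succ] using hg
    rw [barAug_tprod, ← h]
    exact mul_mem_component (mk_mem _ _) (mk_mem _ _)
  · rw [map_zero]; exact Submodule.zero_mem _
  · intro a b _ _ ha hb
    rw [map_add]
    exact Submodule.add_mem _ ha hb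
  · intro c a _ ha
    rw [map_smul]
    exact Submodule.smul_mem _ c ha

/-- The product of two entries of inverse degrees has degree 1, and an element r of degree 1 is the
image of 1 ⊗ r. -/
theorem range_deltaAug : LinearMap.range (deltaAug k σ) = component σ k 1 := by
  refine le_antisymm ?_ fun r hr => ?_
  · rintro _ ⟨x, rfl⟩
    exact deltaAug_mem x
  · have h : Bar.tprod k ![1, r] ∈ deltaSub k σ 0 := by
      refine tprod_mem_deltaSub (g := fun _ => 1) (fun i => ?_) (by simp)
      fin_cases i
      · exact one_mem_component
      · exact hr
    refine ⟨⟨_, h⟩, ?_⟩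
    change barAug k (CrossedProduct σ) (Bar.tprod k ![1, r]) = r
    rw [barAug_tprod]
    simp

/-! ### The enveloping algebra is projective over `Δ(H)` -/

/-- Since G is finite, each factor is the finite sum of its homogeneous components, so linear maps
may be compared on bihomogeneous tensors. -/
theorem Env.hom_ext {M : Type*} [AddCommGroup M] [Module k M]
    {f f' : Env k (CrossedProduct σ) →ₗ[k] M}
    (h : ∀ (g l : G), ∀ x ∈ component σ k g, ∀ y ∈ component σ k l,
      f (x ⊗ₜ op y) = f' (x ⊗ₜ op y)) : f = f' := by
  refine TensorProduct.ext' fun x y => ?_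
  rw [← op_unop y, ← sum_proj (k := k) x, ← sum_proj (k := k) y.unop, Finset.op_sum]
  simp only [TensorProduct.sum_tmul, TensorProduct.tmul_sum, map_sum]
  exact Finset.sum_congr rfl fun g _ => Finset.sum_congr rfl fun l _ =>
    h _ _ _ (proj_mem _ _) _ (proj_mem _ _)

theorem proj_of_mem {g l : G} [Decidable (g = l)] {x : CrossedProduct σ}
    (hx : x ∈ component σ k g) : proj σ k l x = if g = l then x else 0 := by
  obtain ⟨s, rfl⟩ := mem_component.1 hx
  exact proj_mk s g l

variable (k σ) in
open Classical in
/-- The projection of `R ⊗ Rᵒᵖ` onto its direct summand `Δ(H)`. -/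
def envProj (H : Subgroup G) : Env k (CrossedProduct σ) →ₗ[k] Env k (CrossedProduct σ) :=
  ∑ g : G, if g ∈ H then TensorProduct.map (proj σ k g)
    ((opLinearEquiv k).toLinearMap ∘ₗ proj σ k g⁻¹ ∘ₗ (opLinearEquiv k).symm.toLinearMap) else 0

open Classical in
theorem envProj_tmul (H : Subgroup G) {g l : G} {x y : CrossedProduct σ}
    (hx : x ∈ component σ k g) (hy : y ∈ component σ k l) :
    envProj k σ H (x ⊗ₜ op y) = if g ∈ H ∧ l = g⁻¹ then x ⊗ₜ op y else 0 := by
  rw [envProj, LinearMap.sum_apply, Finset.sum_eq_single g]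
  · by_cases hg : g ∈ H
    · rw [if_pos hg, TensorProduct.map_tmul, proj_of_mem hx, if_pos rfl]
      simp only [LinearMap.comp_apply, LinearEquiv.coe_coe, coe_opLinearEquiv_symm, unop_op,
        proj_of_mem hy, coe_opLinearEquiv, hg, true_and]
      split_ifs <;> simp
    · rw [if_neg hg, if_neg fun h => hg h.1, LinearMap.zero_apply]
  · intro g' _ hne
    split_ifs with h
    · rw [TensorProduct.map_tmul, proj_of_mem hx, if_neg hne.symm, TensorProduct.zero_tmul]
    · rfl
  · exact fun h => absurd (Finset.mem_univ _) h

theorem envProj_mem (H : Subgroup G) (z : Env k (CrossedProduct σ)) :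
    envProj k σ H z ∈ Delta k σ H := by
  classical
  suffices h : (Subalgebra.toSubmodule (Delta k σ H)).mkQ.comp (envProj k σ H) = 0 by
    exact (Submodule.Quotient.mk_eq_zero (Subalgebra.toSubmodule (Delta k σ H))).1
      (LinearMap.congr_fun h z)
  refine Env.hom_ext fun g l x hx y hy => ?_
  rw [LinearMap.comp_apply, envProj_tmul H hx hy, LinearMap.zero_apply, Submodule.mkQ_apply,
    Submodule.Quotient.mk_eq_zero]
  split_ifs with h
  · obtain ⟨hg, rfl⟩ := h
    exact tmul_mem_Delta hg hx hy
  · exact Submodule.zero_mem _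

/-- Left multiplication by a tensor of bidegree (h, h⁻¹) sends bidegree (g, l) to (hg, lh⁻¹), the
second factor being multiplied in the opposite ring. For h in H this neither creates nor destroys
membership of the bidegree in {(g, g⁻¹) : g ∈ H}. -/
theorem envProj_mul (H : Subgroup G) {a : Env k (CrossedProduct σ)} (ha : a ∈ Delta k σ H)
    (z : Env k (CrossedProduct σ)) : envProj k σ H (a * z) = a * envProj k σ H z := by
  classical
  refine Delta_induction (p := fun a => envProj k σ H (a * z) = a * envProj k σ H z) ?_ ?_ ?_ ha
  · rw [zero_mul, zero_mul, map_zero]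
  · intro a _ b _ h h'
    rw [add_mul, add_mul, map_add, h, h']
  · intro h hh x hx y hy
    suffices hs : (envProj k σ H).comp (LinearMap.mulLeft k (x ⊗ₜ[k] op y)) =
        (LinearMap.mulLeft k (x ⊗ₜ[k] op y)).comp (envProj k σ H) from LinearMap.congr_fun hs z
    refine Env.hom_ext fun g l u hu v hv => ?_
    rw [LinearMap.comp_apply, LinearMap.comp_apply, LinearMap.mulLeft_apply,
      LinearMap.mulLeft_apply, tmul_mul_tmul_op, envProj_tmul H hu hv,
      envProj_tmul H (mul_mem_component hx hu) (mul_mem_component hv hy)]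
    have h1 : h * g ∈ H ∧ l * h⁻¹ = (h * g)⁻¹ ↔ g ∈ H ∧ l = g⁻¹ := by
      rw [H.mul_mem_cancel_left hh, mul_inv_rev, mul_left_inj]
    simp only [h1]
    split_ifs
    · rw [tmul_mul_tmul_op]
    · rw [mul_zero]

variable (k σ) in
/-- The unit `x̄ ⊗ \overline{p x⁻¹}` of `R ⊗ Rᵒᵖ`, for `(x, p)`. -/
def envUnit (x p : G) : Env k (CrossedProduct σ) :=
  (bar σ x : CrossedProduct σ) ⊗ₜ op (bar σ (p * x⁻¹) : CrossedProduct σ)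

variable (k σ) in
/-- The inverse of `envUnit`. -/
def envUnitInv (x p : G) : Env k (CrossedProduct σ) :=
  (((bar σ x)⁻¹ : (CrossedProduct σ)ˣ) : CrossedProduct σ) ⊗ₜ
    op (((bar σ (p * x⁻¹))⁻¹ : (CrossedProduct σ)ˣ) : CrossedProduct σ)

/-- The elements `envUnit` generate R^e over Δ(H). The translate of Δ(H) by the unit for (x, p) has
the bidegrees (hx, px⁻¹h⁻¹) with h in H. These are the (g, l) with Hg = Hx and lg = p, so each
bidegree belongs to exactly one index. -/
theorem sum_envProj (H : Subgroup G) [Fintype (Quotient (QuotientGroup.rightRel H))]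
    (z : Env k (CrossedProduct σ)) :
    ∑ i : Quotient (QuotientGroup.rightRel H) × G,
      envProj k σ H (z * envUnitInv k σ i.1.out i.2) * envUnit k σ i.1.out i.2 = z := by
  classical
  suffices hs : ∑ i : Quotient (QuotientGroup.rightRel H) × G,
      (LinearMap.mulRight k (envUnit k σ i.1.out i.2)).comp ((envProj k σ H).comp
        (LinearMap.mulRight k (envUnitInv k σ i.1.out i.2))) = LinearMap.id by
    have := LinearMap.congr_fun hs z
    rwa [LinearMap.sum_apply] at this
  refine Env.hom_ext fun g l x hx y hy => ?_
  rw [LinearMap.sum_apply]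
  have key : ∀ i : Quotient (QuotientGroup.rightRel H) × G,
      ((LinearMap.mulRight k (envUnit k σ i.1.out i.2)).comp ((envProj k σ H).comp
        (LinearMap.mulRight k (envUnitInv k σ i.1.out i.2)))) (x ⊗ₜ op y) =
      if i = (Quotient.mk _ g, l * g) then x ⊗ₜ op y else 0 := by
    rintro ⟨q, p⟩
    rw [LinearMap.comp_apply, LinearMap.comp_apply, LinearMap.mulRight_apply,
      LinearMap.mulRight_apply, envUnitInv, tmul_mul_tmul_op,
      envProj_tmul H (mul_mem_component hx (bar_inv_mem _))
        (mul_mem_component (bar_inv_mem _) hy)]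
    -- The condition under which the summand survives the projection singles out the index formed by
    -- the right coset of g and the element lg.
    have h1 : g * q.out⁻¹ ∈ H ∧ (p * q.out⁻¹)⁻¹ * l = (g * q.out⁻¹)⁻¹ ↔
        (q, p) = (Quotient.mk _ g, l * g) := by
      rw [Prod.mk.injEq]
      refine and_congr ?_ ?_
      · conv_rhs => rw [← Quotient.out_eq q, Quotient.eq]
        exact QuotientGroup.rightRel_apply.symm
      · constructor
        · intro h
          have h2 : (p * q.out⁻¹)⁻¹ * l * (g * q.out⁻¹) = 1 := by rw [h, inv_mul_cancel]
          have h3 : q.out * (p⁻¹ * (l * g)) * q.out⁻¹ = 1 := by rw [← h2]; group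
          rw [mul_inv_eq_one, mul_eq_left, inv_mul_eq_one] at h3
          exact h3
        · rintro rfl
          group
    simp only [h1]
    split_ifs
    · rw [envUnit, tmul_mul_tmul_op, mul_assoc, Units.inv_mul, mul_one, ← mul_assoc,
        Units.mul_inv, one_mul]
    · rw [zero_mul]
  rw [Finset.sum_congr rfl fun i _ => key i, Finset.sum_ite_eq' _ _ _,
    if_pos (Finset.mem_univ _), LinearMap.id_apply]

/-- The coordinates z ↦ `envProj` (z · unit⁻¹) map R^e to a finite free Δ(H)-module, and linear
combination of the units is a left inverse. -/
theorem env_projective (H : Subgroup G) :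
    Module.Projective (Delta k σ H) (Env k (CrossedProduct σ)) := by
  classical
  let _ := Fintype.ofFinite (Quotient (QuotientGroup.rightRel H))
  let ι := Quotient (QuotientGroup.rightRel H) × G
  refine Module.Projective.of_split (M := ι → Delta k σ H)
    (LinearMap.pi fun i : ι =>
      { toFun := fun z => ⟨envProj k σ H (z * envUnitInv k σ i.1.out i.2), envProj_mem H _⟩
        map_add' := fun z w => Subtype.ext (by
          change envProj k σ H ((z + w) * _) = envProj k σ H _ + envProj k σ H _
          rw [add_mul, map_add])
        map_smul' := fun a z => Subtype.ext (by
          change envProj k σ H ((a : Env k (CrossedProduct σ)) * z * _) = a * _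
          rw [mul_assoc, envProj_mul H a.2]) })
    (Fintype.linearCombination (Delta k σ H) fun i : ι => envUnit k σ i.1.out i.2)
    (LinearMap.ext fun z => ?_)
  rw [LinearMap.comp_apply, Fintype.linearCombination_apply]
  exact sum_envProj H z

/-- A projective A-module is a summand of a direct sum of copies of A, and each copy is projective
over B. -/
theorem projective_restrict {A : Type*} [Ring A] [Algebra k A] (B : Subalgebra k A)
    [Module.Projective B A] (P : Type*) [AddCommGroup P] [Module A P] [Module.Projective A P] :
    Module.Projective B P := by
  classical
  obtain ⟨s, hs⟩ := Module.projective_def'.1 (‹Module.Projective A P›)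
  have : Module.Projective B (P →₀ A) :=
    Module.Projective.of_equiv (finsuppLequivDFinsupp (ι := P) (M := A) B).symm
  exact Module.Projective.of_split (M := P →₀ A) (s.restrictScalars B)
    ((Finsupp.linearCombination A (id : P → P)).restrictScalars B)
    (LinearMap.ext fun x => LinearMap.congr_fun hs x)

/-- The bar term is projective over R^e, hence over Δ(H), and Δ_n is a Δ(H)-summand of it. -/
theorem delta_projective {k : Type*} [Field k] [Algebra k S] [SMulCommClass G k S]
    (H : Subgroup G) (n : ℕ) : Module.Projective (Delta k σ H) (DeltaN k σ n) := by
  have := env_projective (k := k) (σ := σ) H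
  have := bar_projective (k := k) (R := CrossedProduct σ) n
  have := projective_restrict (Delta k σ H) (Bar k (CrossedProduct σ) n)
  exact Module.Projective.of_split (M := Bar k (CrossedProduct σ) n)
    { toFun := deltaIncl k σ n
      map_add' := map_add _
      map_smul' := fun _ _ => rfl }
    { toFun := deltaRetr k σ n
      map_add' := map_add _
      map_smul' := fun a x => deltaRetr_smul a x }
    (LinearMap.ext deltaRetr_deltaIncl)

end DeltaResolution

/-! ## Total cohomology of a cochain complex -/

section TotalCohomology

variable {k : Type*} [CommRing k]
variable {X : ℕ → Type*} [∀ n, AddCommGroup (X n)] [∀ n, Module k (X n)]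
variable {Y : ℕ → Type*} [∀ n, AddCommGroup (Y n)] [∀ n, Module k (Y n)]

/-- The class of a cocycle in the total cohomology. -/
def tot (d : ∀ n, X n →ₗ[k] X (n + 1)) {n : ℕ} (x : X n) (hx : d n x = 0) : ⨁ n, Coh d n :=
  DirectSum.lof k ℕ (fun n => Coh d n) n (Coh.mk d x hx)

theorem tot_congr {d : ∀ n, X n →ₗ[k] X (n + 1)} {n : ℕ} {x y : X n} (h : x = y)
    (hx : d n x = 0) (hy : d n y = 0) : tot d x hx = tot d y hy := by
  subst h
  rfl

theorem tot_add {d : ∀ n, X n →ₗ[k] X (n + 1)} {n : ℕ} (x y : X n)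
    (hx : d n x = 0) (hy : d n y = 0) :
    tot d (x + y) (by rw [map_add, hx, hy, add_zero]) = tot d x hx + tot d y hy := by
  exact map_add ((DirectSum.lof k ℕ (fun n => Coh d n) n).comp (Coh.proj d n)) ⟨x, hx⟩ ⟨y, hy⟩

theorem tot_zero {d : ∀ n, X n →ₗ[k] X (n + 1)} {n : ℕ} :
    tot d (0 : X n) (map_zero _) = 0 :=
  (congrArg _ (map_zero (Coh.proj d n))).trans (map_zero _)

theorem tot_map {dX : ∀ n, X n →ₗ[k] X (n + 1)} {dY : ∀ n, Y n →ₗ[k] Y (n + 1)}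
    (φ : ∀ n, X n →ₗ[k] Y n) (h : ∀ n x, φ (n + 1) (dX n x) = dY n (φ n x)) {n : ℕ}
    (x : X n) (hx : dX n x = 0) :
    DirectSum.lmap (Coh.map φ h) (tot dX x hx) =
      tot dY (φ n x) (by rw [← h, hx, map_zero]) := by
  rw [tot, DirectSum.lmap_lof, Coh.map_mk]
  rfl

theorem totalMul_lof {M : ℕ → Type*} [∀ n, AddCommGroup (M n)]
    [∀ n, Module k (M n)] (μ : ∀ m n, M m →ₗ[k] M n →ₗ[k] M (m + n)) {m n : ℕ} (x : M m)
    (y : M n) : totalMul μ (DirectSum.lof k ℕ M m x) (DirectSum.lof k ℕ M n y) =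
      DirectSum.lof k ℕ M (m + n) (μ m n x y) := by
  rw [totalMul, DirectSum.toModule_lof, LinearMap.flip_apply, DirectSum.toModule_lof,
    LinearMap.flip_apply, LinearMap.compr₂_apply]

theorem cup_cocycle {d : ∀ n, X n →ₗ[k] X (n + 1)}
    {μ : ∀ {m n N : ℕ}, m + n = N → (X m →ₗ[k] X n →ₗ[k] X N)}
    (hμ : ∀ {m n N : ℕ} (h : m + n = N) (h1 : (m + 1) + n = N + 1) (h2 : m + (n + 1) = N + 1)
      (x : X m) (y : X n),
      μ h1 (d m x) y + (-1 : k) ^ m • μ h2 x (d n y) = d N (μ h x y)) {m n N : ℕ}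
    (h : m + n = N) (x : X m) (y : X n) (hx : d m x = 0) (hy : d n y = 0) :
    d N (μ h x y) = 0 := by
  rw [← hμ h (by omega) (by omega), hx, hy]
  simp

/-- The target degree is a variable N with a proof of m + n = N. Thus two products bracketed
differently can be compared in one degree, without transport along an equality of degrees. -/
theorem tot_cup {d : ∀ n, X n →ₗ[k] X (n + 1)}
    (μ : ∀ {m n N : ℕ}, m + n = N → (X m →ₗ[k] X n →ₗ[k] X N))
    (hμ : ∀ {m n N : ℕ} (h : m + n = N) (h1 : (m + 1) + n = N + 1) (h2 : m + (n + 1) = N + 1)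
      (x : X m) (y : X n),
      μ h1 (d m x) y + (-1 : k) ^ m • μ h2 x (d n y) = d N (μ h x y)) {m n N : ℕ}
    (h : m + n = N) (x : X m) (y : X n) (hx : d m x = 0) (hy : d n y = 0) :
    totalMul (Coh.cup μ hμ) (tot d x hx) (tot d y hy) =
      tot d (μ h x y) (cup_cocycle hμ h x y hx hy) := by
  subst h
  rw [tot, tot, totalMul_lof]
  rfl

/-- Additive statements about total cohomology need only be checked on the class of one cocycle. -/
theorem tot_induction {d : ∀ n, X n →ₗ[k] X (n + 1)} {p : (⨁ n, Coh d n) → Prop} (h0 : p 0)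
    (hadd : ∀ a b, p a → p b → p (a + b)) (h : ∀ (n : ℕ) (x : X n) (hx : d n x = 0),
      p (tot d x hx)) (a : ⨁ n, Coh d n) : p a := by
  induction a using DirectSum.induction_on with
  | zero => exact h0
  | of n a =>
    obtain ⟨x, rfl⟩ := Coh.proj_surjective d n a
    exact h n x.1 x.2
  | add a b ha hb => exact hadd a b ha hb

theorem coh_map_bijective {dX : ∀ n, X n →ₗ[k] X (n + 1)} {dY : ∀ n, Y n →ₗ[k] Y (n + 1)}
    (φ : ∀ n, X n →ₗ[k] Y n) (h : ∀ n x, φ (n + 1) (dX n x) = dY n (φ n x))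
    (hφ : ∀ n, Function.Bijective (φ n)) (n : ℕ) : Function.Bijective (Coh.map φ h n) := by
  constructor
  · rw [injective_iff_map_eq_zero]
    intro a ha
    obtain ⟨x, rfl⟩ := Coh.proj_surjective dX n a
    have ha' : φ n x.1 ∈ coboundaries dY n := (Coh.proj_eq_zero dY _).1 ha
    rw [Coh.proj_eq_zero]
    cases n with
    -- In degree 0 the coboundaries are the zero submodule, so the image itself is zero.
    | zero => exact (hφ 0).1 (Eq.trans ha' (map_zero _).symm)
    | succ n =>
      obtain ⟨y, hy⟩ := ha'
      obtain ⟨z, rfl⟩ := (hφ n).2 y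
      exact ⟨z, (hφ _).1 ((h n z).trans hy)⟩
  · intro b
    obtain ⟨y, rfl⟩ := Coh.proj_surjective dY n b
    obtain ⟨x, hx⟩ := (hφ n).2 y.1
    refine ⟨Coh.mk dX x ((hφ _).1 ?_), ?_⟩
    · rw [h, hx, map_zero]
      exact y.2
    · rw [Coh.map_mk]
      exact congrArg (Coh.proj dY n) (Subtype.ext hx)

end TotalCohomology

/-! ## The algebra `HH^*(R)` -/

section HochschildAlgebra

variable {k : Type*} [CommRing k] {R : Type*} [Ring R] [Algebra k R]

theorem hochCup_tprod {m n N : ℕ} (h : m + n = N) (f : HochCochain k R m) (f' : HochCochain k R n)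
    (r : Fin (N + 2) → R) : (hochCup k R h f f').1 (Bar.tprod k r) =
      f.1 (Bar.tprod k (headTuple (by omega) r 1)) * f'.1 (Bar.tprod k (tailTuple h 1 r)) := by
  change barCup _ _ h f.1 f'.1 (Bar.tprod k r) = _
  rw [barCup_tprod, Finset.univ_unique, Finset.sum_singleton]

/-- Associativity is strict on cochains: both bracketings evaluate the three factors on the same
three tensors. -/
theorem hochCup_assoc {l m n p q N : ℕ} (h1 : l + m = p) (h2 : p + n = N) (h3 : m + n = q)
    (h4 : l + q = N) (f : HochCochain k R l) (f' : HochCochain k R m) (f'' : HochCochain k R n) :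
    hochCup k R h2 (hochCup k R h1 f f') f'' = hochCup k R h4 f (hochCup k R h3 f' f'') := by
  refine Subtype.ext (Bar.hom_ext fun r => ?_)
  simp only [hochCup_tprod, mul_assoc]
  congr 3
  · ext j
    simp only [headTuple]
    split_ifs <;> first | omega | rfl
  · congr 2
    ext j
    simp only [headTuple, tailTuple]
    split_ifs <;> first | omega | rfl
  · congr 1
    ext j
    simp only [tailTuple]
    split_ifs <;> first | omega | rfl | (congr 1; ext; simp; omega)

theorem tot_hochCup {m n N : ℕ} (h : m + n = N) (f : HochCochain k R m) (f' : HochCochain k R n)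
    (hf : hochD k R m f = 0) (hf' : hochD k R n f' = 0) :
    HHTot.mul k R (tot (hochD k R) f hf) (tot (hochD k R) f' hf') =
      tot (hochD k R) (hochCup k R h f f')
        (cup_cocycle (hochCup_leibniz k R) h f f' hf hf') :=
  tot_cup (d := hochD k R) (hochCup k R) (hochCup_leibniz k R) h f f' hf hf'

theorem HHTot.mul_assoc (a b c : HHTot k R) :
    HHTot.mul k R (HHTot.mul k R a b) c = HHTot.mul k R a (HHTot.mul k R b c) := by
  induction a using tot_induction with
  | h0 => simp only [map_zero, LinearMap.zero_apply]
  | hadd a a' h h' => simp only [map_add, LinearMap.add_apply, h, h']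
  | h l f hf =>
  induction b using tot_induction with
  | h0 => simp only [map_zero, LinearMap.zero_apply]
  | hadd a a' h h' => simp only [map_add, LinearMap.add_apply, h, h']
  | h m f' hf' =>
  induction c using tot_induction with
  | h0 => simp only [map_zero]
  | hadd a a' h h' => simp only [map_add, h, h']
  | h n f'' hf'' =>
  rw [tot_hochCup rfl, tot_hochCup rfl, tot_hochCup rfl, tot_hochCup (add_assoc l m n).symm]
  exact tot_congr (hochCup_assoc rfl rfl rfl _ f f' f'') _ _

variable (k R) in
/-- The multiplication map as a Hochschild cochain. -/
def hochUnit : HochCochain k R 0 := ⟨barAug k R, fun a x => barAug_smul a x⟩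

variable (k R) in
theorem hochD_hochUnit : hochD k R 0 (hochUnit k R) = 0 :=
  Subtype.ext (LinearMap.ext fun x => barAug_barD x)

theorem HHTot.one_eq : HHTot.one k R = tot (hochD k R) (hochUnit k R) (hochD_hochUnit k R) := rfl

/-- The multiplication map turns r_0 ⊗ 1 into the scalar r_0, which left linearity puts back in the
first slot of f. -/
theorem hochUnit_cup {n : ℕ} (f : HochCochain k R n) :
    hochCup k R (zero_add n) (hochUnit k R) f = f := by
  refine Subtype.ext (Bar.hom_ext fun r => ?_)
  rw [hochCup_tprod]
  change barAug k R _ * _ = _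
  have h : r = sandwich (r 0) 1 (tailTuple (zero_add n) 1 r) := by
    ext j
    refine Fin.cases ?_ (fun j => ?_) j
    · simp [sandwich, tailTuple]
    · simp [sandwich, tailTuple]
      rfl
  conv_rhs => rw [h, hochCochain_tmul f.2]
  rw [barAug_tprod]
  simp [headTuple]

/-- The mirror image: the last entry returns to f by right linearity. -/
theorem cup_hochUnit {n : ℕ} (f : HochCochain k R n) :
    hochCup k R (add_zero n) f (hochUnit k R) = f := by
  refine Subtype.ext (Bar.hom_ext fun r => ?_)
  rw [hochCup_tprod]
  change _ * barAug k R _ = _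
  have h : r = sandwich 1 (r (Fin.last _)) (headTuple le_rfl r 1) := by
    ext j
    refine Fin.lastCases ?_ (fun j => ?_) j
    · simp [sandwich, headTuple]
    · have h1 := j.2
      have h2 : (j : ℕ) ≠ n + 1 := by omega
      have h3 : (j : ℕ) ≤ n := by omega
      simp only [sandwich, headTuple, Fin.val_castSucc, h2, h3]
      simp
      rfl
  conv_rhs => rw [h, hochCochain_tmul f.2]
  rw [barAug_tprod]
  simp [tailTuple]
  rfl

theorem HHTot.one_mul (a : HHTot k R) : HHTot.mul k R (HHTot.one k R) a = a := by
  induction a using tot_induction with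
  | h0 => simp only [map_zero]
  | hadd a a' h h' => simp only [map_add, h, h']
  | h l f hf =>
    rw [HHTot.one_eq, tot_hochCup (zero_add l)]
    exact tot_congr (hochUnit_cup f) _ _

theorem HHTot.mul_one (a : HHTot k R) : HHTot.mul k R a (HHTot.one k R) = a := by
  induction a using tot_induction with
  | h0 => simp only [map_zero, LinearMap.zero_apply]
  | hadd a a' h h' => simp only [map_add, LinearMap.add_apply, h, h']
  | h l f hf =>
    rw [HHTot.one_eq, tot_hochCup (add_zero l)]
    exact tot_congr (cup_hochUnit f) _ _

end HochschildAlgebra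

/-! ## The isomorphism `HH^*(R) ≅ Ext^*_Δ(S, R)` -/

section Comparison

set_option linter.unusedSectionVars false

open CrossedProduct

variable {G S : Type*} [Group G] [Fintype G] [Ring S] [MulSemiringAction G S]
variable {k : Type*} [CommRing k] [Algebra k S] [SMulCommClass G k S]
variable {σ : TwoCocycle G S}

variable (k σ) in
/-- The restriction of a Hochschild cochain to `Δ_n`. -/
def restrictCochain (n : ℕ) :
    HochCochain k (CrossedProduct σ) n →ₗ[k] DeltaCochain k σ (⊤ : Subgroup G) ⊤ n :=
  (LinearMap.lcomp k (CrossedProduct σ) (deltaIncl k σ n)).restrict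
    (p := hochCochain k (CrossedProduct σ) n) (q := deltaCochain k σ ⊤ ⊤ n)
    (fun _ hf => ⟨fun a x => hf a.1 (deltaIncl k σ n x), fun _ => Submodule.mem_top⟩)

theorem HHTot.toExt_tot {n : ℕ} (f : HochCochain k (CrossedProduct σ) n)
    (hf : hochD k (CrossedProduct σ) n f = 0) (hf' : cochainD k σ ⊤ ⊤ n
      (restrictCochain k σ n f) = 0) :
    HHTot.toExt k σ (tot (hochD k (CrossedProduct σ)) f hf) =
      tot (cochainD k σ ⊤ ⊤) (restrictCochain k σ n f) hf' :=
  tot_map (dX := hochD k (CrossedProduct σ)) (dY := cochainD k σ ⊤ ⊤) (restrictCochain k σ)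
    (fun _ _ => rfl) f hf

theorem sandwich_one_one {A : Type*} [Monoid A] {n : ℕ} (r : Fin (n + 2) → A) :
    sandwich 1 1 r = r := by
  ext j
  simp [sandwich]

/-- A homogeneous tensor of degree p becomes an element of Δ_n after right multiplication by p̄⁻¹,
and right R-linearity recovers the value on the original tensor. -/
theorem restrictCochain_injective (n : ℕ) : Function.Injective (restrictCochain k σ n) := by
  intro f f' h
  refine Subtype.ext (Bar.hom_ext_mk fun r g hr => ?_)
  set p := (List.ofFn g).prod with hp
  have hr' : r = sandwich 1 (bar σ p : CrossedProduct σ)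
      (sandwich 1 (((bar σ p)⁻¹ : (CrossedProduct σ)ˣ) : CrossedProduct σ) r) := by
    rw [sandwich_sandwich, Units.inv_mul, mul_one, sandwich_one_one]
  have hm : Bar.tprod k (sandwich 1 (((bar σ p)⁻¹ : (CrossedProduct σ)ˣ) : CrossedProduct σ) r) ∈
      deltaSub k σ n :=
    tprod_mem_deltaSub (sandwich_mem_component hr one_mem_component (bar_inv_mem p))
      (by rw [prod_sandwich, one_mul, mul_inv_cancel])
  rw [hr', hochCochain_tmul f.2, hochCochain_tmul f'.2]
  have := LinearMap.congr_fun (congrArg Subtype.val h) ⟨_, hm⟩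
  exact congrArg (fun z => 1 * z * (bar σ p : CrossedProduct σ)) this

/-- The extension of a `Δ(G)`-linear map `F : Δ_n → R` to the map
`r ↦ ∑ e, F (r ē⁻¹) ē` on `R^{⊗ (n + 2)}`. -/
def extendCochain {n : ℕ} (F : DeltaN k σ n →ₗ[k] CrossedProduct σ) :
    Bar k (CrossedProduct σ) n →ₗ[k] CrossedProduct σ :=
  ∑ e : G, (LinearMap.mulRight k (bar σ e : CrossedProduct σ)).comp
    ((F.comp (deltaRetr k σ n)).comp
      (Bar.act n (1 ⊗ₜ op (((bar σ e)⁻¹ : (CrossedProduct σ)ˣ) : CrossedProduct σ))))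

theorem extendCochain_tprod {n : ℕ} (F : DeltaN k σ n →ₗ[k] CrossedProduct σ)
    (r : Fin (n + 2) → CrossedProduct σ) : extendCochain F (Bar.tprod k r) =
      ∑ e : G, F.comp (deltaRetr k σ n) (Bar.tprod k (sandwich 1
        (((bar σ e)⁻¹ : (CrossedProduct σ)ˣ) : CrossedProduct σ) r)) * bar σ e := by
  rw [extendCochain, LinearMap.sum_apply]
  refine Finset.sum_congr rfl fun e _ => ?_
  rw [LinearMap.comp_apply, LinearMap.comp_apply, ← Bar.smul_def, Bar.tmul_smul_tprod,
    LinearMap.mulRight_apply]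

/-- On homogeneous a and b, the action of a ⊗ b factors as an element of bidegree (g, g⁻¹), which
lies in Δ and passes through F, and a correction on the right, which the factors c̄ absorb. -/
theorem extendCochain_mem {n : ℕ} (F : DeltaCochain k σ (⊤ : Subgroup G) ⊤ n) :
    extendCochain F.1 ∈ hochCochain k (CrossedProduct σ) n := by
  intro z x
  suffices hs : (extendCochain F.1).comp ((LinearMap.applyₗ x).comp (Bar.act n).toLinearMap) =
      (LinearMap.applyₗ (extendCochain F.1 x)).comp
        (AlgHom.mulLeftRight k (CrossedProduct σ)).toLinearMap from LinearMap.congr_fun hs z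
  refine Env.hom_ext fun g l a ha b hb => ?_
  change extendCochain F.1 (Bar.act n (a ⊗ₜ op b) x) =
    AlgHom.mulLeftRight k (CrossedProduct σ) (a ⊗ₜ op b) (extendCochain F.1 x)
  suffices hs : (extendCochain F.1).comp (Bar.act n (a ⊗ₜ op b)) =
      (AlgHom.mulLeftRight k (CrossedProduct σ) (a ⊗ₜ op b)).comp (extendCochain F.1) from
    LinearMap.congr_fun hs x
  refine Bar.hom_ext fun r => ?_
  rw [LinearMap.comp_apply, LinearMap.comp_apply, ← Bar.smul_def, Bar.tmul_smul_tprod,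
    AlgHom.mulLeftRight_apply, unop_op, extendCochain_tprod, extendCochain_tprod, Finset.mul_sum,
    Finset.sum_mul]
  symm
  -- Sandwiching by degrees g and l changes total degree c into gcl, so this is how the summands
  -- correspond.
  refine Fintype.sum_equiv ((Equiv.mulLeft g).trans (Equiv.mulRight l)) _ _ fun c => ?_
  simp only [Equiv.trans_apply, Equiv.coe_mulLeft, Equiv.coe_mulRight]
  have hw : (bar σ c : CrossedProduct σ) * b *
      (((bar σ (g * c * l))⁻¹ : (CrossedProduct σ)ˣ) : CrossedProduct σ) ∈ component σ k g⁻¹ := by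
    have := mul_mem_component (mul_mem_component (bar_mem (k := k) (σ := σ) c) hb)
      (bar_inv_mem (g * c * l))
    rwa [show c * l * (g * c * l)⁻¹ = g⁻¹ by group] at this
  have h1 : sandwich 1 (((bar σ (g * c * l))⁻¹ : (CrossedProduct σ)ˣ) : CrossedProduct σ)
      (sandwich a b r) = sandwich a ((bar σ c : CrossedProduct σ) * b *
      (((bar σ (g * c * l))⁻¹ : (CrossedProduct σ)ˣ) : CrossedProduct σ))
      (sandwich 1 (((bar σ c)⁻¹ : (CrossedProduct σ)ˣ) : CrossedProduct σ) r) := by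
    rw [sandwich_sandwich, sandwich_sandwich, one_mul, mul_one, mul_assoc (bar σ c : CrossedProduct σ),
      Units.inv_mul_cancel_left]
  rw [h1, retr_sandwich F (Subgroup.mem_top g) ha hw]
  simp only [mul_assoc, Units.inv_mul, mul_one]

/-- On a tensor of total degree 1 the twisted tensor has degree e⁻¹, so only the summand e = 1
survives the projection. -/
theorem extendCochain_deltaIncl {n : ℕ} (F : DeltaN k σ n →ₗ[k] CrossedProduct σ)
    (x : DeltaN k σ n) : extendCochain F (deltaIncl k σ n x) = F x := by
  classical
  -- Inserting the projection gives an identity of linear maps on all of R^{⊗(n+2)}, which can be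
  -- checked on homogeneous tensors.
  suffices h : extendCochain F (deltaProj k σ n (deltaIncl k σ n x)) =
      F (deltaRetr k σ n (deltaIncl k σ n x)) by
    rwa [← deltaIncl_deltaRetr, deltaRetr_deltaIncl] at h
  generalize deltaIncl k σ n x = y
  suffices hs : (extendCochain F).comp (deltaProj k σ n) = F.comp (deltaRetr k σ n) from
    LinearMap.congr_fun hs y
  refine Bar.hom_ext_mk fun r g hr => ?_
  rw [LinearMap.comp_apply, LinearMap.comp_apply]
  by_cases hg : (List.ofFn g).prod = 1
  · rw [deltaProj_tprod hr, if_pos hg, extendCochain_tprod, Finset.sum_eq_single 1]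
    · have h1 : bar σ 1 = 1 := Units.ext rfl
      rw [h1, inv_one, Units.val_one, sandwich_one_one, mul_one, LinearMap.comp_apply]
    · intro e _ he
      have h0 : deltaRetr k σ n (Bar.tprod k (sandwich 1
          (((bar σ e)⁻¹ : (CrossedProduct σ)ˣ) : CrossedProduct σ) r)) = 0 := by
        refine deltaIncl_injective n ?_
        rw [deltaIncl_deltaRetr, deltaProj_tprod (sandwich_mem_component hr one_mem_component
          (bar_inv_mem e)), prod_sandwich, hg, one_mul, one_mul, if_neg (inv_ne_one.2 he), map_zero]
      rw [LinearMap.comp_apply, h0, map_zero, zero_mul]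
    · exact fun h => absurd (Finset.mem_univ _) h
  · have h0 : deltaRetr k σ n (Bar.tprod k r) = 0 := by
      refine deltaIncl_injective n ?_
      rw [deltaIncl_deltaRetr, deltaProj_tprod hr, if_neg hg, map_zero]
    rw [deltaProj_tprod hr, if_neg hg, h0, map_zero, map_zero]

/-- The two cochain complexes are isomorphic, so no comparison of resolutions enters. In effect
R^{⊗(n+2)} is induced from the Δ-module Δ_n. -/
theorem restrictCochain_bijective (n : ℕ) : Function.Bijective (restrictCochain k σ n) :=
  ⟨restrictCochain_injective n, fun F => ⟨⟨_, extendCochain_mem F⟩,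
    Subtype.ext (LinearMap.ext fun x => extendCochain_deltaIncl F.1 x)⟩⟩

theorem HHTot.toExt_bijective : Function.Bijective (HHTot.toExt k σ) := by
  have h := coh_map_bijective (dX := hochD k (CrossedProduct σ)) (dY := cochainD k σ ⊤ ⊤)
    (restrictCochain k σ) (fun _ _ => rfl) restrictCochain_bijective
  exact ⟨(DirectSum.lmap_injective _).2 fun n => (h n).1,
    (DirectSum.lmap_surjective _).2 fun n => (h n).2⟩

/-! ### Head and tail tuples, and the comparison of the two cup products. -/

theorem prod_headTuple_mul_prod_tailTuple {m n N : ℕ} (hm : m ≤ N) (h : m + n = N)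
    (g : Fin (N + 2) → G) : (List.ofFn (headTuple hm g 1)).prod *
      (List.ofFn (tailTuple h 1 g)).prod = (List.ofFn g).prod := by
  have h1 : List.ofFn (headTuple hm g 1) = (List.ofFn g).take (m + 1) ++ [1] := by
    refine List.ext_getElem (by simp; omega) fun i hi hi' => ?_
    rw [List.length_ofFn] at hi
    simp only [headTuple, List.getElem_ofFn, List.getElem_append, List.length_take,
      List.length_ofFn, List.getElem_take, List.getElem_singleton]
    split_ifs <;> first | rfl | omega
  have h2 : List.ofFn (tailTuple h 1 g) = 1 :: (List.ofFn g).drop (m + 1) := by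
    refine List.ext_getElem (by simp; omega) fun i hi hi' => ?_
    cases i with
    | zero => simp [tailTuple]
    | succ i =>
      simp only [tailTuple, List.getElem_ofFn, List.getElem_cons_succ, List.getElem_drop,
        Nat.add_eq_zero_iff, one_ne_zero, and_false, if_false]
      congr 1
      ext
      simp only
      omega
  rw [h1, h2, List.prod_append, List.prod_cons, List.prod_cons, List.prod_nil, mul_one, mul_one,
    one_mul, List.prod_take_mul_prod_drop]

theorem headTuple_eq_sandwich {A : Type*} [Monoid A] {m N : ℕ} (h : m ≤ N) (r : Fin (N + 2) → A)
    (a : A) : headTuple h r a = sandwich 1 a (headTuple h r 1) := by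
  ext j
  by_cases hj : (j : ℕ) ≤ m
  · have h1 : (j : ℕ) ≠ m + 1 := by omega
    simp [headTuple, sandwich, hj, h1]
  · have h1 : (j : ℕ) = m + 1 := by omega
    simp [headTuple, sandwich, h1]

theorem tailTuple_eq_sandwich {A : Type*} [Monoid A] {m n N : ℕ} (h : m + n = N)
    (r : Fin (N + 2) → A) (a : A) : tailTuple h a r = sandwich a 1 (tailTuple h 1 r) := by
  ext j
  by_cases hj : (j : ℕ) = 0
  · simp [tailTuple, sandwich, hj]
  · simp [tailTuple, sandwich, hj]

theorem headTuple_mem_component {m N : ℕ} (hm : m ≤ N) {r : Fin (N + 2) → CrossedProduct σ}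
    {g : Fin (N + 2) → G} (hr : ∀ i, r i ∈ component σ k (g i)) {a : CrossedProduct σ} {e : G}
    (ha : a ∈ component σ k e) (i : Fin (m + 2)) :
    headTuple hm r a i ∈ component σ k (headTuple hm g e i) := by
  unfold headTuple
  split_ifs
  · exact hr _
  · exact ha

theorem tailTuple_mem_component {m n N : ℕ} (h : m + n = N) {r : Fin (N + 2) → CrossedProduct σ}
    {g : Fin (N + 2) → G} (hr : ∀ i, r i ∈ component σ k (g i)) {a : CrossedProduct σ} {e : G}
    (ha : a ∈ component σ k e) (i : Fin (n + 2)) :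
    tailTuple h a r i ∈ component σ k (tailTuple h e g i) := by
  unfold tailTuple
  split_ifs
  · exact ha
  · exact hr _

/-- Composition with the retraction reduces this to homogeneous tensors in R^{⊗(n+2)}, where those
of degree other than 1 are sent to zero. -/
theorem DeltaN.hom_ext {n : ℕ} {M : Type*} [AddCommGroup M] [Module k M]
    {f f' : DeltaN k σ n →ₗ[k] M}
    (h : ∀ (r : Fin (n + 2) → CrossedProduct σ) (g : Fin (n + 2) → G)
      (hr : ∀ i, r i ∈ component σ k (g i)) (hg : (List.ofFn g).prod = 1),
      f ⟨Bar.tprod k r, tprod_mem_deltaSub hr hg⟩ =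
        f' ⟨Bar.tprod k r, tprod_mem_deltaSub hr hg⟩) : f = f' := by
  classical
  suffices hs : f.comp (deltaRetr k σ n) = f'.comp (deltaRetr k σ n) by
    refine LinearMap.ext fun x => ?_
    have := LinearMap.congr_fun hs (deltaIncl k σ n x)
    rwa [LinearMap.comp_apply, LinearMap.comp_apply, deltaRetr_deltaIncl] at this
  refine Bar.hom_ext_mk fun r g hr => ?_
  rw [LinearMap.comp_apply, LinearMap.comp_apply]
  by_cases hg : (List.ofFn g).prod = 1
  · have h1 : deltaRetr k σ n (Bar.tprod k r) = ⟨Bar.tprod k r, tprod_mem_deltaSub hr hg⟩ :=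
      deltaRetr_deltaIncl ⟨Bar.tprod k r, tprod_mem_deltaSub hr hg⟩
    rw [h1]
    exact h r g hr hg
  · have h0 : deltaRetr k σ n (Bar.tprod k r) = 0 := by
      refine deltaIncl_injective n ?_
      rw [deltaIncl_deltaRetr, deltaProj_tprod hr, if_neg hg, map_zero]
    rw [h0, map_zero, map_zero]

/-- The entry h̄⁻¹ leaves f by right linearity, the entry h̄ leaves f' by left linearity, and the
two cancel. -/
theorem restrictCochain_hochCup {m n N : ℕ} (h : m + n = N)
    (f : HochCochain k (CrossedProduct σ) m) (f' : HochCochain k (CrossedProduct σ) n) :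
    restrictCochain k σ N (hochCup k (CrossedProduct σ) h f f') =
      deltaCup k σ ⊤ h (restrictCochain k σ m f) (restrictCochain k σ n f') := by
  refine Subtype.ext (DeltaN.hom_ext fun r g hr hg => ?_)
  have hm : m ≤ N := by omega
  -- A 1 in the last slot makes this the product g_0⋯g_m, the degree of the head.
  set e := (List.ofFn (headTuple hm g 1)).prod with he
  have h1 : (List.ofFn (headTuple hm g e⁻¹)).prod = 1 := by
    rw [headTuple_eq_sandwich, prod_sandwich, one_mul, ← he, mul_inv_cancel]
  have h2 : (List.ofFn (tailTuple h e g)).prod = 1 := by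
    rw [tailTuple_eq_sandwich, prod_sandwich, mul_one, he,
      prod_headTuple_mul_prod_tailTuple hm h g, hg]
  have key := deltaCup_tprod h hm (restrictCochain k σ m f) (restrictCochain k σ n f') r g hr e h1
    ⟨_, tprod_mem_deltaSub hr hg⟩ rfl
    ⟨_, tprod_mem_deltaSub (headTuple_mem_component hm hr (bar_inv_mem e)) h1⟩ rfl
    ⟨_, tprod_mem_deltaSub (tailTuple_mem_component h hr (bar_mem e)) h2⟩ rfl
  refine Eq.trans ?_ key.symm
  change (hochCup k (CrossedProduct σ) h f f').1 (Bar.tprod k r) =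
    f.1 (Bar.tprod k _) * f'.1 (Bar.tprod k _)
  rw [hochCup_tprod, headTuple_eq_sandwich _ r (((bar σ e)⁻¹ : (CrossedProduct σ)ˣ) :
      CrossedProduct σ), tailTuple_eq_sandwich _ r (bar σ e : CrossedProduct σ),
    hochCochain_tmul f.2, hochCochain_tmul f'.2]
  simp only [mul_assoc, Units.inv_mul_cancel_left, one_mul, mul_one]

theorem tot_deltaCup (H : Subgroup G) {m n N : ℕ} (h : m + n = N) (f : DeltaCochain k σ H ⊤ m)
    (f' : DeltaCochain k σ H ⊤ n) (hf : cochainD k σ H ⊤ m f = 0)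
    (hf' : cochainD k σ H ⊤ n f' = 0) :
    ExtTot.mul H (tot (cochainD k σ H ⊤) f hf) (tot (cochainD k σ H ⊤) f' hf') =
      tot (cochainD k σ H ⊤) (deltaCup k σ H h f f')
        (cup_cocycle (deltaCup_leibniz H) h f f' hf hf') :=
  tot_cup (d := cochainD k σ H ⊤) (deltaCup k σ H) (deltaCup_leibniz H) h f f' hf hf'

theorem restrictCochain_cocycle {n : ℕ} {f : HochCochain k (CrossedProduct σ) n}
    (hf : hochD k (CrossedProduct σ) n f = 0) :
    cochainD k σ ⊤ ⊤ n (restrictCochain k σ n f) = 0 :=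
  (congrArg (restrictCochain k σ (n + 1)) hf).trans (map_zero _)

theorem HHTot.toExt_mul (a b : HHTot k (CrossedProduct σ)) :
    HHTot.toExt k σ (HHTot.mul k (CrossedProduct σ) a b) =
      ExtTot.mul ⊤ (HHTot.toExt k σ a) (HHTot.toExt k σ b) := by
  induction a using tot_induction with
  | h0 => simp only [map_zero, LinearMap.zero_apply]
  | hadd a a' h h' => simp only [map_add, LinearMap.add_apply, h, h']
  | h m f hf =>
  induction b using tot_induction with
  | h0 => simp only [map_zero]
  | hadd a a' h h' => simp only [map_add, h, h']
  | h n f' hf' =>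
  have h1 := restrictCochain_cocycle hf
  have h2 := restrictCochain_cocycle hf'
  have h3 := cup_cocycle (hochCup_leibniz k (CrossedProduct σ)) rfl f f' hf hf'
  rw [tot_hochCup rfl, HHTot.toExt_tot f hf h1, HHTot.toExt_tot f' hf' h2,
    HHTot.toExt_tot _ h3 (restrictCochain_cocycle h3), tot_deltaCup ⊤ rfl]
  exact tot_congr (restrictCochain_hochCup rfl f f') _ _

end Comparison

/-! ## Operations on cochains -/

section Cochains

set_option linter.unusedSectionVars false

open CrossedProduct

variable {G S : Type*} [Group G] [Fintype G] [Ring S] [MulSemiringAction G S]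
variable {k : Type*} [CommRing k] [Algebra k S] [SMulCommClass G k S]
variable {σ : TwoCocycle G S}

/-- `Δ(H)`-linearity of a map `Δ_n → R`. -/
def IsLin (H : Subgroup G) {n : ℕ} (f : DeltaN k σ n →ₗ[k] CrossedProduct σ) : Prop :=
  ∀ (a : Delta k σ H) (x : DeltaN k σ n), f (a • x) = a • f x

/-! ### Conjugation of maps and projection to homogeneous components. -/

theorem IsLin.mono {H K : Subgroup G} (h : K ≤ H) {n : ℕ}
    {f : DeltaN k σ n →ₗ[k] CrossedProduct σ} (hf : IsLin H f) : IsLin K f :=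
  fun a x => linear_mono h hf a x

theorem IsLin.bot {H : Subgroup G} {n : ℕ}
    {f : DeltaN k σ n →ₗ[k] CrossedProduct σ} (hf : IsLin H f) : IsLin ⊥ f :=
  hf.mono bot_le

theorem IsLin.conjMap {H : Subgroup G} {n : ℕ} {f : DeltaN k σ n →ₗ[k] CrossedProduct σ}
    (hf : IsLin H f) (x : G) : IsLin (conjSub x H) (conjMap k σ x n f) :=
  linear_iff.2 fun _ hh _ _ hy hz p => conjMap_tmul hf (mem_conjSub.1 hh) hy hz p

theorem IsLin.conjMap_bot {n : ℕ} {f : DeltaN k σ n →ₗ[k] CrossedProduct σ}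
    (hf : IsLin ⊥ f) (x : G) : IsLin ⊥ (CrossedHH.conjMap k σ x n f) :=
  (hf.conjMap x).bot

/-- The product x̄ȳ differs from the basis element of xy by a unit of S, so conjugation is
multiplicative only on maps that are linear over Δ(1). This explains the linearity over `⊥` assumed
here and below. -/
theorem conjMap_conjMap {n : ℕ} {f : DeltaN k σ n →ₗ[k] CrossedProduct σ} (hf : IsLin ⊥ f)
    (x y : G) : conjMap k σ x n (conjMap k σ y n f) = conjMap k σ (x * y) n f := by
  refine LinearMap.ext fun p => ?_
  rw [conjMap_apply]
  have h := conjMap_tmul hf (g := y) (g' := x * y) (h := x⁻¹)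
    (by rw [Subgroup.mem_bot]; group) (bar_inv_mem x) (by rw [inv_inv]; exact bar_mem x) p
  refine (congrArg (fun z => (bar σ x : CrossedProduct σ) * z *
    (((bar σ x)⁻¹ : (CrossedProduct σ)ˣ) : CrossedProduct σ)) h).trans ?_
  simp only [mul_assoc, Units.mul_inv_cancel_left, Units.mul_inv, mul_one]

/-- For x in H the tensor x̄⁻¹ ⊗ x̄ belongs to Δ(H), so the inner conjugation comes out of f and
cancels the outer one. -/
theorem IsLin.conjMap_of_mem {H : Subgroup G} {n : ℕ} {f : DeltaN k σ n →ₗ[k] CrossedProduct σ}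
    (hf : IsLin H f) {x : G} (hx : x ∈ H) : CrossedHH.conjMap k σ x n f = f := by
  refine LinearMap.ext fun p => ?_
  rw [conjMap_apply]
  have h := linear_iff.1 hf x⁻¹ (H.inv_mem hx) _ _ (bar_inv_mem x)
    (by rw [inv_inv]; exact bar_mem x) p
  refine (congrArg (fun z => (bar σ x : CrossedProduct σ) * z *
    (((bar σ x)⁻¹ : (CrossedProduct σ)ˣ) : CrossedProduct σ)) h).trans ?_
  simp only [mul_assoc, Units.mul_inv_cancel_left, Units.mul_inv, mul_one]

/-- The conjugate depends only on the left coset xK, which makes corestriction independent of the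
transversal. -/
theorem IsLin.conjMap_congr {K : Subgroup G} {n : ℕ} {f : DeltaN k σ n →ₗ[k] CrossedProduct σ}
    (hf : IsLin K f) {x y : G} (h : x⁻¹ * y ∈ K) :
    CrossedHH.conjMap k σ x n f = CrossedHH.conjMap k σ y n f := by
  conv_lhs => rw [← hf.conjMap_of_mem h, conjMap_conjMap hf.bot, mul_inv_cancel_left]

theorem proj_conj (x g : G) (r : CrossedProduct σ) :
    CrossedProduct.proj σ k (x * g * x⁻¹)
        (bar σ x * r * ((bar σ x)⁻¹ : (CrossedProduct σ)ˣ)) =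
      bar σ x * CrossedProduct.proj σ k g r * ((bar σ x)⁻¹ : (CrossedProduct σ)ˣ) := by
  classical
  induction r using CrossedProduct.induction with
  | h0 => simp
  | hadd a b ha hb => simp only [mul_add, add_mul, map_add, ha, hb]
  | hmk s l =>
    rw [proj_of_mem (conj_mem_component x (mk_mem s l)), proj_mk]
    have : x * l * x⁻¹ = x * g * x⁻¹ ↔ l = g := by rw [mul_left_inj, mul_right_inj]
    simp only [this]
    split_ifs <;> simp

theorem proj_comp_conjMap (x : G) {g g' : G} (e : g' = x * g * x⁻¹) {n : ℕ}
    (f : DeltaN k σ n →ₗ[k] CrossedProduct σ) :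
    CrossedProduct.proj σ k g' ∘ₗ conjMap k σ x n f =
      conjMap k σ x n (CrossedProduct.proj σ k g ∘ₗ f) := by
  subst e
  exact LinearMap.ext fun p => proj_conj x g _

theorem conjMap_mem (x : G) {g : G} {n : ℕ} {f : DeltaN k σ n →ₗ[k] CrossedProduct σ}
    (hf : ∀ p, f p ∈ component σ k g) (p : DeltaN k σ n) :
    conjMap k σ x n f p ∈ component σ k (x * g * x⁻¹) :=
  conj_mem_component x (hf _)

theorem proj_comp_of_mem {g : G} {n : ℕ} {f : DeltaN k σ n →ₗ[k] CrossedProduct σ}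
    (hf : ∀ p, f p ∈ component σ k g) : CrossedProduct.proj σ k g ∘ₗ f = f := by
  classical
  refine LinearMap.ext fun p => ?_
  rw [LinearMap.comp_apply, proj_of_mem (hf p), if_pos rfl]

theorem proj_comp_of_mem_of_ne {g h : G} (hne : g ≠ h) {n : ℕ}
    {f : DeltaN k σ n →ₗ[k] CrossedProduct σ}
    (hf : ∀ p, f p ∈ component σ k g) : CrossedProduct.proj σ k h ∘ₗ f = 0 := by
  classical
  refine LinearMap.ext fun p => ?_
  rw [LinearMap.comp_apply, proj_of_mem (hf p), if_neg hne, LinearMap.zero_apply]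

theorem sum_proj_comp {n : ℕ} (f : DeltaN k σ n →ₗ[k] CrossedProduct σ) :
    ∑ g : G, CrossedProduct.proj σ k g ∘ₗ f = f := by
  refine LinearMap.ext fun p => ?_
  rw [LinearMap.sum_apply]
  exact sum_proj (f p)

theorem proj_comp_sum (g : G) {ι : Type*} (s : Finset ι) {n : ℕ}
    (f : ι → (DeltaN k σ n →ₗ[k] CrossedProduct σ)) :
    CrossedProduct.proj σ k g ∘ₗ ∑ i ∈ s, f i = ∑ i ∈ s, CrossedProduct.proj σ k g ∘ₗ f i := by
  refine LinearMap.ext fun p => ?_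
  simp only [LinearMap.comp_apply, LinearMap.sum_apply, map_sum]

/-! ### Corestriction as a sum over a transversal -/

theorem coresMap_apply (H K : Subgroup G) [Fintype (H ⧸ K.subgroupOf H)] {n : ℕ}
    (f : DeltaN k σ n →ₗ[k] CrossedProduct σ) :
    coresMap k σ H K n f = ∑ q : H ⧸ K.subgroupOf H, conjMap k σ ((q.out : H) : G) n f := by
  rw [coresMap, LinearMap.sum_apply]
  congr!

/-- Any transversal may replace the representatives fixed in the definition, since conjugates depend
only on cosets. Transitivity and conjugation of corestrictions are then choices of convenient
transversals. -/
theorem coresMap_eq_sum {H K : Subgroup G} {ι : Type*} [Fintype ι] (r : ι → G)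
    (hr : ∀ i, r i ∈ H) (h : ∀ g ∈ H, ∃! i, (r i)⁻¹ * g ∈ K) {n : ℕ}
    {f : DeltaN k σ n →ₗ[k] CrossedProduct σ} (hf : IsLin K f) :
    coresMap k σ H K n f = ∑ i, conjMap k σ (r i) n f := by
  classical
  let _ := Fintype.ofFinite (H ⧸ K.subgroupOf H)
  have hmk : ∀ (i : ι) (g : H), (QuotientGroup.mk ⟨r i, hr i⟩ : H ⧸ K.subgroupOf H) =
      QuotientGroup.mk g ↔ (r i)⁻¹ * g ∈ K := fun i g => by
    rw [QuotientGroup.eq, Subgroup.mem_subgroupOf]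
    rfl
  rw [coresMap_apply]
  symm
  refine Fintype.sum_bijective
    (fun i => (QuotientGroup.mk ⟨r i, hr i⟩ : H ⧸ K.subgroupOf H)) ⟨?_, ?_⟩ _ _ fun i => ?_
  · intro i j hij
    refine (h (r j) (hr j)).unique ((hmk i ⟨r j, hr j⟩).1 hij) ?_
    rw [inv_mul_cancel]
    exact K.one_mem
  · intro q
    obtain ⟨i, hi, -⟩ := h q.out q.out.2
    exact ⟨i, ((hmk i q.out).2 hi).trans (QuotientGroup.out_eq' q)⟩
  · exact hf.conjMap_congr ((hmk i _).1 (QuotientGroup.out_eq' _).symm)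

theorem existsUnique_out {H K : Subgroup G} {g : G} (hg : g ∈ H) :
    ∃! q : H ⧸ K.subgroupOf H, ((q.out : H) : G)⁻¹ * g ∈ K := by
  have hmk : ∀ q : H ⧸ K.subgroupOf H, ((q.out : H) : G)⁻¹ * g ∈ K ↔
      q = QuotientGroup.mk ⟨g, hg⟩ := fun q => by
    conv_rhs => rw [← QuotientGroup.out_eq' q, QuotientGroup.eq, Subgroup.mem_subgroupOf]
    rfl
  simp only [hmk]
  exact existsUnique_eq

/-- Products of a transversal of H/L and one of L/K form a transversal of H/K. -/
theorem coresMap_coresMap {H L K : Subgroup G} (hLH : L ≤ H) (hKL : K ≤ L) {n : ℕ}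
    {f : DeltaN k σ n →ₗ[k] CrossedProduct σ} (hf : IsLin K f) :
    coresMap k σ H L n (coresMap k σ L K n f) = coresMap k σ H K n f := by
  classical
  let _ := Fintype.ofFinite (H ⧸ L.subgroupOf H)
  let _ := Fintype.ofFinite (L ⧸ K.subgroupOf L)
  rw [coresMap_eq_sum (H := H) (K := K)
    (fun i : (H ⧸ L.subgroupOf H) × (L ⧸ K.subgroupOf L) => ((i.1.out : H) : G) * (i.2.out : L))
    (fun i => H.mul_mem i.1.out.2 (hLH i.2.out.2)) ?_ hf, coresMap_apply, coresMap_apply]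
  · simp only [map_sum, conjMap_conjMap hf.bot, Fintype.sum_prod_type]
  · intro g hg
    obtain ⟨q, hq, hq'⟩ := existsUnique_out (K := L) hg
    obtain ⟨p, hp, hp'⟩ := existsUnique_out (K := K) hq
    refine ⟨(q, p), by simpa only [mul_inv_rev, mul_assoc] using hp, ?_⟩
    rintro ⟨q₁, p₁⟩ h
    have h1 : q₁ = q := hq' q₁ (by
      have := L.mul_mem p₁.out.2 (hKL h)
      simpa only [mul_inv_rev, mul_assoc, mul_inv_cancel_left] using this)
    subst h1
    rw [hp' p₁ (by simpa only [mul_inv_rev, mul_assoc] using h)]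

/-- Conjugating a transversal of H/K by x gives one of H'/K'. The hypotheses only compare
membership, so centralizers and their intersections can be inserted directly. -/
theorem conjMap_coresMap {H K H' K' : Subgroup G} (x : G) (hH : ∀ z, z ∈ H' ↔ x⁻¹ * z * x ∈ H)
    (hK : ∀ z, z ∈ K' ↔ x⁻¹ * z * x ∈ K) {n : ℕ}
    {f : DeltaN k σ n →ₗ[k] CrossedProduct σ} (hf : IsLin K f) :
    conjMap k σ x n (coresMap k σ H K n f) = coresMap k σ H' K' n (conjMap k σ x n f) := by
  classical
  let _ := Fintype.ofFinite (H ⧸ K.subgroupOf H)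
  have hf' : IsLin K' (conjMap k σ x n f) :=
    (hf.conjMap x).mono fun z hz => mem_conjSub.2 ((hK z).1 hz)
  rw [coresMap_eq_sum (H := H') (K := K')
    (fun q : H ⧸ K.subgroupOf H => x * (q.out : H) * x⁻¹) ?_ ?_ hf', coresMap_apply, map_sum]
  · refine Finset.sum_congr rfl fun q _ => ?_
    rw [conjMap_conjMap hf.bot, conjMap_conjMap hf.bot, inv_mul_cancel_right]
  · intro q
    rw [hH]
    simp [mul_assoc]
  · intro g hg
    have := existsUnique_out (K := K) ((hH g).1 hg)
    simpa only [hK, mul_inv_rev, inv_inv, mul_assoc, inv_mul_cancel_left] using this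

theorem coresMap_self {H : Subgroup G} {n : ℕ}
    {f : DeltaN k σ n →ₗ[k] CrossedProduct σ} (hf : IsLin H f) : coresMap k σ H H n f = f := by
  rw [coresMap_eq_sum (H := H) (K := H) (fun _ : Unit => 1) (fun _ => H.one_mem)
    (fun g hg => ⟨(), by simpa using hg, fun _ _ => rfl⟩) hf, Finset.univ_unique,
    Finset.sum_singleton, hf.conjMap_of_mem H.one_mem]

/-! ### The cup product of maps `Δ_n → R` -/

variable (k σ) in
/-- The cup product of linear maps `Δ_m → R` and `Δ_n → R`. -/
def rawCup {m n N : ℕ} (h : m + n = N) : (DeltaN k σ m →ₗ[k] CrossedProduct σ) →ₗ[k]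
    (DeltaN k σ n →ₗ[k] CrossedProduct σ) →ₗ[k] (DeltaN k σ N →ₗ[k] CrossedProduct σ) :=
  ((barCup (k := k) (fun e : G => (((bar σ e)⁻¹ : (CrossedProduct σ)ˣ) : CrossedProduct σ))
      (fun e : G => (bar σ e : CrossedProduct σ)) h).compl₁₂
    (LinearMap.lcomp k (CrossedProduct σ) (deltaRetr k σ m))
    (LinearMap.lcomp k (CrossedProduct σ) (deltaRetr k σ n))).compr₂
    (LinearMap.lcomp k (CrossedProduct σ) (deltaIncl k σ N))

theorem rawCup_apply {m n N : ℕ} (h : m + n = N) (f : DeltaN k σ m →ₗ[k] CrossedProduct σ)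
    (f' : DeltaN k σ n →ₗ[k] CrossedProduct σ) (p : DeltaN k σ N) :
    rawCup k σ h f f' p =
      barCup (fun e : G => (((bar σ e)⁻¹ : (CrossedProduct σ)ˣ) : CrossedProduct σ))
        (fun e : G => (bar σ e : CrossedProduct σ)) h (f.comp (deltaRetr k σ m))
        (f'.comp (deltaRetr k σ n)) (deltaIncl k σ N p) :=
  rfl

theorem rawCup_mem {m n N : ℕ} (h : m + n = N) {f : DeltaN k σ m →ₗ[k] CrossedProduct σ}
    {f' : DeltaN k σ n →ₗ[k] CrossedProduct σ} {a b : G} (hf : ∀ p, f p ∈ component σ k a)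
    (hf' : ∀ p, f' p ∈ component σ k b) (p : DeltaN k σ N) :
    rawCup k σ h f f' p ∈ component σ k (a * b) := by
  rw [rawCup_apply]
  suffices hs : (component σ k (a * b)).mkQ.comp
      (barCup (fun e : G => (((bar σ e)⁻¹ : (CrossedProduct σ)ˣ) : CrossedProduct σ))
        (fun e : G => (bar σ e : CrossedProduct σ)) h (f.comp (deltaRetr k σ m))
        (f'.comp (deltaRetr k σ n))) = 0 by
    rw [← Submodule.Quotient.mk_eq_zero]
    exact LinearMap.congr_fun hs (deltaIncl k σ N p)
  refine Bar.hom_ext fun r => ?_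
  rw [LinearMap.comp_apply, LinearMap.zero_apply, Submodule.mkQ_apply,
    Submodule.Quotient.mk_eq_zero, barCup_tprod]
  exact Submodule.sum_mem _ fun e _ => mul_mem_component (hf _) (hf' _)

theorem conjMap_deltaRetr (x : G) {n : ℕ} (f : DeltaN k σ n →ₗ[k] CrossedProduct σ)
    (r : Fin (n + 2) → CrossedProduct σ) :
    (conjMap k σ x n f).comp (deltaRetr k σ n) (Bar.tprod k r) =
      bar σ x * f.comp (deltaRetr k σ n) (Bar.tprod k (sandwich
        (((bar σ x)⁻¹ : (CrossedProduct σ)ˣ) : CrossedProduct σ) (bar σ x) r)) *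
        ((bar σ x)⁻¹ : (CrossedProduct σ)ˣ) := by
  rw [LinearMap.comp_apply, conjMap_apply, ← deltaRetr_smul, LinearMap.comp_apply,
    ← Bar.tmul_smul_tprod]
  rfl

theorem IsLin.comp_deltaRetr_sandwich {n : ℕ} {f : DeltaN k σ n →ₗ[k] CrossedProduct σ}
    (hf : IsLin ⊥ f) {y z : CrossedProduct σ} (hy : y ∈ component σ k 1)
    (hz : z ∈ component σ k 1) (r : Fin (n + 2) → CrossedProduct σ) :
    f.comp (deltaRetr k σ n) (Bar.tprod k (sandwich y z r)) =
      y * f.comp (deltaRetr k σ n) (Bar.tprod k r) * z :=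
  retr_sandwich (H := ⊥) (N := ⊤) ⟨f, hf, fun _ => Submodule.mem_top⟩ (Subgroup.one_mem _) hy
    (by rwa [inv_one]) r

/-- Conjugation turns the inserted ē into x̄⁻¹ē, which differs from the basis element of x⁻¹e by a
unit of S. That unit leaves f on the right, its inverse leaves f' on the left, and they cancel. -/
theorem conjMap_rawCup {m n N : ℕ} (h : m + n = N) {f : DeltaN k σ m →ₗ[k] CrossedProduct σ}
    {f' : DeltaN k σ n →ₗ[k] CrossedProduct σ} (hf : IsLin ⊥ f) (hf' : IsLin ⊥ f') (x : G) :
    conjMap k σ x N (rawCup k σ h f f') =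
      rawCup k σ h (conjMap k σ x m f) (conjMap k σ x n f') := by
  refine LinearMap.ext fun p => ?_
  rw [conjMap_apply, rawCup_apply, rawCup_apply, deltaIncl_smul]
  generalize deltaIncl k σ N p = w
  suffices hs : (LinearMap.mulRight k (((bar σ x)⁻¹ : (CrossedProduct σ)ˣ) :
      CrossedProduct σ)).comp ((LinearMap.mulLeft k (bar σ x : CrossedProduct σ)).comp
      ((barCup (fun e : G => (((bar σ e)⁻¹ : (CrossedProduct σ)ˣ) : CrossedProduct σ))
        (fun e : G => (bar σ e : CrossedProduct σ)) h (f.comp (deltaRetr k σ m))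
        (f'.comp (deltaRetr k σ n))).comp (Bar.act N (conjEltInv k σ x).1))) =
      barCup (fun e : G => (((bar σ e)⁻¹ : (CrossedProduct σ)ˣ) : CrossedProduct σ))
        (fun e : G => (bar σ e : CrossedProduct σ)) h
        ((conjMap k σ x m f).comp (deltaRetr k σ m))
        ((conjMap k σ x n f').comp (deltaRetr k σ n)) from LinearMap.congr_fun hs w
  refine Bar.hom_ext fun r => ?_
  rw [LinearMap.comp_apply, LinearMap.comp_apply, LinearMap.comp_apply, ← Bar.smul_def, conjEltInv,
    Bar.tmul_smul_tprod, barCup_tprod, barCup_tprod, LinearMap.mulLeft_apply,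
    LinearMap.mulRight_apply, Finset.mul_sum, Finset.sum_mul]
  symm
  -- Multiplying the first entry by x̄⁻¹ changes the degree e of the head into x⁻¹e.
  refine Fintype.sum_equiv (Equiv.mulLeft x⁻¹) _ _ fun e => ?_
  rw [Equiv.coe_mulLeft, conjMap_deltaRetr, conjMap_deltaRetr]
  set X := bar σ x
  set E := bar σ e
  set C := bar σ (x⁻¹ * e)
  have hw : ((C * E⁻¹ * X : (CrossedProduct σ)ˣ) : CrossedProduct σ) ∈ component σ k 1 := by
    have := mul_mem_component (mul_mem_component (bar_mem (k := k) (σ := σ) (x⁻¹ * e))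
      (bar_inv_mem e)) (bar_mem x)
    rwa [mul_inv_cancel_right, inv_mul_cancel] at this
  have hw' : ((X⁻¹ * E * C⁻¹ : (CrossedProduct σ)ˣ) : CrossedProduct σ) ∈ component σ k 1 := by
    have := mul_mem_component (mul_mem_component (bar_inv_mem (k := k) (σ := σ) x)
      (bar_mem e)) (bar_inv_mem (x⁻¹ * e))
    rwa [mul_inv_cancel] at this
  have t1 : sandwich ((X⁻¹ : (CrossedProduct σ)ˣ) : CrossedProduct σ) X
      (headTuple (m := m) (by omega) r ((E⁻¹ : (CrossedProduct σ)ˣ) : CrossedProduct σ)) =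
      sandwich 1 ((C * E⁻¹ * X : (CrossedProduct σ)ˣ) : CrossedProduct σ)
        (headTuple (by omega) (sandwich ((X⁻¹ : (CrossedProduct σ)ˣ) : CrossedProduct σ) X r)
          ((C⁻¹ : (CrossedProduct σ)ˣ) : CrossedProduct σ)) := by
    rw [headTuple_sandwich, headTuple_eq_sandwich,
      headTuple_eq_sandwich _ r ((C⁻¹ : (CrossedProduct σ)ˣ) : CrossedProduct σ)]
    simp only [sandwich_sandwich, Units.val_mul, mul_assoc, mul_one, one_mul,
      Units.inv_mul_cancel_left]
  have t2 : sandwich ((X⁻¹ : (CrossedProduct σ)ˣ) : CrossedProduct σ) X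
      (tailTuple h (E : CrossedProduct σ) r) =
      sandwich ((X⁻¹ * E * C⁻¹ : (CrossedProduct σ)ˣ) : CrossedProduct σ) 1
        (tailTuple h (C : CrossedProduct σ)
          (sandwich ((X⁻¹ : (CrossedProduct σ)ˣ) : CrossedProduct σ) X r)) := by
    rw [tailTuple_sandwich, tailTuple_eq_sandwich,
      tailTuple_eq_sandwich _ r (C : CrossedProduct σ)]
    simp only [sandwich_sandwich, Units.val_mul, mul_assoc, mul_one, one_mul,
      Units.inv_mul]
  rw [t1, t2, hf.comp_deltaRetr_sandwich one_mem_component hw,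
    hf'.comp_deltaRetr_sandwich hw' one_mem_component]
  simp only [Units.val_mul, mul_assoc, one_mul, mul_one, Units.inv_mul_cancel_left,
    Units.mul_inv_cancel_left]

/-- The cup product is additive in the homogeneous components of both factors, and components with
values in degrees a and b have a product of degree ab. -/
theorem proj_rawCup {m n N : ℕ} (h : m + n = N) (f : DeltaN k σ m →ₗ[k] CrossedProduct σ)
    (f' : DeltaN k σ n →ₗ[k] CrossedProduct σ) (g : G) [Fintype (PairsOf g)] :
    CrossedProduct.proj σ k g ∘ₗ rawCup k σ h f f' =
      ∑ p : PairsOf g, rawCup k σ h (CrossedProduct.proj σ k p.1.1 ∘ₗ f)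
        (CrossedProduct.proj σ k p.1.2 ∘ₗ f') := by
  classical
  have h1 : ∀ p : G × G, CrossedProduct.proj σ k g ∘ₗ rawCup k σ h
      (CrossedProduct.proj σ k p.1 ∘ₗ f) (CrossedProduct.proj σ k p.2 ∘ₗ f') =
      if p.1 * p.2 = g then rawCup k σ h
        (CrossedProduct.proj σ k p.1 ∘ₗ f) (CrossedProduct.proj σ k p.2 ∘ₗ f') else 0 := by
    intro p
    have h2 := rawCup_mem h (f := CrossedProduct.proj σ k p.1 ∘ₗ f)
      (f' := CrossedProduct.proj σ k p.2 ∘ₗ f') (fun _ => proj_mem _ _) (fun _ => proj_mem _ _)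
    split_ifs with hp
    · subst hp
      exact proj_comp_of_mem h2
    · exact proj_comp_of_mem_of_ne hp h2
  conv_lhs => rw [← sum_proj_comp f, ← sum_proj_comp f']
  simp only [map_sum, LinearMap.sum_apply]
  rw [Finset.sum_comm, ← Fintype.sum_prod_type']
  refine (proj_comp_sum g _ _).trans
    ((Finset.sum_congr rfl fun p _ => h1 p).trans ?_)
  rw [← Finset.sum_filter]
  exact Finset.sum_subtype _ (fun p => by simp) _

/-- On Δ(H)-linear maps `rawCup` unfolds to the map underlying `deltaCup`, whose linearity is part
of its construction. -/
theorem IsLin.rawCup {H : Subgroup G} {m n N : ℕ} (h : m + n = N)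
    {f : DeltaN k σ m →ₗ[k] CrossedProduct σ} {f' : DeltaN k σ n →ₗ[k] CrossedProduct σ}
    (hf : IsLin H f) (hf' : IsLin H f') : IsLin H (CrossedHH.rawCup k σ h f f') :=
  (deltaCup k σ H h (⟨f, hf, fun _ => Submodule.mem_top⟩ : deltaCochain k σ H ⊤ m)
    (⟨f', hf', fun _ => Submodule.mem_top⟩ : deltaCochain k σ H ⊤ n)).2.1

theorem IsLin.proj {W : Subgroup G} {g : G} (hW : W ≤ Subgroup.centralizer {g}) {n : ℕ}
    {f : DeltaN k σ n →ₗ[k] CrossedProduct σ} (hf : IsLin W f) :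
    IsLin W (CrossedProduct.proj σ k g ∘ₗ f) := fun a x => by
  rw [LinearMap.comp_apply, hf, LinearMap.comp_apply]
  exact linear_ext (fun h hh x hx y hy r => proj_mul hW h hh hx hy r) a _

/-! ### Sums over orbits -/

/-- Orbit-stabilizer: the orbit of r_i is H/K_i, and by equivariance the terms along it are the
conjugates of f(r_i), so they add up to a corestriction. -/
theorem sum_eq_sum_coresMap {Y ι : Type*} [Fintype Y] [Fintype ι] {H : Subgroup G}
    (act : H → Y → Y) (act_one : ∀ y, act 1 y = y)
    (act_mul : ∀ a b y, act (a * b) y = act a (act b y)) (r : ι → Y) (K : ι → Subgroup G)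
    (hK : ∀ i (x : H), (x : G) ∈ K i ↔ act x (r i) = r i)
    (hr : ∀ y, ∃! i, ∃ x, act x (r i) = y) {n : ℕ}
    (f : Y → (DeltaN k σ n →ₗ[k] CrossedProduct σ))
    (hf : ∀ (x : H) y, conjMap k σ (x : G) n (f y) = f (act x y)) :
    ∑ y, f y = ∑ i, coresMap k σ H (K i) n (f (r i)) := by
  classical
  let _ : ∀ i, Fintype (H ⧸ (K i).subgroupOf H) := fun i => Fintype.ofFinite _
  simp only [coresMap_apply, hf]
  rw [← Fintype.sum_sigma' (f := fun i (q : H ⧸ (K i).subgroupOf H) => f (act q.out (r i)))]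
  symm
  refine Fintype.sum_bijective
    (fun z : Σ i, H ⧸ (K i).subgroupOf H => act z.2.out (r z.1)) ⟨?_, ?_⟩ _ _ fun _ => rfl
  · rintro ⟨i, q⟩ ⟨j, q'⟩ h
    obtain rfl : i = j := (hr (act q'.out (r j))).unique ⟨_, h⟩ ⟨_, rfl⟩
    have h1 : act (q.out⁻¹ * q'.out) (r i) = r i := by
      rw [act_mul, ← show act q.out (r i) = act q'.out (r i) from h, ← act_mul, inv_mul_cancel,
        act_one]
    have h2 : q.out⁻¹ * q'.out ∈ (K i).subgroupOf H := (hK i _).2 h1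
    rw [← QuotientGroup.eq, QuotientGroup.out_eq', QuotientGroup.out_eq'] at h2
    rw [h2]
  · intro y
    obtain ⟨i, ⟨x, rfl⟩, -⟩ := hr y
    refine ⟨⟨i, QuotientGroup.mk x⟩, ?_⟩
    have h2 : (QuotientGroup.mk x : H ⧸ (K i).subgroupOf H).out⁻¹ * x ∈ (K i).subgroupOf H := by
      rw [← QuotientGroup.eq, QuotientGroup.out_eq']
    have h1 := (hK i ((QuotientGroup.mk x : H ⧸ (K i).subgroupOf H).out⁻¹ * x)).1 h2
    change act _ (r i) = act x (r i)
    conv_lhs => rw [← h1, ← act_mul, mul_inv_cancel_left]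

theorem mem_centralizer_singleton {x g : G} :
    x ∈ Subgroup.centralizer {g} ↔ x * g * x⁻¹ = g := by
  rw [Subgroup.mem_centralizer_iff, mul_inv_eq_iff_eq_mul]
  exact ⟨fun h => (h g rfl).symm, by rintro h _ rfl; exact h.symm⟩

/-- The orbit principle for G acting on itself by conjugation: a Δ-linear f is fixed by conjugation,
so its components are permuted, and the stabilizer of g is C(g). -/
theorem sum_coresMap_proj {t : Type*} [Fintype t] (rep : t → G)
    (hrep : ∀ g : G, ∃! i, IsConj (rep i) g) {n : ℕ} {f : DeltaN k σ n →ₗ[k] CrossedProduct σ}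
    (hf : IsLin ⊤ f) : ∑ i, coresMap k σ ⊤ (Subgroup.centralizer {rep i}) n
      (CrossedProduct.proj σ k (rep i) ∘ₗ f) = f := by
  rw [← sum_eq_sum_coresMap (H := ⊤) (fun (x : (⊤ : Subgroup G)) g => (x : G) * g * (x : G)⁻¹)
    (by simp) (by simp [mul_assoc]) rep (fun i => Subgroup.centralizer {rep i})
    (fun i x => mem_centralizer_singleton) ?_ (fun g => CrossedProduct.proj σ k g ∘ₗ f) ?_,
    sum_proj_comp]
  · intro g
    have h1 : ∀ i, (∃ x : (⊤ : Subgroup G), (x : G) * rep i * (x : G)⁻¹ = g) ↔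
        IsConj (rep i) g := fun i => by
      rw [isConj_iff]
      exact ⟨fun ⟨x, hx⟩ => ⟨x, hx⟩, fun ⟨x, hx⟩ => ⟨⟨x, Subgroup.mem_top x⟩, hx⟩⟩
    simp only [h1]
    exact hrep g
  · intro x g
    rw [← proj_comp_conjMap (x : G) rfl, hf.conjMap_of_mem x.2]

/-- The conjugate by x takes values in degree xgx⁻¹, which equals g only for the trivial coset of
C(g). -/
theorem proj_coresMap_self {g : G} {n : ℕ} {f : DeltaN k σ n →ₗ[k] CrossedProduct σ}
    (hf : IsLin (Subgroup.centralizer {g}) f) (hf' : ∀ p, f p ∈ component σ k g) :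
    CrossedProduct.proj σ k g ∘ₗ coresMap k σ ⊤ (Subgroup.centralizer {g}) n f = f := by
  classical
  let _ := Fintype.ofFinite
    ((⊤ : Subgroup G) ⧸ (Subgroup.centralizer {g}).subgroupOf (⊤ : Subgroup G))
  rw [coresMap_apply]
  refine (proj_comp_sum g _ _).trans ?_
  rw [Finset.sum_eq_single (QuotientGroup.mk 1)]
  · rw [hf.conjMap_congr (y := 1), hf.conjMap_of_mem (Subgroup.one_mem _)]
    · exact proj_comp_of_mem hf'
    · have h := QuotientGroup.out_eq' (QuotientGroup.mk 1 :
        (⊤ : Subgroup G) ⧸ (Subgroup.centralizer {g}).subgroupOf (⊤ : Subgroup G))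
      rw [QuotientGroup.eq] at h
      exact h
  · intro q _ hq
    refine proj_comp_of_mem_of_ne (fun h => hq ?_) (conjMap_mem _ hf')
    rw [← QuotientGroup.out_eq' q, eq_comm, QuotientGroup.eq, inv_one, one_mul]
    exact mem_centralizer_singleton.2 h
  · exact fun h => absurd (Finset.mem_univ _) h

theorem proj_coresMap_of_not_isConj {g h : G} (hne : ¬ IsConj h g) {n : ℕ} (K : Subgroup G)
    {f : DeltaN k σ n →ₗ[k] CrossedProduct σ} (hf' : ∀ p, f p ∈ component σ k h) :
    CrossedProduct.proj σ k g ∘ₗ coresMap k σ ⊤ K n f = 0 := by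
  classical
  let _ := Fintype.ofFinite ((⊤ : Subgroup G) ⧸ K.subgroupOf (⊤ : Subgroup G))
  rw [coresMap_apply]
  refine (proj_comp_sum g _ _).trans ?_
  refine Finset.sum_eq_zero fun q _ => ?_
  exact proj_comp_of_mem_of_ne (fun h => hne (isConj_iff.2 ⟨_, h⟩)) (conjMap_mem _ hf')

/-- The action of `C(g)` on the pairs with product `g`. -/
def conjPair {g : G} (x : Subgroup.centralizer {g}) (p : PairsOf g) : PairsOf g :=
  ⟨((x : G) * p.1.1 * (x : G)⁻¹, (x : G) * p.1.2 * (x : G)⁻¹), by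
    refine Eq.trans (b := (x : G) * (p.1.1 * p.1.2) * (x : G)⁻¹) (by group) ?_
    exact (congrArg (fun z => (x : G) * z * (x : G)⁻¹) p.2).trans (mem_centralizer_singleton.1 x.2)⟩

theorem conjPair_eq_iff {g : G} {x : Subgroup.centralizer {g}} {p q : PairsOf g} :
    conjPair x p = q ↔ (x : G) * p.1.1 * (x : G)⁻¹ = q.1.1 ∧
      (x : G) * p.1.2 * (x : G)⁻¹ = q.1.2 := by
  rw [Subtype.ext_iff, Prod.ext_iff]
  rfl

-- The orbit principle for C(g) acting on pairs of product g. The stabilizer of (h, l) is C(h) ∩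
-- C(l), and equivariance follows from multiplicativity of conjugation. The outer projection changes
-- nothing; it is kept to match `mMap`.
open Classical in
theorem proj_rawCup_eq_sum_coresMap {m n N : ℕ} (h : m + n = N)
    {f : DeltaN k σ m →ₗ[k] CrossedProduct σ}
    {f' : DeltaN k σ n →ₗ[k] CrossedProduct σ} (hf : IsLin ⊤ f) (hf' : IsLin ⊤ f') (g : G)
    [Fintype (Quotient (pairSetoid g))] :
    CrossedProduct.proj σ k g ∘ₗ rawCup k σ h f f' =
      ∑ q : Quotient (pairSetoid g), coresMap k σ (Subgroup.centralizer {g})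
        (Subgroup.centralizer {q.out.1.1} ⊓ Subgroup.centralizer {q.out.1.2}) N
        (CrossedProduct.proj σ k g ∘ₗ rawCup k σ h (CrossedProduct.proj σ k q.out.1.1 ∘ₗ f)
          (CrossedProduct.proj σ k q.out.1.2 ∘ₗ f')) := by
  have h1 : ∀ p : PairsOf g, CrossedProduct.proj σ k g ∘ₗ rawCup k σ h
      (CrossedProduct.proj σ k p.1.1 ∘ₗ f) (CrossedProduct.proj σ k p.1.2 ∘ₗ f') =
      rawCup k σ h (CrossedProduct.proj σ k p.1.1 ∘ₗ f)
        (CrossedProduct.proj σ k p.1.2 ∘ₗ f') := by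
    rintro ⟨p, rfl⟩
    exact proj_comp_of_mem (rawCup_mem h (fun _ => proj_mem _ _) (fun _ => proj_mem _ _))
  simp only [h1]
  rw [proj_rawCup]
  refine sum_eq_sum_coresMap conjPair (fun p => ?_) (fun a b p => ?_)
    (fun q : Quotient (pairSetoid g) => q.out) _ (fun q x => ?_) (fun p => ?_)
    (fun p : PairsOf g => rawCup k σ h (CrossedProduct.proj σ k p.1.1 ∘ₗ f)
        (CrossedProduct.proj σ k p.1.2 ∘ₗ f')) (fun x p => ?_)
  · simp [conjPair]
  · simp [conjPair, mul_assoc]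
  · rw [conjPair_eq_iff, Subgroup.mem_inf, mem_centralizer_singleton, mem_centralizer_singleton]
  · have h2 : ∀ q : Quotient (pairSetoid g), (∃ x, conjPair x q.out = p) ↔
        q = Quotient.mk _ p := fun q => by
      conv_rhs => rw [← Quotient.out_eq q, Quotient.eq]
      simp only [conjPair_eq_iff]
      exact ⟨fun ⟨x, hx⟩ => ⟨x, x.2, hx⟩, fun ⟨x, hx, hx'⟩ => ⟨⟨x, hx⟩, hx'⟩⟩
    simp only [h2]
    exact existsUnique_eq
  · have e : ∀ {l : ℕ} (u : G) {F : DeltaN k σ l →ₗ[k] CrossedProduct σ}, IsLin ⊤ F →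
        IsLin ⊥ (CrossedProduct.proj σ k u ∘ₗ F) := fun u _ hF => hF.bot.proj bot_le
    rw [conjMap_rawCup h (e _ hf) (e _ hf'), ← proj_comp_conjMap (x : G) rfl,
      ← proj_comp_conjMap (x : G) rfl, hf.conjMap_of_mem (Subgroup.mem_top _),
      hf'.conjMap_of_mem (Subgroup.mem_top _)]
    rfl

/-- A Mackey formula. The product of the two transversal sums runs over G/C × G/C' with diagonal
action, whose orbits are the double cosets, via (aC, bC') ↦ C a⁻¹b C'. The stabilizer of (yC, yxC')
is the intersection of the conjugates of C by y and of C' by yx. The element y is arbitrary because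
it only moves the point within its orbit. -/
theorem rawCup_coresMap {g h : G} (D : Finset G)
    (hD : ∀ z : G, ∃! x, x ∈ D ∧ z ∈ DoubleCoset.doubleCoset x
      (Subgroup.centralizer {g} : Set G) (Subgroup.centralizer {h} : Set G))
    (y : D → G) {m n N : ℕ} (hN : m + n = N) {f : DeltaN k σ m →ₗ[k] CrossedProduct σ}
    {f' : DeltaN k σ n →ₗ[k] CrossedProduct σ} (hf : IsLin (Subgroup.centralizer {g}) f)
    (hf' : IsLin (Subgroup.centralizer {h}) f') :
    rawCup k σ hN (coresMap k σ ⊤ (Subgroup.centralizer {g}) m f)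
        (coresMap k σ ⊤ (Subgroup.centralizer {h}) n f') =
      ∑ x : D, coresMap k σ ⊤ (conjSub (y x) (Subgroup.centralizer {g}) ⊓
        conjSub (y x * x) (Subgroup.centralizer {h})) N
        (rawCup k σ hN (conjMap k σ (y x) m f) (conjMap k σ (y x * x) n f')) := by
  classical
  set C := Subgroup.centralizer {g}
  set C' := Subgroup.centralizer {h}
  let _ := Fintype.ofFinite (G ⧸ C)
  let _ := Fintype.ofFinite (G ⧸ C')
  have hc : ∀ (L : Subgroup G) (z : G), ∃! q : G ⧸ L, q.out⁻¹ * z ∈ L := fun L z => by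
    have : ∀ q : G ⧸ L, q.out⁻¹ * z ∈ L ↔ q = QuotientGroup.mk z := fun q => by
      rw [← QuotientGroup.eq, QuotientGroup.out_eq']
    simp only [this]
    exact existsUnique_eq
  have ho : ∀ (L : Subgroup G) (z : G), (QuotientGroup.mk z : G ⧸ L).out⁻¹ * z ∈ L :=
    fun L z => by rw [← QuotientGroup.eq, QuotientGroup.out_eq']
  rw [coresMap_eq_sum (H := ⊤) (fun q : G ⧸ C => q.out) (fun _ => Subgroup.mem_top _)
      (fun z _ => hc C z) hf,
    coresMap_eq_sum (H := ⊤) (fun q : G ⧸ C' => q.out) (fun _ => Subgroup.mem_top _)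
      (fun z _ => hc C' z) hf']
  -- Defined through chosen coset representatives; by linearity over C and C' any representatives
  -- give the same value.
  let F : (G ⧸ C) × (G ⧸ C') → (DeltaN k σ N →ₗ[k] CrossedProduct σ) := fun q =>
    rawCup k σ hN (conjMap k σ q.1.out m f) (conjMap k σ q.2.out n f')
  have hF : ∀ a b : G, F (QuotientGroup.mk a, QuotientGroup.mk b) =
      rawCup k σ hN (conjMap k σ a m f) (conjMap k σ b n f') := fun a b => by
    simp only [F]
    rw [hf.conjMap_congr (ho C a), hf'.conjMap_congr (ho C' b)]
  have hsum : rawCup k σ hN (∑ q : G ⧸ C, conjMap k σ q.out m f)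
      (∑ q : G ⧸ C', conjMap k σ q.out n f') = ∑ q, F q := by
    simp only [map_sum, LinearMap.sum_apply]
    rw [Finset.sum_comm, ← Fintype.sum_prod_type']
  simp only [← hF]
  rw [hsum]
  refine sum_eq_sum_coresMap (fun (x : (⊤ : Subgroup G)) q => (x : G) • q)
    (fun q => one_smul G q) (fun a b q => mul_smul (a : G) b q)
    (fun x : D => ((QuotientGroup.mk (y x) : G ⧸ C), (QuotientGroup.mk (y x * x) : G ⧸ C')))
    _ (fun x z => ?_) ?_ F ?_
  · rw [Subgroup.mem_inf, mem_conjSub, mem_conjSub, Prod.smul_mk, Prod.mk.injEq,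
      MulAction.Quotient.smul_mk, MulAction.Quotient.smul_mk, eq_comm, QuotientGroup.eq,
      eq_comm (b := (QuotientGroup.mk (y x * x) : G ⧸ C')), QuotientGroup.eq]
    simp only [smul_eq_mul, mul_assoc]
  · rintro ⟨q, q'⟩
    induction q using QuotientGroup.induction_on with | H a => ?_
    induction q' using QuotientGroup.induction_on with | H b => ?_
    -- The point (aC, bC') lies in the orbit of x exactly when a⁻¹b lies in C x C', so the
    -- hypothesis on D says that D represents the orbits once each.
    have key : ∀ x : D, (∃ z : (⊤ : Subgroup G), (z : G) •
        ((QuotientGroup.mk (y x) : G ⧸ C), (QuotientGroup.mk (y x * x) : G ⧸ C')) =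
          (QuotientGroup.mk a, QuotientGroup.mk b)) ↔
        a⁻¹ * b ∈ DoubleCoset.doubleCoset (x : G) (C : Set G) (C' : Set G) := by
      intro x
      rw [DoubleCoset.mem_doubleCoset]
      simp only [Prod.smul_mk, Prod.mk.injEq, MulAction.Quotient.smul_mk, QuotientGroup.eq,
        smul_eq_mul]
      constructor
      · rintro ⟨z, h1, h2⟩
        refine ⟨_, C.inv_mem h1, _, h2, ?_⟩
        group
      · rintro ⟨c, hc, c', hc', e⟩
        refine ⟨⟨a * c * (y x)⁻¹, Subgroup.mem_top _⟩, ?_, ?_⟩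
        · have : (a * c * (y x)⁻¹ * y x)⁻¹ * a = c⁻¹ := by group
          rw [this]
          exact C.inv_mem hc
        · have : (a * c * (y x)⁻¹ * (y x * x))⁻¹ * b = c' := by
            rw [inv_mul_eq_iff_eq_mul, inv_mul_eq_iff_eq_mul.1 e]
            group
          rw [this]
          exact hc'
    simp only [key]
    obtain ⟨x, ⟨hx, hx'⟩, hu⟩ := hD (a⁻¹ * b)
    exact ⟨⟨x, hx⟩, hx', fun x' h' => Subtype.ext (hu x' ⟨x'.2, h'⟩)⟩
  · rintro x ⟨q, q'⟩
    induction q using QuotientGroup.induction_on with | H a => ?_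
    induction q' using QuotientGroup.induction_on with | H b => ?_
    rw [hF, conjMap_rawCup hN (hf.bot.conjMap_bot a) (hf'.bot.conjMap_bot b),
      conjMap_conjMap hf.bot, conjMap_conjMap hf'.bot, ← hF]
    rfl

end Cochains

/-! ## Cohomology classes represented by cochains -/

section Classes

set_option linter.unusedSectionVars false

open CrossedProduct

variable {G S : Type*} [Group G] [Fintype G] [Ring S] [MulSemiringAction G S]
variable {k : Type*} [CommRing k] [Algebra k S] [SMulCommClass G k S]
variable {σ : TwoCocycle G S}

/-- The element `ζ` of `Ext^*_{Δ(H)}(S, N)` is the class of the cocycle `f : Δ_n → R`. -/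
def Rep {H : Subgroup G} {N : Submodule k (CrossedProduct σ)} (ζ : ExtTot k σ H N) (n : ℕ)
    (f : DeltaN k σ n →ₗ[k] CrossedProduct σ) : Prop :=
  ∃ x : DeltaCochain k σ H N n, x.1 = f ∧ ∃ hx : cochainD k σ H N n x = 0,
    ζ = tot (cochainD k σ H N) x hx

variable {H K : Subgroup G} {N N' : Submodule k (CrossedProduct σ)} {n : ℕ}
variable {f f' : DeltaN k σ n →ₗ[k] CrossedProduct σ}

/-! ### Calculus of representing cocycles. -/

theorem Rep.isLin {ζ : ExtTot k σ H N} (h : Rep ζ n f) : IsLin H f := by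
  obtain ⟨x, rfl, -⟩ := h
  exact x.2.1

theorem Rep.mem {ζ : ExtTot k σ H N} (h : Rep ζ n f) (p : DeltaN k σ n) : f p ∈ N := by
  obtain ⟨x, rfl, -⟩ := h
  exact x.2.2 p

/-- This is how identities descend to cohomology: each operation has a representative by the lemmas
below, and equality of the underlying maps suffices. -/
theorem Rep.unique {ζ ζ' : ExtTot k σ H N} (h : Rep ζ n f) (h' : Rep ζ' n f') (e : f = f') :
    ζ = ζ' := by
  obtain ⟨x, rfl, hx, rfl⟩ := h
  obtain ⟨x', rfl, hx', rfl⟩ := h'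
  exact tot_congr (Subtype.ext e) _ _

theorem Rep.zero : Rep (0 : ExtTot k σ H N) n 0 := ⟨0, rfl, map_zero _, tot_zero.symm⟩

theorem Rep.add {ζ ζ' : ExtTot k σ H N} (h : Rep ζ n f) (h' : Rep ζ' n f') :
    Rep (ζ + ζ') n (f + f') := by
  obtain ⟨x, rfl, hx, rfl⟩ := h
  obtain ⟨x', rfl, hx', rfl⟩ := h'
  exact ⟨x + x', rfl, by rw [map_add, hx, hx', add_zero], (tot_add x x' hx hx').symm⟩

theorem Rep.sum {ι : Type*} (s : Finset ι) {ζ : ι → ExtTot k σ H N}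
    {F : ι → (DeltaN k σ n →ₗ[k] CrossedProduct σ)} (h : ∀ i ∈ s, Rep (ζ i) n (F i)) :
    Rep (∑ i ∈ s, ζ i) n (∑ i ∈ s, F i) := by
  classical
  induction s using Finset.induction_on with
  | empty => exact Rep.zero
  | insert i s hi ih =>
    rw [Finset.sum_insert hi, Finset.sum_insert hi]
    exact (h i (Finset.mem_insert_self i s)).add
      (ih fun j hj => h j (Finset.mem_insert_of_mem hj))

@[elab_as_elim]
theorem Rep.induction {p : ExtTot k σ H N → Prop} (ζ : ExtTot k σ H N) (h0 : p 0)
    (hadd : ∀ a b, p a → p b → p (a + b))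
    (h : ∀ ζ n (f : DeltaN k σ n →ₗ[k] CrossedProduct σ), Rep ζ n f → p ζ) : p ζ :=
  tot_induction h0 hadd (fun n x hx => h _ n x.1 ⟨x, rfl, hx, rfl⟩) ζ

theorem Rep.map
    (φ : ∀ n, (DeltaN k σ n →ₗ[k] CrossedProduct σ) →ₗ[k] (DeltaN k σ n →ₗ[k] CrossedProduct σ))
    (hφ : ∀ n, ∀ f ∈ deltaCochain k σ H N n, φ n f ∈ deltaCochain k σ K N' n)
    (hd : ∀ n f, φ (n + 1) (f.comp (deltaD k σ n)) = (φ n f).comp (deltaD k σ n))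
    {ζ : ExtTot k σ H N} (h : Rep ζ n f) :
    Rep (DirectSum.lmap (ExtD.map φ hφ hd) ζ) n (φ n f) := by
  obtain ⟨x, rfl, hx, rfl⟩ := h
  have hc : ∀ n (x : DeltaCochain k σ H N n), (φ (n + 1)).restrict
      (p := deltaCochain k σ H N (n + 1)) (q := deltaCochain k σ K N' (n + 1)) (hφ (n + 1))
      (cochainD k σ H N n x) = cochainD k σ K N' n ((φ n).restrict (p := deltaCochain k σ H N n)
        (q := deltaCochain k σ K N' n) (hφ n) x) := fun n x => Subtype.ext (hd n x.1)
  exact ⟨(φ n).restrict (p := deltaCochain k σ H N n) (q := deltaCochain k σ K N' n) (hφ n) x, rfl,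
    (hc n x).symm.trans ((congrArg _ hx).trans (map_zero _)), tot_map (dX := cochainD k σ H N) (dY := cochainD k σ K N')
      (fun n => (φ n).restrict (p := deltaCochain k σ H N n) (q := deltaCochain k σ K N' n) (hφ n))
      hc x hx⟩

theorem Rep.res (hKH : K ≤ H) {ζ : ExtTot k σ H N} (h : Rep ζ n f) :
    Rep (ExtTot.res hKH N ζ) n f :=
  h.map (fun _ => LinearMap.id) _ (fun _ _ => rfl)

theorem Rep.conj (x : G) (hN : ∀ r ∈ N, bar σ x * r * ((bar σ x)⁻¹ : (CrossedProduct σ)ˣ) ∈ N')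
    {ζ : ExtTot k σ H N} (h : Rep ζ n f) :
    Rep (ExtTot.conj x H hN ζ) n (conjMap k σ x n f) :=
  h.map (conjMap k σ x) _ (conjMap_deltaD x)

theorem Rep.cores (hKH : K ≤ H)
    (hN : ∀ g ∈ H, ∀ r ∈ N, bar σ g * r * ((bar σ g)⁻¹ : (CrossedProduct σ)ˣ) ∈ N)
    {ζ : ExtTot k σ K N} (h : Rep ζ n f) :
    Rep (ExtTot.cores hKH hN ζ) n (coresMap k σ H K n f) :=
  h.map (coresMap k σ H K) _ (coresMap_deltaD H K)

theorem Rep.theta (g : G) {ζ : ExtTot k σ H (component σ k g)} (h : Rep ζ n f) :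
    Rep (ExtTot.theta g H ζ) n f :=
  h.map (fun _ => LinearMap.id) _ (fun _ _ => rfl)

theorem Rep.pi {g : G} (hH : H ≤ Subgroup.centralizer {g}) {ζ : ExtTot k σ H ⊤}
    (h : Rep ζ n f) : Rep (ExtTot.pi g hH ζ) n (CrossedProduct.proj σ k g ∘ₗ f) :=
  h.map (fun _ => (CrossedProduct.proj σ k g).compRight k) _ (fun _ _ => rfl)

theorem Rep.mul {l m : ℕ} {f : DeltaN k σ l →ₗ[k] CrossedProduct σ}
    {f' : DeltaN k σ m →ₗ[k] CrossedProduct σ} {ζ ζ' : ExtTot k σ H ⊤} (h : Rep ζ l f)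
    (h' : Rep ζ' m f') (e : l + m = n) : Rep (ExtTot.mul H ζ ζ') n (rawCup k σ e f f') := by
  obtain ⟨x, rfl, hx, rfl⟩ := h
  obtain ⟨x', rfl, hx', rfl⟩ := h'
  exact ⟨deltaCup k σ H e x x', rfl, cup_cocycle (deltaCup_leibniz H) e x x' hx hx',
    tot_deltaCup H e x x' hx hx'⟩

theorem Rep.gamma {g : G} {α : A k σ g} (h : Rep α n f) :
    Rep (gamma g α) n (coresMap k σ ⊤ (Subgroup.centralizer {g}) n f) :=
  (h.theta g).cores _ _

theorem Rep.piRes (g : G) {ζ : ExtTot k σ (⊤ : Subgroup G) ⊤} (h : Rep ζ n f) :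
    Rep (piRes g ζ) n (CrossedProduct.proj σ k g ∘ₗ f) :=
  (h.res _).pi _

theorem Rep.pairing {g g' l : G} {L M : Subgroup G} (hW : L ⊓ M ≤ Subgroup.centralizer {l})
    {a b : ℕ} {f : DeltaN k σ a →ₗ[k] CrossedProduct σ}
    {f' : DeltaN k σ b →ₗ[k] CrossedProduct σ} {α : ExtTot k σ L (component σ k g)}
    {β : ExtTot k σ M (component σ k g')} (h : Rep α a f) (h' : Rep β b f') (e : a + b = n) :
    Rep (pairing hW α β) n (coresMap k σ (Subgroup.centralizer {l}) (L ⊓ M) n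
      (CrossedProduct.proj σ k l ∘ₗ rawCup k σ e f f')) :=
  ((((h.res _).theta g).mul ((h'.res _).theta g') e).pi hW).cores _ _

theorem Rep.conjTo (x g : G) {α : A k σ g} (h : Rep α n f) :
    Rep (conjTo x g α) n (conjMap k σ x n f) :=
  h.conj x _

theorem Rep.cMap (x : G) {g g' : G} (e : g' = x * g * x⁻¹) {α : A k σ g} (h : Rep α n f) :
    Rep (cMap x e α) n (conjMap k σ x n f) :=
  (h.conj x _).res _

theorem Rep.mMap {g h l : G} (e : g * h = l) {a b : ℕ} {f : DeltaN k σ a →ₗ[k] CrossedProduct σ}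
    {f' : DeltaN k σ b →ₗ[k] CrossedProduct σ} {α : A k σ g} {β : A k σ h}
    (hα : Rep α a f) (hβ : Rep β b f') (e' : a + b = n) :
    Rep (mMap e α β) n (coresMap k σ (Subgroup.centralizer {l})
      (Subgroup.centralizer {g} ⊓ Subgroup.centralizer {h}) n
      (CrossedProduct.proj σ k l ∘ₗ rawCup k σ e' f f')) :=
  hα.pairing _ hβ e'

/-! ### The isomorphism `⨁ A(g_i) ≅ Ext^*_Δ(S, R)` and the product formula -/

theorem piRes_gamma_self {g : G} (α : A k σ g) : piRes g (gamma g α) = α := by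
  induction α using Rep.induction with
  | h0 => simp only [map_zero]
  | hadd a b ha hb => simp only [map_add, ha, hb]
  | h α n f h => exact (h.gamma.piRes g).unique h (proj_coresMap_self h.isLin h.mem)

theorem piRes_gamma_of_not_isConj {g h : G} (hne : ¬ IsConj h g) (α : A k σ h) :
    piRes g (gamma h α) = 0 := by
  induction α using Rep.induction with
  | h0 => simp only [map_zero]
  | hadd a b ha hb => simp only [map_add, ha, hb, add_zero]
  | h α n f h =>
    exact (h.gamma.piRes g).unique Rep.zero (proj_coresMap_of_not_isConj hne _ h.mem)

/-- `rawCup_coresMap` followed by transitivity of corestriction through C(l x). -/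
theorem ExtTot.mul_gamma_gamma {g h : G} (D : Finset G)
    (hD : ∀ z : G, ∃! x, x ∈ D ∧ z ∈ DoubleCoset.doubleCoset x
      (Subgroup.centralizer {g} : Set G) (Subgroup.centralizer {h} : Set G))
    (l y : D → G)
    (e : ∀ x : D, (y x * g * (y x)⁻¹) * ((y x * x) * h * (y x * x)⁻¹) = l x)
    (α : A k σ g) (β : A k σ h) :
    ExtTot.mul ⊤ (gamma g α) (gamma h β) = ∑ x : D, gamma (l x)
      (pairing (conjSub_inf_le (e x)) (conjTo (y x) g α) (conjTo (y x * x) h β)) := by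
  induction α using Rep.induction with
  | h0 => simp only [map_zero, LinearMap.zero_apply, Finset.sum_const_zero]
  | hadd a b ha hb => simp only [map_add, LinearMap.add_apply, Finset.sum_add_distrib, ha, hb]
  | h α m f hα =>
  induction β using Rep.induction with
  | h0 => simp only [map_zero, Finset.sum_const_zero]
  | hadd a b ha hb => simp only [map_add, Finset.sum_add_distrib, ha, hb]
  | h β n f' hβ =>
  refine (hα.gamma.mul hβ.gamma rfl).unique (Rep.sum _ fun x _ =>
    ((hα.conjTo (y x) g).pairing (conjSub_inf_le (e x)) (hβ.conjTo (y x * x) h) rfl).gamma) ?_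
  rw [rawCup_coresMap D hD y rfl hα.isLin hβ.isLin]
  refine Finset.sum_congr rfl fun x _ => ?_
  have h1 := rawCup_mem (N := m + n) rfl (conjMap_mem (y x) hα.mem)
    (conjMap_mem (y x * x) hβ.mem)
  rw [e x] at h1
  -- The conjugated factors already have a product of degree l x, so the projection in `pairing` is
  -- the identity on it.
  rw [proj_comp_of_mem h1, coresMap_coresMap le_top (conjSub_inf_le (e x))]
  exact ((hα.isLin.conjMap (y x)).mono inf_le_left).rawCup rfl
    ((hβ.isLin.conjMap (y x * x)).mono inf_le_right)

/-! ### The maps `c` and `m` -/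

theorem cMap_one {g : G} (e : g = 1 * g * 1⁻¹) (α : A k σ g) : cMap 1 e α = α := by
  induction α using Rep.induction with
  | h0 => simp only [map_zero]
  | hadd a b ha hb => simp only [map_add, ha, hb]
  | h α n f h => exact (h.cMap 1 e).unique h (h.isLin.conjMap_of_mem (Subgroup.one_mem _))

theorem cMap_cMap {x y g g' g'' : G} (e : g' = y * g * y⁻¹) (e' : g'' = x * g' * x⁻¹)
    (e'' : g'' = (x * y) * g * (x * y)⁻¹) (α : A k σ g) :
    cMap x e' (cMap y e α) = cMap (x * y) e'' α := by
  induction α using Rep.induction with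
  | h0 => simp only [map_zero]
  | hadd a b ha hb => simp only [map_add, ha, hb]
  | h α n f h =>
    exact ((h.cMap y e).cMap x e').unique (h.cMap (x * y) e'') (conjMap_conjMap h.isLin.bot x y)

theorem cMap_of_mem {x g : G} (hx : x ∈ Subgroup.centralizer {g}) (e : g = x * g * x⁻¹)
    (α : A k σ g) : cMap x e α = α := by
  induction α using Rep.induction with
  | h0 => simp only [map_zero]
  | hadd a b ha hb => simp only [map_add, ha, hb]
  | h α n f h => exact (h.cMap x e).unique h (h.isLin.conjMap_of_mem hx)

theorem mem_centralizer_conj {x z g g' : G} (e : g' = x * g * x⁻¹) :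
    z ∈ Subgroup.centralizer {g'} ↔ x⁻¹ * z * x ∈ Subgroup.centralizer {g} :=
  ⟨fun h => mem_conjSub.1 (centralizer_le_conjSub e h),
    fun h => conjSub_centralizer_le e (mem_conjSub.2 h)⟩

/-- Conjugation commutes with cup products, permutes the projections, and carries corestriction to
corestriction between the conjugate subgroups. -/
theorem cMap_mMap {x h l g h' l' g' : G} (e : h * l = g) (e' : h' * l' = g')
    (eh : h' = x * h * x⁻¹) (el : l' = x * l * x⁻¹) (eg : g' = x * g * x⁻¹) (α : A k σ h)
    (β : A k σ l) : cMap x eg (mMap e α β) = mMap e' (cMap x eh α) (cMap x el β) := by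
  induction α using Rep.induction with
  | h0 => simp only [map_zero, LinearMap.zero_apply]
  | hadd a b ha hb => simp only [map_add, LinearMap.add_apply, ha, hb]
  | h α m f hα =>
  induction β using Rep.induction with
  | h0 => simp only [map_zero]
  | hadd a b ha hb => simp only [map_add, ha, hb]
  | h β n f' hβ =>
  refine ((hα.mMap e hβ rfl).cMap x eg).unique ((hα.cMap x eh).mMap e' (hβ.cMap x el) rfl) ?_
  have hW := centralizer_inf_le e
  rw [← conjMap_rawCup rfl hα.isLin.bot hβ.isLin.bot, proj_comp_conjMap x eg]
  refine conjMap_coresMap x (fun z => mem_centralizer_conj eg) (fun z => ?_) (IsLin.proj hW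
    ((hα.isLin.mono inf_le_left).rawCup rfl (hβ.isLin.mono inf_le_right)))
  rw [Subgroup.mem_inf, Subgroup.mem_inf, mem_centralizer_conj eh, mem_centralizer_conj el]

/-! ### The product on the invariants -/

/-- A Δ(G)-linear map is fixed by conjugation, so the components of a class over Δ(G) form an
invariant family. -/
theorem cMap_piRes {x g g' : G} (e : g' = x * g * x⁻¹) (ζ : ExtTot k σ (⊤ : Subgroup G) ⊤) :
    cMap x e (piRes g ζ) = piRes g' ζ := by
  induction ζ using Rep.induction with
  | h0 => simp only [map_zero]
  | hadd a b ha hb => simp only [map_add, ha, hb]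
  | h ζ n f h =>
    refine ((h.piRes g).cMap x e).unique (h.piRes g') ?_
    rw [← proj_comp_conjMap x e, h.isLin.conjMap_of_mem (Subgroup.mem_top x)]

/-- The source of the product on A^G: each orbit sum in `proj_rawCup_eq_sum_coresMap` is one term of
`mulA`. -/
theorem piRes_mul (ζ ζ' : ExtTot k σ (⊤ : Subgroup G) ⊤) (g : G) :
    piRes g (ExtTot.mul ⊤ ζ ζ') = mulA (fun h => piRes h ζ) (fun h => piRes h ζ') g := by
  induction ζ using Rep.induction with
  | h0 => simp only [mulA, map_zero, LinearMap.zero_apply, Finset.sum_const_zero]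
  | hadd a b ha hb =>
    simp only [mulA] at ha hb ⊢
    simp only [map_add, LinearMap.add_apply, Finset.sum_add_distrib, ha, hb]
  | h ζ m f h =>
  induction ζ' using Rep.induction with
  | h0 => simp only [mulA, map_zero, Finset.sum_const_zero]
  | hadd a b ha hb =>
    simp only [mulA] at ha hb ⊢
    simp only [map_add, Finset.sum_add_distrib, ha, hb]
  | h ζ' n f' h' =>
  let _ := Fintype.ofFinite (Quotient (pairSetoid g))
  exact ((h.mul h' rfl).piRes g).unique
    (Rep.sum _ fun q _ => (h.piRes q.out.1.1).mMap q.out.2 (h'.piRes q.out.1.2) rfl)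
    (proj_rawCup_eq_sum_coresMap rfl h.isLin h'.isLin g)

/-- Invariance and equivariance of m move one term to the other by some x in C(g), and C(g) acts
trivially on A(g). -/
theorem mMap_congr_of_rel {α β : ∀ g : G, A k σ g} (hα : α ∈ invA k σ) (hβ : β ∈ invA k σ) {g : G}
    {p q : PairsOf g} (h : (pairSetoid g).r p q) :
    mMap p.2 (α p.1.1) (β p.1.2) = mMap q.2 (α q.1.1) (β q.1.2) := by
  obtain ⟨x, hx, h1, h2⟩ := h
  rw [← hα x _ _ h1.symm, ← hβ x _ _ h2.symm,
    ← cMap_mMap p.2 q.2 h1.symm h2.symm (eq_conj_of_mem hx), cMap_of_mem hx]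

theorem mulA_eq_sum {α β : ∀ g : G, A k σ g} (hα : α ∈ invA k σ) (hβ : β ∈ invA k σ) (g : G)
    (T : Finset (PairsOf g)) (hT : ∀ p : PairsOf g, ∃! q, q ∈ T ∧ (pairSetoid g).r p q) :
    mulA α β g = ∑ q ∈ T, mMap q.2 (α q.1.1) (β q.1.2) := by
  classical
  let _ := Fintype.ofFinite (Quotient (pairSetoid g))
  have hT' : mulA α β g = ∑ q : Quotient (pairSetoid g),
      mMap q.out.2 (α q.out.1.1) (β q.out.1.2) := rfl
  rw [hT', ← Finset.sum_coe_sort T]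
  symm
  refine Fintype.sum_bijective (fun q : T => (Quotient.mk _ q.1 : Quotient (pairSetoid g)))
    ⟨fun q q' h => ?_, fun q => ?_⟩ _ _ fun q => ?_
  · exact Subtype.ext ((hT q).unique ⟨q.2, (pairSetoid g).refl _⟩ ⟨q'.2, Quotient.exact h⟩)
  · obtain ⟨p, ⟨hp, hr⟩, -⟩ := hT q.out
    exact ⟨⟨p, hp⟩, (Quotient.sound ((pairSetoid g).symm hr)).trans (Quotient.out_eq q)⟩
  · exact mMap_congr_of_rel hα hβ ((pairSetoid g).symm (Quotient.mk_out (s := pairSetoid g) q.1))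

/-! ### Classification by conjugacy classes -/

variable {t : Type*} [Fintype t] {rep : t → G}

theorem sum_gamma_piRes (hrep : ∀ g : G, ∃! i, IsConj (rep i) g)
    (ζ : ExtTot k σ (⊤ : Subgroup G) ⊤) : ∑ i, gamma (rep i) (piRes (rep i) ζ) = ζ := by
  induction ζ using Rep.induction with
  | h0 => simp only [map_zero, Finset.sum_const_zero]
  | hadd a b ha hb => simp only [map_add, Finset.sum_add_distrib, ha, hb]
  | h ζ n f h =>
    exact (Rep.sum _ fun i _ => (h.piRes (rep i)).gamma).unique h
      (sum_coresMap_proj rep hrep h.isLin)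

theorem piRes_sum_gamma (hrep : ∀ g : G, ∃! i, IsConj (rep i) g) (a : ∀ i, A k σ (rep i)) (i : t) :
    piRes (rep i) (∑ j, gamma (rep j) (a j)) = a i := by
  rw [map_sum, Finset.sum_eq_single i, piRes_gamma_self]
  · intro j _ hj
    exact piRes_gamma_of_not_isConj
      (fun h => hj ((hrep (rep i)).unique h (IsConj.refl _))) (a j)
  · exact fun h => absurd (Finset.mem_univ i) h

theorem invA_ext (hrep : ∀ g : G, ∃! i, IsConj (rep i) g) {α β : ∀ g : G, A k σ g}
    (hα : α ∈ invA k σ) (hβ : β ∈ invA k σ) (h : ∀ i, α (rep i) = β (rep i)) : α = β := by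
  funext g
  obtain ⟨i, hi, -⟩ := hrep g
  obtain ⟨x, hx⟩ := isConj_iff.1 hi
  rw [← hα x _ _ hx.symm, ← hβ x _ _ hx.symm, h]

variable (k σ) in
/-- The map `ζ ↦ (π_g^* res ζ)_g` from `Ext^*_Δ(S, R)` to `A^G`. -/
def piInv : ExtTot k σ (⊤ : Subgroup G) ⊤ →ₗ[k] invA k σ :=
  (LinearMap.pi fun g => piRes g).codRestrict _ fun ζ _ _ _ e => cMap_piRes e ζ

theorem piInv_apply (ζ : ExtTot k σ (⊤ : Subgroup G) ⊤) (g : G) :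
    (piInv k σ ζ : ∀ g : G, A k σ g) g = piRes g ζ :=
  rfl

/-- A class is recovered from its components at the representatives. For surjectivity, the sum of
the γ of those components has the right values at the representatives, and an invariant family is
determined by these. -/
theorem piInv_bijective (hrep : ∀ g : G, ∃! i, IsConj (rep i) g) :
    Function.Bijective (piInv k σ) := by
  constructor
  · intro ζ ζ' h
    rw [← sum_gamma_piRes hrep ζ, ← sum_gamma_piRes hrep ζ']
    simp only [← piInv_apply, h]
  · intro α
    refine ⟨∑ j, gamma (rep j) ((α : ∀ g, A k σ g) (rep j)), Subtype.ext ?_⟩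
    exact invA_ext hrep (Subtype.prop _) α.2 fun i => piRes_sum_gamma hrep _ i

/-- Prescribed values are extended to an invariant family by passing through Ext^*_Δ(S,R), so the
choice of conjugating elements never has to be examined. -/
theorem invA_restrict_bijective (hrep : ∀ g : G, ∃! i, IsConj (rep i) g) :
    Function.Bijective (fun (α : invA k σ) (i : t) => (α : ∀ g, A k σ g) (rep i)) :=
  ⟨fun α β h => Subtype.ext (invA_ext hrep α.2 β.2 fun i => congrFun h i), fun a =>
    ⟨piInv k σ (∑ j, gamma (rep j) (a j)), funext fun i => piRes_sum_gamma hrep a i⟩⟩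

/-! ### The unit -/

theorem deltaAug_isLin : IsLin (⊤ : Subgroup G) (deltaAug k σ) := fun a x =>
  barAug_smul a.1 (deltaIncl k σ 0 x)

theorem rep_toExt_one : Rep (HHTot.toExt k σ (HHTot.one k (CrossedProduct σ))) 0 (deltaAug k σ) :=
  ⟨restrictCochain k σ 0 (hochUnit k (CrossedProduct σ)), rfl,
    restrictCochain_cocycle (hochD_hochUnit k (CrossedProduct σ)),
    HHTot.toExt_tot _ (hochD_hochUnit k (CrossedProduct σ)) _⟩

/-- For a homogeneous tensor the sum over G in the cup product reduces to the single term indexed by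
the degree of the head. -/
theorem rawCup_tprod {m n N : ℕ} (h : m + n = N) (hm : m ≤ N)
    {f : DeltaN k σ m →ₗ[k] CrossedProduct σ} {f' : DeltaN k σ n →ₗ[k] CrossedProduct σ}
    (hf : IsLin ⊥ f) (hf' : IsLin ⊥ f') (r : Fin (N + 2) → CrossedProduct σ)
    (g : Fin (N + 2) → G) (hr : ∀ i, r i ∈ component σ k (g i)) (hg : (List.ofFn g).prod = 1)
    (e : G) (he : (List.ofFn (headTuple hm g 1)).prod = e) :
    rawCup k σ h f f' ⟨Bar.tprod k r, tprod_mem_deltaSub hr hg⟩ =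
      f.comp (deltaRetr k σ m) (Bar.tprod k
        (headTuple hm r (((bar σ e)⁻¹ : (CrossedProduct σ)ˣ) : CrossedProduct σ))) *
      f'.comp (deltaRetr k σ n) (Bar.tprod k (tailTuple h (bar σ e : CrossedProduct σ) r)) := by
  have h1 : (List.ofFn (headTuple hm g e⁻¹)).prod = 1 := by
    rw [headTuple_eq_sandwich, prod_sandwich, one_mul, he, mul_inv_cancel]
  have h2 : (List.ofFn (tailTuple h e g)).prod = 1 := by
    rw [tailTuple_eq_sandwich, prod_sandwich, mul_one, ← he,
      prod_headTuple_mul_prod_tailTuple hm h g, hg]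
  have key := deltaCup_tprod h hm
    (⟨f, hf, fun _ => Submodule.mem_top⟩ : deltaCochain k σ ⊥ ⊤ m)
    (⟨f', hf', fun _ => Submodule.mem_top⟩ : deltaCochain k σ ⊥ ⊤ n) r g hr e h1
    ⟨_, tprod_mem_deltaSub hr hg⟩ rfl
    ⟨_, tprod_mem_deltaSub (headTuple_mem_component hm hr (bar_inv_mem e)) h1⟩ rfl
    ⟨_, tprod_mem_deltaSub (tailTuple_mem_component h hr (bar_mem e)) h2⟩ rfl
  refine key.trans (congrArg₂ _ (congrArg f ?_) (congrArg f' ?_))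
  · exact (deltaRetr_deltaIncl _).symm
  · exact (deltaRetr_deltaIncl _).symm

theorem deltaAug_deltaRetr {r : Fin 2 → CrossedProduct σ} {g : Fin 2 → G}
    (hr : ∀ i, r i ∈ component σ k (g i)) (hg : (List.ofFn g).prod = 1) :
    (deltaAug k σ).comp (deltaRetr k σ 0) (Bar.tprod k r) = r 0 * r 1 := by
  rw [LinearMap.comp_apply, deltaAug, LinearMap.comp_apply,
    deltaIncl_deltaRetr_of_mem _ (tprod_mem_deltaSub hr hg), barAug_tprod]

/-- The augmentation is a strict left unit. It produces r_0 ē⁻¹, which lies in S, and linearity over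
Δ(1) moves it into the first slot of f, where it restores r_0. -/
theorem deltaAug_rawCup {f : DeltaN k σ n →ₗ[k] CrossedProduct σ} (hf : IsLin ⊥ f) :
    rawCup k σ (zero_add n) (deltaAug k σ) f = f := by
  refine DeltaN.hom_ext fun r g hr hg => ?_
  -- For m = 0 the head contains only r_0, so the inserted group element is g_0.
  have he : (List.ofFn (headTuple (m := 0) (Nat.zero_le n) g 1)).prod = g 0 := by
    simp [List.ofFn_succ, headTuple]
  rw [rawCup_tprod (zero_add n) (Nat.zero_le n) deltaAug_isLin.bot hf r g hr hg _ he,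
    deltaAug_deltaRetr (headTuple_mem_component _ hr (bar_inv_mem _))
      (by simp [List.ofFn_succ, headTuple])]
  set E := bar σ (g 0)
  have hw : r 0 * ((E⁻¹ : (CrossedProduct σ)ˣ) : CrossedProduct σ) ∈ component σ k 1 := by
    have := mul_mem_component (hr 0) (bar_inv_mem (g 0))
    rwa [mul_inv_cancel] at this
  have h1 : r = sandwich (r 0 * ((E⁻¹ : (CrossedProduct σ)ˣ) : CrossedProduct σ)) 1
      (tailTuple (zero_add n) (E : CrossedProduct σ) r) := by
    ext j
    refine Fin.cases ?_ (fun j => ?_) j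
    · simp [sandwich, tailTuple]
    · simp [sandwich, tailTuple]
      rfl
  have h2 : f ⟨Bar.tprod k r, tprod_mem_deltaSub hr hg⟩ =
      f.comp (deltaRetr k σ n) (Bar.tprod k r) :=
    congrArg f (deltaRetr_deltaIncl ⟨Bar.tprod k r, tprod_mem_deltaSub hr hg⟩).symm
  rw [h2]
  conv_rhs => rw [h1, hf.comp_deltaRetr_sandwich hw one_mem_component, mul_one]
  rfl

/-- Here the head contains every entry but the last. Total degree 1 forces e to be inverse to the
last degree, so ē r_{n+1} lies in S and can be returned to f. -/
theorem rawCup_deltaAug {f : DeltaN k σ n →ₗ[k] CrossedProduct σ} (hf : IsLin ⊥ f) :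
    rawCup k σ (add_zero n) f (deltaAug k σ) = f := by
  refine DeltaN.hom_ext fun r g hr hg => ?_
  set e := (List.ofFn (headTuple (m := n) le_rfl g 1)).prod with he
  have hlast : e * g (Fin.last _) = 1 := by
    have h1 := prod_headTuple_mul_prod_tailTuple le_rfl (add_zero n) g
    have h2 : (List.ofFn (tailTuple (add_zero n) 1 g)).prod = g (Fin.last _) := by
      simp [List.ofFn_succ, tailTuple]
      rfl
    rwa [h2, hg, ← he] at h1
  have h3 : (List.ofFn (tailTuple (add_zero n) e g)).prod = 1 := by
    rw [← hlast]
    simp [List.ofFn_succ, tailTuple]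
    rfl
  rw [rawCup_tprod (add_zero n) le_rfl hf deltaAug_isLin.bot r g hr hg e he.symm,
    deltaAug_deltaRetr (tailTuple_mem_component _ hr (bar_mem _)) h3]
  set E := bar σ e
  have hw : (E : CrossedProduct σ) * r (Fin.last _) ∈ component σ k 1 := by
    have := mul_mem_component (bar_mem (k := k) (σ := σ) e) (hr (Fin.last _))
    rwa [hlast] at this
  have h1 : r = sandwich 1 ((E : CrossedProduct σ) * r (Fin.last _))
      (headTuple le_rfl r ((E⁻¹ : (CrossedProduct σ)ˣ) : CrossedProduct σ)) := by
    ext j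
    refine Fin.lastCases ?_ (fun j => ?_) j
    · simp [sandwich, headTuple]
    · have h1 := j.2
      have h2 : (j : ℕ) ≠ n + 1 := by omega
      have h3 : (j : ℕ) ≤ n := by omega
      simp only [sandwich, headTuple, Fin.val_castSucc, h2, h3]
      simp
      rfl
  have h2 : f ⟨Bar.tprod k r, tprod_mem_deltaSub hr hg⟩ =
      f.comp (deltaRetr k σ n) (Bar.tprod k r) :=
    congrArg f (deltaRetr_deltaIncl ⟨Bar.tprod k r, tprod_mem_deltaSub hr hg⟩).symm
  rw [h2]
  conv_rhs => rw [h1, hf.comp_deltaRetr_sandwich one_mem_component hw, one_mul]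
  rfl

variable (k σ) in
/-- The unit `u ∈ A(1)`. -/
def unitClass : A k σ (1 : G) := piRes 1 (HHTot.toExt k σ (HHTot.one k (CrossedProduct σ)))

theorem rep_unitClass : Rep (unitClass k σ) 0 (deltaAug k σ) := by
  have h := rep_toExt_one (k := k) (σ := σ)
  have h1 := h.piRes 1
  rwa [proj_comp_of_mem deltaAug_mem] at h1

theorem piRes_toExt_one_of_ne {g : G} (hg : g ≠ 1) :
    piRes g (HHTot.toExt k σ (HHTot.one k (CrossedProduct σ))) = 0 :=
  (rep_toExt_one.piRes g).unique Rep.zero (proj_comp_of_mem_of_ne hg.symm deltaAug_mem)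

theorem centralizer_one : Subgroup.centralizer {(1 : G)} = ⊤ :=
  eq_top_iff.2 fun x _ => mem_centralizer_singleton.2 (by simp)

/-- As C(1) = G, the intersection of centralizers is C(g), so the corestriction is trivial. The
projection is trivial because f already has values in degree g. -/
theorem mMap_unitClass_left {g : G} (α : A k σ g) :
    mMap (one_mul g) (unitClass k σ) α = α := by
  induction α using Rep.induction with
  | h0 => simp only [map_zero]
  | hadd a b ha hb => simp only [map_add, ha, hb]
  | h α n f h =>
    refine (rep_unitClass.mMap (one_mul g) h (zero_add n)).unique h ?_
    rw [deltaAug_rawCup h.isLin.bot, proj_comp_of_mem h.mem, centralizer_one, top_inf_eq,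
      coresMap_self h.isLin]

theorem mMap_unitClass_right {g : G} (α : A k σ g) :
    mMap (mul_one g) α (unitClass k σ) = α := by
  induction α using Rep.induction with
  | h0 => simp only [map_zero, LinearMap.zero_apply]
  | hadd a b ha hb => simp only [map_add, LinearMap.add_apply, ha, hb]
  | h α n f h =>
    refine (h.mMap (mul_one g) rep_unitClass (add_zero n)).unique h ?_
    rw [rawCup_deltaAug h.isLin.bot, proj_comp_of_mem h.mem, centralizer_one, inf_top_eq,
      coresMap_self h.isLin]

/-! ### The isomorphism `A^G ≅ HH^*(R)` -/

variable (k σ) in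
/-- The isomorphism `HH^*(R) ≅ A^G`. -/
def hochEquivInv (hrep : ∀ g : G, ∃! i, IsConj (rep i) g) :
    HHTot k (CrossedProduct σ) ≃ₗ[k] invA k σ :=
  LinearEquiv.ofBijective ((piInv k σ).comp (HHTot.toExt k σ))
    ((piInv_bijective hrep).comp HHTot.toExt_bijective)

theorem hochEquivInv_apply (hrep : ∀ g : G, ∃! i, IsConj (rep i) g)
    (a : HHTot k (CrossedProduct σ)) (g : G) :
    (hochEquivInv k σ hrep a : ∀ g : G, A k σ g) g = piRes g (HHTot.toExt k σ a) :=
  rfl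

theorem hochEquivInv_mul (hrep : ∀ g : G, ∃! i, IsConj (rep i) g)
    (a b : HHTot k (CrossedProduct σ)) :
    (hochEquivInv k σ hrep (HHTot.mul k (CrossedProduct σ) a b) : ∀ g : G, A k σ g) =
      mulA (hochEquivInv k σ hrep a : ∀ g : G, A k σ g)
        (hochEquivInv k σ hrep b : ∀ g : G, A k σ g) := by
  funext g
  rw [hochEquivInv_apply, HHTot.toExt_mul, piRes_mul]
  rfl

theorem hochEquivInv_one (hrep : ∀ g : G, ∃! i, IsConj (rep i) g) :
    (hochEquivInv k σ hrep (HHTot.one k (CrossedProduct σ)) : ∀ g : G, A k σ g) =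
      unitA (unitClass k σ) := by
  classical
  funext g
  rw [hochEquivInv_apply, unitA]
  by_cases hg : g = 1
  · subst hg
    rw [Pi.single_eq_same]
    rfl
  · rw [Pi.single_eq_of_ne hg, piRes_toExt_one_of_ne hg]

end Classes

end CrossedHH

end

/-! ### The theorem assembled. -/

theorem mainTheorem3 {k S G t : Type*} [Field k] [Ring S] [Algebra k S] [Group G] [Fintype G]
    [MulSemiringAction G S] [SMulCommClass G k S] (σ : TwoCocycle G S) [Fintype t] (rep : t → G)
    (hrep : ∀ g : G, ∃! i, IsConj (rep i) g) :
    -- the Hochschild complex is a projective resolution of `R` over `R ⊗ Rᵒᵖ`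
    ((∀ n, Module.Projective (Env k (CrossedProduct σ)) (Bar k (CrossedProduct σ) n)) ∧
      (∀ n, Function.Exact (barD k (CrossedProduct σ) (n + 1)) (barD k (CrossedProduct σ) n)) ∧
      Function.Exact (barD k (CrossedProduct σ) 0) (barAug k (CrossedProduct σ)) ∧
      Function.Surjective (barAug k (CrossedProduct σ))) ∧
    -- the complex `Δ_•` is a projective resolution of `S` over `Δ(H)` for every subgroup `H`
    ((∀ (H : Subgroup G) (n : ℕ), Module.Projective (Delta k σ H) (DeltaN k σ n)) ∧
      (∀ n, Function.Exact (deltaD k σ (n + 1)) (deltaD k σ n)) ∧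
      Function.Exact (deltaD k σ 0) (deltaAug k σ) ∧
      LinearMap.range (deltaAug k σ) = CrossedProduct.component σ k 1) ∧
    -- `HH^*(R)` is an associative algebra with unit
    ((∀ a b c, HHTot.mul k (CrossedProduct σ) (HHTot.mul k (CrossedProduct σ) a b) c =
        HHTot.mul k (CrossedProduct σ) a (HHTot.mul k (CrossedProduct σ) b c)) ∧
      ∀ a, HHTot.mul k (CrossedProduct σ) (HHTot.one k (CrossedProduct σ)) a = a ∧
        HHTot.mul k (CrossedProduct σ) a (HHTot.one k (CrossedProduct σ)) = a) ∧
    -- the restriction map `HH^*(R) → Ext^*_Δ(S, R)` is an isomorphism of algebras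
    (Function.Bijective (HHTot.toExt k σ) ∧
      ∀ a b, HHTot.toExt k σ (HHTot.mul k (CrossedProduct σ) a b) =
        ExtTot.mul ⊤ (HHTot.toExt k σ a) (HHTot.toExt k σ b)) ∧
    -- the maps `γ_i` and `π_i^* ∘ res` give inverse isomorphisms between `⨁ i, A(g_i)` and
    -- `Ext^*_Δ(S, R)`
    ((∀ ζ : ExtTot k σ (⊤ : Subgroup G) ⊤, ∑ i, gamma (rep i) (piRes (rep i) ζ) = ζ) ∧
      ∀ (a : ∀ i, A k σ (rep i)) (i : t), piRes (rep i) (∑ j, gamma (rep j) (a j)) = a i) ∧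
    -- the product formula
    (∀ (i j : t) (D : Finset G),
      (∀ z : G, ∃! x, x ∈ D ∧ z ∈ DoubleCoset.doubleCoset x
        (Subgroup.centralizer {rep i} : Set G) (Subgroup.centralizer {rep j} : Set G)) →
      (∀ x : G, ∃ (κ : t) (y : G),
        (y * rep i * y⁻¹) * ((y * x) * rep j * (y * x)⁻¹) = rep κ) ∧
      ∀ (κ : D → t) (y : D → G)
        (e : ∀ x : D, (y x * rep i * (y x)⁻¹) * ((y x * x) * rep j * (y x * x)⁻¹) = rep (κ x))
        (α : A k σ (rep i)) (β : A k σ (rep j)) (a b : HHTot k (CrossedProduct σ)),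
        HHTot.toExt k σ a = gamma (rep i) α → HHTot.toExt k σ b = gamma (rep j) β →
        HHTot.toExt k σ (HHTot.mul k (CrossedProduct σ) a b) =
          ∑ x : D, gamma (rep (κ x)) (pairing (conjSub_inf_le (e x))
            (conjTo (y x) (rep i) α) (conjTo (y x * x) (rep j) β))) ∧
    -- the maps `c` form a group action, compatible with the maps `m`
    ((∀ (g : G) (e : g = 1 * g * 1⁻¹) (α : A k σ g), cMap 1 e α = α) ∧
      (∀ (x y g g' g'' : G) (e : g' = y * g * y⁻¹) (e' : g'' = x * g' * x⁻¹)
        (e'' : g'' = (x * y) * g * (x * y)⁻¹) (α : A k σ g),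
        cMap x e' (cMap y e α) = cMap (x * y) e'' α) ∧
      ∀ (x h l g h' l' g' : G) (e : h * l = g) (e' : h' * l' = g') (eh : h' = x * h * x⁻¹)
        (el : l' = x * l * x⁻¹) (eg : g' = x * g * x⁻¹) (α : A k σ h) (β : A k σ l),
        cMap x eg (mMap e α β) = mMap e' (cMap x eh α) (cMap x el β)) ∧
    -- the product on `A^G` does not depend on the choice of orbit representatives
    (∀ α ∈ invA k σ, ∀ β ∈ invA k σ, ∀ (g : G) (T : Finset (PairsOf g)),
      (∀ p : PairsOf g, ∃! q, q ∈ T ∧ (pairSetoid g).r p q) →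
      mulA α β g = ∑ q ∈ T, mMap q.2 (α q.1.1) (β q.1.2)) ∧
    -- restriction to the representatives identifies `A^G` with `⨁ i, A(g_i)`
    Function.Bijective (fun (α : invA k σ) (i : t) => (α : ∀ g, A k σ g) (rep i)) ∧
    -- the unit for the maps `m`, and the isomorphism of the algebras `A^G` and `HH^*(R)`
    ∃ u : A k σ (1 : G),
      (∀ (x : G) (e : (1 : G) = x * 1 * x⁻¹), cMap x e u = u) ∧
      (∀ (g : G) (α : A k σ g), mMap (one_mul g) u α = α ∧ mMap (mul_one g) α u = α) ∧
      ∃ (μ : invA k σ →ₗ[k] invA k σ →ₗ[k] invA k σ) (one : invA k σ)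
        (Φ : invA k σ ≃ₗ[k] HHTot k (CrossedProduct σ)),
        (∀ α β : invA k σ, (μ α β : ∀ g, A k σ g) = mulA (α : ∀ g, A k σ g) β) ∧
        (one : ∀ g, A k σ g) = unitA u ∧
        (∀ α β γ : invA k σ, μ (μ α β) γ = μ α (μ β γ)) ∧
        (∀ α : invA k σ, μ one α = α ∧ μ α one = α) ∧
        (∀ α : invA k σ, HHTot.toExt k σ (Φ α) =
          ∑ i, gamma (rep i) ((α : ∀ g, A k σ g) (rep i))) ∧
        (∀ α β : invA k σ, Φ (μ α β) = HHTot.mul k (CrossedProduct σ) (Φ α) (Φ β)) ∧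
        Φ one = HHTot.one k (CrossedProduct σ) := by
  refine ⟨⟨bar_projective, bar_exact, bar_exact_zero, barAug_surjective⟩,
    ⟨delta_projective, delta_exact, delta_exact_zero, range_deltaAug⟩,
    ⟨HHTot.mul_assoc, fun a => ⟨HHTot.one_mul a, HHTot.mul_one a⟩⟩,
    ⟨HHTot.toExt_bijective, HHTot.toExt_mul⟩,
    ⟨sum_gamma_piRes hrep, piRes_sum_gamma hrep⟩, ?_,
    ⟨fun _ => cMap_one, fun _ _ _ _ _ => cMap_cMap, fun _ _ _ _ _ _ _ => cMap_mMap⟩,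
    fun _ hα _ hβ => mulA_eq_sum hα hβ, invA_restrict_bijective hrep,
    -- The class u is a component of a class over Δ(G), and this gives its invariance.
    unitClass k σ, fun _ e => cMap_piRes e _,
    fun _ α => ⟨mMap_unitClass_left α, mMap_unitClass_right α⟩, ?_⟩
  · intro i j D hD
    refine ⟨fun x => ?_, fun κ y e α β a b ha hb => ?_⟩
    -- The index κ is that of the conjugacy class of g_i · xg_jx⁻¹, and y conjugates this product to
    -- the representative.
    · obtain ⟨κ, hκ, -⟩ := hrep (rep i * (x * rep j * x⁻¹))
      obtain ⟨y, hy⟩ := isConj_iff.1 hκ.symm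
      refine ⟨κ, y, ?_⟩
      rw [← hy]
      group
    · rw [HHTot.toExt_mul, ha, hb]
      exact ExtTot.mul_gamma_gamma D hD (fun x => rep (κ x)) y e α β
  -- The product on A^G is defined by transport along Ψ, so associativity, unit laws and
  -- multiplicativity of Φ come from HH^*(R). What needs proof is that it equals `mulA` and that Φ
  -- is given by the maps γ_i.
  · let Ψ := hochEquivInv k σ hrep
    refine ⟨((HHTot.mul k (CrossedProduct σ)).compl₁₂ Ψ.symm.toLinearMap
      Ψ.symm.toLinearMap).compr₂ Ψ.toLinearMap, Ψ (HHTot.one k (CrossedProduct σ)), Ψ.symm,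
      fun α β => ?_, hochEquivInv_one hrep, fun α β γ => ?_, fun α => ?_, fun α => ?_,
      fun α β => Ψ.symm_apply_apply _, Ψ.symm_apply_apply _⟩
    · refine (hochEquivInv_mul hrep (Ψ.symm α) (Ψ.symm β)).trans ?_
      rw [show hochEquivInv k σ hrep (Ψ.symm α) = α from Ψ.apply_symm_apply α,
        show hochEquivInv k σ hrep (Ψ.symm β) = β from Ψ.apply_symm_apply β]
    · simp only [LinearMap.compr₂_apply, LinearMap.compl₁₂_apply, LinearEquiv.coe_coe,
        LinearEquiv.symm_apply_apply, HHTot.mul_assoc]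
    · simp only [LinearMap.compr₂_apply, LinearMap.compl₁₂_apply, LinearEquiv.coe_coe,
        LinearEquiv.symm_apply_apply, HHTot.one_mul, HHTot.mul_one, LinearEquiv.apply_symm_apply,
        and_self]
    -- The class is expanded through its components at the representatives, which are those of α
    -- because Ψ inverts Φ.
    · conv_lhs => rw [← sum_gamma_piRes hrep (HHTot.toExt k σ (Ψ.symm α))]
      have h : hochEquivInv k σ hrep (Ψ.symm α) = α := Ψ.apply_symm_apply α
      simp only [← hochEquivInv_apply hrep, h]
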